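/- Notation. Let $\overline\psi(\hbar^2,z)=\sum_{d\ge 0}\hbar^{2d}\psi_{2d}(z)$ and $\overline y(\hbar^2,z)=\sum_{d\ge 0}\hbar^{2d}y_d(z)$, where each $\psi_{2d}\in\mathbb C[[z]]$ is even and each $y_d\in\mathbb C[[z]]$ is odd; put $\psi=\psi_0$, $y=y_0$. Let $\phi_k$, $k\in\mathbb Z$, be the neutral fermions, $\phi_k\phi_m+\phi_m\phi_k=(-1)^k\delta_{k+m,0}$, acting on the Fock space with basis $\phi_{k_1}\cdots\phi_{k_m}|0\rangle$, $k_1>\dots>k_m\ge 0$, where $\phi_m|0\rangle=0$ for $m<0$; let $\langle 0|a|0\rangle$ be the coefficient of $|0\rangle$ in $a|0\rangle$, and $:\!\phi_k\phi_m\!:\;=\phi_k\phi_m-\langle 0|\phi_k\phi_m|0\rangle$. For odd $k$ let $J_k=\frac12\sum_{m\in\mathbb Z}(-1)^{m+1}:\!\phi_m\phi_{-m-k}\!:$, and let $J_+(\mathbf t)=\sum_{k}t_kJ_k$, $J_-(\mathbf s)=\sum_{k}s_kJ_{-k}$ (sums over odd $k>0$). Define $T_k$, $k\in\mathbb Z$,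 by $T_0=0$, $T_{k+1}-T_k=\overline\psi(\hbar^2,\hbar(k+\tfrac12))$, so that $T_{-k}=-T_k$, and let $\mathcal D=\exp\big(\sum_{k\in\mathbb Z}(-1)^kT_k:\!\phi_k\phi_{-k}\!:\big)$. The hypergeometric 2-BKP tau-function is $$\tau(\mathbf t,\mathbf s)=\langle 0|e^{J_+(\mathbf t)}\,\mathcal D\,e^{J_-(\mathbf s)}|0\rangle .$$ With $s_k=\frac1k[z^k]\overline y(\hbar^2,z)$ for odd $k>0$, put $$H_n^\bullet=\sum_{k_1,\dots,k_n>0\ \mathrm{odd}}\frac{\partial^n\tau(\mathbf t,\hbar^{-1}\mathbf s)}{\partial t_{k_1}\cdots\partial t_{k_n}}\Big|_{\mathbf t=0}\frac{X_1^{k_1}}{k_1}\cdots\frac{X_n^{k_n}}{k_n},$$ let $H_n$, $n\ge1$, be the connected functions obtained from the $H_n^\bullet$ by inclusion-exclusion, put $W_n=D_1\cdots D_nH_n$ with $D_i=X_i\partial_{X_i}$, and let $W_{g,n}\in\mathbb C[[X_1,\dots,X_n]]$ be the coefficient of $\hbar^{2g-2+n}$ in $W_n$. Let $X(z)=z\,e^{-2\psi(y(z))}\in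 z\,\mathbb C[[z]]$, $X_i=X(z_i)$, $Q_i=\frac{z_i}{X_i}\frac{dX_i}{dz_i}$ and $B(z,w)=\frac{zw}{(z-w)^2}+\frac{zw}{(z+w)^2}$, and let $$\omega_{g,n}=2^{1-g}\,W_{g,n}(X_1,\dots,X_n)\prod_{i=1}^n d\log X_i+\delta_{g,0}\delta_{n,2}\,\tfrac12B(X_1,X_2)\,d\log X_1\,d\log X_2 .$$ Theorem. The following identities hold, where both sides are elements (respectively, formal differentials with coefficients) of the field of fractions of $\mathbb C[[z]]$ (for $n=1$, $z=z_1$) or of $\mathbb C[[z_1,z_2]]$ (for $n=2$): $$W_{0,1}(X(z))=\tfrac12\,y(z),\qquad W_{0,2}(X(z_1),X(z_2))=\frac{1}{4Q_1Q_2}B(z_1,z_2)-\frac14B(X_1,X_2),$$ $$\omega_{0,1}=y(z)\,d\log X(z),\qquad \omega_{0,2}=\frac12\left(\frac1{(z_1-z_2)^2}+\frac1{(z_1+z_2)^2}\right)dz_1\,dz_2 .$$ -/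

import Mathlib

namespace BKP

noncomputable section

open scoped Nat

/-! ### Neutral fermions -/

section Fermions

variable (K : Type*) [Field K]

/-- The neutral fermion Fock space. The basis vector indexed by `S = {k₁ > k₂ > ⋯ > kₘ ≥ 0}` is
`φ_{k₁} φ_{k₂} ⋯ φ_{kₘ} |0⟩`. -/
abbrev Fock : Type _ := Finset ℕ →₀ K

/-- The basis vector `φ_{k₁} ⋯ φ_{kₘ} |0⟩` of `S = {k₁ > ⋯ > kₘ}`. -/
def basisVec (S : Finset ℕ) : Fock K := Finsupp.single S 1

/-- The sign picked up when `φ_{±j}` is anticommuted past all `φ_i`, `i ∈ S`, `i > j`. -/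
def fermionSign (j : ℕ) (S : Finset ℕ) : K := (-1) ^ (S.filter (fun i => j < i)).card

/-- The action of `φ_k` on the basis vectors, obtained from `φ_k φ_m + φ_m φ_k = (-1)^k δ_{k+m,0}`
(so `φ_0 ^ 2 = 1/2`) and `φ_m |0⟩ = 0` for `m < 0`. -/
def fermionOnBasis (k : ℤ) (S : Finset ℕ) : Fock K :=
  if 0 < k then
    if k.natAbs ∈ S then 0
    else fermionSign K k.natAbs S • basisVec K (insert k.natAbs S)
  else if k = 0 then
    if 0 ∈ S then ((1 / 2 : K) * fermionSign K 0 S) • basisVec K (S.erase 0)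
    else fermionSign K 0 S • basisVec K (insert 0 S)
  else
    if k.natAbs ∈ S then
      ((-1) ^ k.natAbs * fermionSign K k.natAbs S) • basisVec K (S.erase k.natAbs)
    else 0

/-- The neutral fermion `φ_k`, `k ∈ ℤ`, as an operator on the Fock space. -/
def fermion (k : ℤ) : Module.End K (Fock K) := Finsupp.linearCombination K (fermionOnBasis K k)

/-- The vacuum expectation value `⟨0| a |0⟩`. -/
def vev (a : Module.End K (Fock K)) : K := a (basisVec K ∅) ∅

/-- The normal ordering `:φ_k φ_m: = φ_k φ_m - ⟨0| φ_k φ_m |0⟩`. -/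
def normalOrd (k m : ℤ) : Module.End K (Fock K) :=
  fermion K k * fermion K m - vev K (fermion K k * fermion K m) • 1

/-- The bosonic operator `J_k = ½ ∑_{m ∈ ℤ} (-1)^{m+1} :φ_m φ_{-m-k}:`. On each basis vector only
finitely many summands are nonzero. It is used for odd `k` only. -/
def boson (k : ℤ) : Module.End K (Fock K) :=
  Finsupp.linearCombination K fun S =>
    (1 / 2 : K) • ∑ᶠ m : ℤ, ((-1 : K) ^ (m + 1)) • normalOrd K m (-m - k) (basisVec K S)

variable {K}

/-- The diagonal group element `D = exp (∑_{k ∈ ℤ} (-1)^k T_k :φ_k φ_{-k}:)`, `T_{-k} = -T_k`, in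
terms of the weights `w k = e^{2 T_k}`, `k ≥ 0`. The exponent equals
`2 ∑_{k > 0} (-1)^k T_k φ_k φ_{-k}`, and for `k > 0` the operator `(-1)^k φ_k φ_{-k}` is `1` on the
basis vector of `S` if `k ∈ S` and `0` otherwise; moreover `w 0 = 1` as `T_0 = 0`. -/
def diagonalElement (w : ℕ → K) : Module.End K (Fock K) :=
  Finsupp.linearCombination K fun S => (∏ k ∈ S, w k) • basisVec K S

/-- The coefficient of `∏ u_j ^ (a j)` in `exp (∑_j u_j A_j)`: the sum of `A_{j₁} ⋯ A_{jₗ}` over all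
lists `j₁, …, jₗ` with content `a`, divided by `l!`. -/
def expCoeff (A : ℕ → Module.End K (Fock K)) (a : ℕ →₀ ℕ) : Module.End K (Fock K) :=
  (((Finsupp.toMultiset a).card ! : K)⁻¹) •
    ∑ L ∈ (Finsupp.toMultiset a).lists.toFinset, (L.map A).prod

/-- The hypergeometric tau-function of the 2-BKP hierarchy,
`τ(t, s) = ⟨0| e^{J₊(t)} D e^{J₋(s)} |0⟩`, where `J₊(t) = ∑ t_k J_k` and `J₋(s) = ∑ s_k J_{-k}`
(`k` odd positive). The variables `t_{2j+1}` and `s_{2j+1}` are `Sum.inl j` and `Sum.inr j`. -/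
def tau (w : ℕ → K) : MvPowerSeries (ℕ ⊕ ℕ) K := fun c =>
  vev K (expCoeff (fun j => boson K (2 * j + 1)) (Finsupp.sumFinsuppEquivProdFinsupp c).1 *
    diagonalElement w *
    expCoeff (fun j => boson K (-(2 * j + 1))) (Finsupp.sumFinsuppEquivProdFinsupp c).2)

/-- The power series `τ(t, s)` in `t` alone, for given values `s j` of the variables `s_{2j+1}`.
For a fixed monomial in `t` only finitely many monomials in `s` contribute. -/
def tauAt (w : ℕ → K) (s : ℕ → K) : MvPowerSeries ℕ K := fun a =>
  ∑ᶠ b : ℕ →₀ ℕ,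
    MvPowerSeries.coeff (Finsupp.sumFinsuppEquivProdFinsupp.symm (a, b)) (tau w) *
      b.prod fun j e => s j ^ e

/-- The iterated derivative of a series in `t` with respect to `t_{2j+1}`, `j ∈ L`, at `t = 0`. -/
def derivAtZero (f : MvPowerSeries ℕ K) (L : List ℕ) : K :=
  MvPowerSeries.constantCoeff (L.foldr (fun j g => MvPowerSeries.pderiv K j g) f)

end Fermions

/-! ### The parameters and the correlators -/

/-- Formal Laurent series in `ħ`. -/
abbrev HSeries : Type := LaurentSeries ℂ

/-- The exponential of a formal power series (with arbitrary constant term). -/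
def expSeries (f : PowerSeries ℂ) : PowerSeries ℂ :=
  PowerSeries.C (Complex.exp (PowerSeries.constantCoeff f)) *
    (PowerSeries.exp ℂ).subst (f - PowerSeries.C (PowerSeries.constantCoeff f))

/-- The series `ψ̄(ħ², ħ c)` in `ħ`, where `ψ̄(ħ², z) = ∑_d ħ^{2d} ψ_{2d}(z)` and `psi d = ψ_{2d}`. -/
def psiBarAt (psi : ℕ → PowerSeries ℂ) (c : ℂ) : PowerSeries ℂ :=
  PowerSeries.mk fun N =>
    ∑ d ∈ Finset.range (N / 2 + 1), PowerSeries.coeff (N - 2 * d) (psi d) * c ^ (N - 2 * d)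

/-- `T_k` for `k ≥ 0`: the solution of `T_{k+1} - T_k = ψ̄(ħ², ħ (k + 1/2))`, `T_0 = 0`. -/
def T (psi : ℕ → PowerSeries ℂ) (k : ℕ) : PowerSeries ℂ :=
  ∑ j ∈ Finset.range k, psiBarAt psi ((j : ℂ) + 1 / 2)

/-- The weights `e^{2 T_k}`. -/
def weight (psi : ℕ → PowerSeries ℂ) (k : ℕ) : HSeries :=
  ((expSeries (2 * T psi k) : PowerSeries ℂ) : HSeries)

/-- `s_{2j+1} = (1/(2j+1)) [z^{2j+1}] ȳ(ħ², z)`, where `ȳ(ħ², z) = ∑_d ħ^{2d} y_d(z)`. -/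
def sTime (y : ℕ → PowerSeries ℂ) (j : ℕ) : PowerSeries ℂ :=
  PowerSeries.mk fun N =>
    if Even N then PowerSeries.coeff (2 * j + 1) (y (N / 2)) / (2 * j + 1) else 0

/-- `ħ⁻¹ s_{2j+1}`. -/
def sTimeRescaled (y : ℕ → PowerSeries ℂ) (j : ℕ) : HSeries :=
  HahnSeries.single (-1 : ℤ) (1 : ℂ) * ((sTime y j : PowerSeries ℂ) : HSeries)

variable (psi y : ℕ → PowerSeries ℂ)

/-- The coefficient of `∏_{i ∈ B} X_i^{m i}` in the disconnected function `H^•` of the variables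
`X_i`, `i ∈ B`, where
`H^•_n = ∑_{k₁, …, kₙ odd} (∂ⁿ τ(t, ħ⁻¹ s) / ∂t_{k₁} ⋯ ∂t_{kₙ})|_{t = 0} ∏ X_i^{k_i} / k_i`. -/
def HdiscCoeff {n : ℕ} (B : Finset (Fin n)) (m : Fin n →₀ ℕ) : HSeries :=
  if ∀ i ∈ B, Odd (m i) then
    derivAtZero (tauAt (weight psi) (sTimeRescaled y))
        (((List.finRange n).filter (fun i => i ∈ B)).map fun i => m i / 2) /
      ∏ i ∈ B, (m i : HSeries)
  else 0

/-- The connected `n`-point function `H_n`, `n ≥ 1`, obtained from the disconnected ones by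
inclusion-exclusion over the set partitions of the index set of the variables. -/
def Hconn (n : ℕ) : MvPowerSeries (Fin n) HSeries := fun m =>
  ∑ P : Finpartition (Finset.univ : Finset (Fin n)),
    (-1) ^ (P.parts.card - 1) * ((P.parts.card - 1)! : HSeries) *
      ∏ B ∈ P.parts, HdiscCoeff psi y B m

/-- `W_n = D_1 ⋯ D_n H_n`, `D_i = X_i ∂/∂X_i`. -/
def Wconn (n : ℕ) : MvPowerSeries (Fin n) HSeries := fun m =>
  (∏ i, (m i : HSeries)) * MvPowerSeries.coeff m (Hconn psi y n)

/-- The correlator `W_{g,n}`, defined by `W_n = ∑_g ħ^{2g-2+n} W_{g,n}`. -/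
def W (g n : ℕ) : MvPowerSeries (Fin n) ℂ := fun m =>
  (MvPowerSeries.coeff m (Wconn psi y n)).coeff (2 * (g : ℤ) - 2 + n)

/-! ### The change of variables and the differentials -/

/-- `X(z) = z e^{-2 ψ(y(z))}`, where `ψ = ψ_0` and `y = y_0`. -/
def Xser : PowerSeries ℂ :=
  PowerSeries.X * expSeries (-2 * (psi 0).subst (y 0))

/-- `W_{g,n}(X(z_1), …, X(z_n))` as a power series in `z_1, …, z_n`. -/
def WofZ (g n : ℕ) : MvPowerSeries (Fin n) ℂ :=
  (W psi y g n).subst fun i => (Xser psi y).subst (MvPowerSeries.X i : MvPowerSeries (Fin n) ℂ)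

/-- The field of fractions of `ℂ⟦z_1, …, z_n⟧`. -/
abbrev Frac (n : ℕ) : Type := FractionRing (MvPowerSeries (Fin n) ℂ)

/-- A power series in one variable, evaluated at `z_i`, as an element of the field of fractions. -/
def atZ {n : ℕ} (f : PowerSeries ℂ) (i : Fin n) : Frac n :=
  algebraMap (MvPowerSeries (Fin n) ℂ) (Frac n)
    (f.subst (MvPowerSeries.X i : MvPowerSeries (Fin n) ℂ))

/-- The variable `z_i`. -/
def zVar {n : ℕ} (i : Fin n) : Frac n := atZ PowerSeries.X i

/-- `X_i = X(z_i)`. -/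
def XVar {n : ℕ} (i : Fin n) : Frac n := atZ (Xser psi y) i

/-- `(d log X / dz)(z_i) = X'(z_i) / X(z_i)`. -/
def dlogX {n : ℕ} (i : Fin n) : Frac n :=
  atZ (PowerSeries.derivative ℂ (Xser psi y)) i / XVar psi y i

/-- `Q_i = (z ∂_z log X)(z_i)`. -/
def Q {n : ℕ} (i : Fin n) : Frac n := zVar i * dlogX psi y i

/-- `B(z, w) = zw / (z - w)² + zw / (z + w)²`. -/
def B {F : Type*} [Field F] (z w : F) : F := z * w / (z - w) ^ 2 + z * w / (z + w) ^ 2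

/-- The term `δ_{g,0} δ_{n,2} ½ B(X_1, X_2)`. -/
def omegaShift : (g n : ℕ) → Frac n
  | 0, 2 => 1 / 2 * B (XVar psi y 0) (XVar psi y 1)
  | _, _ => 0

/-- The coefficient of `dz_1 ⋯ dz_n` in the `n`-differential
`ω_{g,n} = (2^{1-g} W_{g,n}(X_1, …, X_n) + δ_{g,0} δ_{n,2} ½ B(X_1, X_2)) d log X_1 ⋯ d log X_n`. -/
def omega (g n : ℕ) : Frac n :=
  ((2 : Frac n) ^ (1 - (g : ℤ)) * algebraMap (MvPowerSeries (Fin n) ℂ) (Frac n) (WofZ psi y g n) +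
      omegaShift psi y g n) * ∏ i, dlogX psi y i

end

end BKP

/-!
Setting `t = 0` after differentiating turns `H_n^•` into vacuum expectations of products of the
bosons `J_k`, conjugated by `D` and commuted repeatedly with `J_-(s)`. Bosons and `D` act on the
linear span of the neutral fermions by explicit weighted shift operators, so by Wick pairing these
expectations are sums over products of shift-matrix entries. The `(m, m - k)` entry has, at leading
order in `ħ`, a symbol in `z = ħ m`: conjugation by `D` contributes `exp(2 ∑ ψ)`, and nested
commutators with `J_-` become the terms of an exponential. This identifies `W_{0,1}` and `W_{0,2}`
with series whose coefficients are `[z^k]` of multiples of `(z / X)^k`. Lagrange inversion for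
`X = z e^{-2ψ(y(z))}` resums them: the first gives `y / 2`; for the second one expands in `z_1`
over the field of fractions in `z_2`, where `B(a, b) = 2 ∑_{n odd} n (a / b)^n`.
-/

namespace BKP

noncomputable section

open scoped Nat

section Fermions

variable {K : Type*} [Field K]

lemma Fock.linearMap_ext {M : Type*} [AddCommMonoid M] [Module K M] {f g : Fock K →ₗ[K] M}
    (h : ∀ S, f (basisVec K S) = g (basisVec K S)) : f = g :=
  Finsupp.lhom_ext' fun S => LinearMap.ext_ring (h S)

lemma basisVec_apply_of_ne {S U : Finset ℕ} (h : U ≠ S) : basisVec K S U = 0 :=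
  Finsupp.single_eq_of_ne h

lemma fermionSign_insert {i j : ℕ} {S : Finset ℕ} (h : i ∉ S) :
    fermionSign K j (insert i S) = (if j < i then -1 else 1) * fermionSign K j S := by
  unfold fermionSign
  rw [Finset.filter_insert]
  split_ifs with hji
  · rw [Finset.card_insert_of_notMem (by simp [h]), pow_succ']
  · rw [one_mul]

lemma fermionSign_erase {i j : ℕ} {S : Finset ℕ} (h : i ∈ S) :
    fermionSign K j (S.erase i) = (if j < i then -1 else 1) * fermionSign K j S := by
  conv_rhs => rw [← Finset.insert_erase h]
  rw [fermionSign_insert (Finset.notMem_erase i S), ← mul_assoc]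
  split_ifs <;> simp

lemma fermionSign_mul_self (j : ℕ) (S : Finset ℕ) :
    fermionSign K j S * fermionSign K j S = 1 := by
  rw [fermionSign, ← mul_pow, neg_one_mul, neg_neg, one_pow]

variable (K)

/-- The operator that adds the mode `j`, with the sign of `fermionSign`; on a basis vector that
already contains `j` it vanishes. The fermions are combinations of `create` and `annihilate`. -/
def create (j : ℕ) : Module.End K (Fock K) :=
  Finsupp.linearCombination K fun S =>
    if j ∈ S then 0 else fermionSign K j S • basisVec K (insert j S)

/-- The operator that removes the mode `j`, with the sign of `fermionSign`; on a basis vector that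
does not contain `j` it vanishes. -/
def annihilate (j : ℕ) : Module.End K (Fock K) :=
  Finsupp.linearCombination K fun S =>
    if j ∈ S then fermionSign K j S • basisVec K (S.erase j) else 0

/-- The vacuum pairing `⟨0| φ_{-b} φ_b |0⟩`, `b ≥ 0`. -/
def pairing (b : ℕ) : K := if b = 0 then 1 / 2 else (-1) ^ b

variable {K}

lemma create_basisVec (j : ℕ) (S : Finset ℕ) : create K j (basisVec K S) =
    if j ∈ S then 0 else fermionSign K j S • basisVec K (insert j S) := by
  simp [create, basisVec]

lemma annihilate_basisVec (j : ℕ) (S : Finset ℕ) : annihilate K j (basisVec K S) =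
    if j ∈ S then fermionSign K j S • basisVec K (S.erase j) else 0 := by
  simp [annihilate, basisVec]

lemma fermion_basisVec (k : ℤ) (S : Finset ℕ) :
    fermion K k (basisVec K S) = fermionOnBasis K k S := by
  simp [fermion, basisVec]

lemma create_mul_create_add_swap (i j : ℕ) :
    create K i * create K j + create K j * create K i = 0 := by
  refine Fock.linearMap_ext fun S => ?_
  simp only [LinearMap.add_apply, Module.End.mul_apply, create_basisVec, LinearMap.zero_apply]
  rcases eq_or_ne i j with rfl | hij
  · by_cases hi : i ∈ S <;> simp [hi, create_basisVec]
  · by_cases hi : i ∈ S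
    · by_cases hj : j ∈ S <;> simp [hi, hj, create_basisVec]
    by_cases hj : j ∈ S
    · simp [hi, hj, create_basisVec]
    simp only [hi, hj, if_false, map_smul, create_basisVec, Finset.mem_insert, hij, hij.symm,
      or_self, fermionSign_insert hi, fermionSign_insert hj, Finset.insert_comm j i]
    rcases lt_or_gt_of_ne hij with h | h <;>
      simp [h, not_lt.2 h.le, smul_smul, mul_comm (fermionSign K i S)]

lemma annihilate_mul_annihilate_add_swap (i j : ℕ) :
    annihilate K i * annihilate K j + annihilate K j * annihilate K i = 0 := by
  refine Fock.linearMap_ext fun S => ?_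
  simp only [LinearMap.add_apply, Module.End.mul_apply, annihilate_basisVec, LinearMap.zero_apply]
  rcases eq_or_ne i j with rfl | hij
  · by_cases hi : i ∈ S <;> simp [hi, annihilate_basisVec]
  · by_cases hi : i ∈ S
    swap
    · by_cases hj : j ∈ S <;> simp [hi, hj, annihilate_basisVec]
    by_cases hj : j ∈ S
    swap
    · simp [hi, hj, annihilate_basisVec]
    simp only [hi, hj, if_true, map_smul, annihilate_basisVec, Finset.mem_erase, ne_eq, hij,
      hij.symm, not_false_eq_true, and_self, fermionSign_erase hi, fermionSign_erase hj,
      Finset.erase_right_comm (a := j)]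
    rcases lt_or_gt_of_ne hij with h | h <;>
      simp [h, not_lt.2 h.le, smul_smul, mul_comm (fermionSign K i S)]

lemma create_mul_annihilate_add_swap (i j : ℕ) :
    create K i * annihilate K j + annihilate K j * create K i = if i = j then 1 else 0 := by
  refine Fock.linearMap_ext fun S => ?_
  simp only [LinearMap.add_apply, Module.End.mul_apply, annihilate_basisVec, create_basisVec]
  rcases eq_or_ne i j with rfl | hij
  · by_cases hi : i ∈ S <;> simp [hi, annihilate_basisVec, create_basisVec, fermionSign_erase,
      fermionSign_insert, smul_smul, fermionSign_mul_self]
  · by_cases hi : i ∈ S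
    · by_cases hj : j ∈ S <;> simp [hi, hj, create_basisVec, hij]
    by_cases hj : j ∈ S
    swap
    · simp [hi, hj, annihilate_basisVec, hij, hij.symm]
    simp only [hi, hj, if_true, if_false, map_smul, annihilate_basisVec, create_basisVec,
      Finset.mem_erase, Finset.mem_insert, and_false, or_true, fermionSign_erase hj,
      fermionSign_insert hi, Finset.erase_insert_of_ne hij, if_neg hij]
    rcases lt_or_gt_of_ne hij with h | h <;>
      simp [h, not_lt.2 h.le, smul_smul, mul_comm (fermionSign K i S)]

lemma fermion_eq_create_add_annihilate (k : ℤ) :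
    fermion K k = (if 0 ≤ k then 1 else 0 : K) • create K k.natAbs +
      (if k ≤ 0 then pairing K k.natAbs else 0) • annihilate K k.natAbs := by
  refine Fock.linearMap_ext fun S => ?_
  simp only [fermion_basisVec, fermionOnBasis, LinearMap.add_apply, LinearMap.smul_apply,
    create_basisVec, annihilate_basisVec, pairing]
  rcases lt_trichotomy k 0 with hk | rfl | hk
  · simp [hk.le, hk.ne, not_lt.2 hk.le, not_le.2 hk, smul_smul]
  · by_cases h : 0 ∈ S <;> simp [h, smul_smul]
  · simp [hk, hk.le, not_le.2 hk]

lemma fermion_eq_create {k : ℕ} (hk : 0 < k) : fermion K k = create K k := by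
  simp [fermion_eq_create_add_annihilate, hk.ne']

lemma fermion_eq_annihilate {k : ℕ} (hk : 0 < k) :
    fermion K (-(k : ℤ)) = (-1 : K) ^ k • annihilate K k := by
  simp [fermion_eq_create_add_annihilate, hk.ne', pairing]

lemma ite_pairing_add_ite_pairing [NeZero (2 : K)] {k m : ℤ} (h : k.natAbs = m.natAbs) :
    (if 0 ≤ k then 1 else 0 : K) * (if m ≤ 0 then pairing K m.natAbs else 0) +
        (if k ≤ 0 then pairing K k.natAbs else 0) * (if 0 ≤ m then 1 else 0) =
      if k + m = 0 then (-1 : K) ^ k else 0 := by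
  obtain ⟨n, rfl | rfl⟩ := k.eq_nat_or_neg <;> obtain ⟨n', rfl | rfl⟩ := m.eq_nat_or_neg <;>
    simp only [Int.natAbs_natCast, Int.natAbs_neg] at h <;> subst h <;>
    rcases eq_or_ne n 0 with rfl | hn <;>
    simp [pairing, *, ← inv_pow, ← two_mul, NeZero.ne (2 : K)]

theorem fermion_anticomm [NeZero (2 : K)] (k m : ℤ) :
    fermion K k * fermion K m + fermion K m * fermion K k =
      if k + m = 0 then (-1 : K) ^ k • 1 else 0 := by
  set c : ℤ → K := fun k => if 0 ≤ k then 1 else 0 with hc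
  set d : ℤ → K := fun k => if k ≤ 0 then pairing K k.natAbs else 0 with hd
  set C := fun k : ℤ => create K k.natAbs with hC
  set A := fun k : ℤ => annihilate K k.natAbs with hA
  have expand : fermion K k * fermion K m + fermion K m * fermion K k =
      (c k * c m) • (C k * C m + C m * C k) + (d k * d m) • (A k * A m + A m * A k) +
        ((c k * d m) • (C k * A m + A m * C k) + (d k * c m) • (C m * A k + A k * C m)) := by
    simp only [fermion_eq_create_add_annihilate, hc, hd, hC, hA, mul_add, add_mul, smul_mul_assoc,
      mul_smul_comm, smul_smul, smul_add]
    module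
  rw [expand]
  simp only [hC, hA, create_mul_create_add_swap, annihilate_mul_annihilate_add_swap,
    create_mul_annihilate_add_swap, smul_zero, zero_add]
  by_cases h : k.natAbs = m.natAbs
  · rw [if_pos h, if_pos h.symm, ← add_smul, ite_pairing_add_ite_pairing h, ite_smul, zero_smul]
  · rw [if_neg h, if_neg (Ne.symm h), if_neg (by omega), smul_zero, smul_zero, add_zero]

lemma fermion_mul_fermion_swap [NeZero (2 : K)] {k m : ℤ} (h : k + m ≠ 0) :
    fermion K k * fermion K m = -(fermion K m * fermion K k) := by
  have := fermion_anticomm (K := K) k m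
  rw [if_neg h] at this
  exact LinearMap.ext fun v => eq_neg_of_add_eq_zero_left (LinearMap.congr_fun this v)

lemma annihilate_apply (j : ℕ) (v : Fock K) (S : Finset ℕ) :
    annihilate K j v S = if j ∈ S then 0 else fermionSign K j S * v (insert j S) := by
  suffices h : Finsupp.lapply S ∘ₗ annihilate K j =
      (if j ∈ S then (0 : K) else fermionSign K j S) • Finsupp.lapply (insert j S) by
    have := LinearMap.congr_fun h v
    simpa only [LinearMap.comp_apply, Finsupp.lapply_apply, LinearMap.smul_apply, smul_eq_mul,
      ite_mul, zero_mul] using this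
  refine Fock.linearMap_ext fun U => ?_
  simp only [LinearMap.comp_apply, annihilate_basisVec, Finsupp.lapply_apply,
    LinearMap.smul_apply, smul_eq_mul]
  by_cases hU : j ∈ U
  · by_cases hS : j ∈ S
    · have : U.erase j ≠ S := fun h => by simp [← h] at hS
      simp [hU, hS, basisVec, this]
    · by_cases h : U = insert j S
      · subst h
        simp [hS, basisVec, fermionSign_insert]
      · have : U.erase j ≠ S := fun h' => h (by rw [← h', Finset.insert_erase hU])
        simp [hU, hS, basisVec, this, h]
  · have : U ≠ insert j S := fun h => hU (by simp [h])
    simp [hU, basisVec, this]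

lemma create_apply_empty (j : ℕ) (v : Fock K) : create K j v ∅ = 0 := by
  suffices h : Finsupp.lapply ∅ ∘ₗ create K j = (0 : Fock K →ₗ[K] K) from LinearMap.congr_fun h v
  refine Fock.linearMap_ext fun U => ?_
  simp only [LinearMap.comp_apply, create_basisVec, Finsupp.lapply_apply, LinearMap.zero_apply]
  by_cases hU : j ∈ U <;> simp [hU, basisVec]

lemma fermion_apply_empty_of_pos {k : ℤ} (hk : 0 < k) (v : Fock K) : fermion K k v ∅ = 0 := by
  lift k to ℕ using hk.le
  rw [fermion_eq_create (by exact_mod_cast hk), create_apply_empty]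

lemma fermion_basisVec_of_neg {k : ℤ} {S : Finset ℕ} (hk : k < 0) (h : k.natAbs ∉ S) :
    fermion K k (basisVec K S) = 0 := by
  rw [fermion_basisVec, fermionOnBasis, if_neg (by omega), if_neg (by omega), if_neg h]

lemma fermion_vacuum (k : ℤ) :
    fermion K k (basisVec K ∅) = if 0 ≤ k then basisVec K {k.natAbs} else 0 := by
  simp only [fermion_eq_create_add_annihilate, LinearMap.add_apply, LinearMap.smul_apply,
    create_basisVec, annihilate_basisVec]
  split_ifs <;> simp_all [fermionSign]

lemma basisVec_insert {a : ℕ} {S : Finset ℕ} (ha : 0 < a) (h : ∀ i ∈ S, i < a) :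
    basisVec K (insert a S) = fermion K a (basisVec K S) := by
  have notMem : a ∉ S := fun h' => lt_irrefl _ (h a h')
  have noLarger : S.filter (fun i => a < i) = ∅ :=
    Finset.filter_eq_empty_iff.2 fun i hi => not_lt.2 (h i hi).le
  rw [fermion_eq_create ha, create_basisVec, if_neg notMem, fermionSign, noLarger,
    Finset.card_empty, pow_zero, one_smul]

lemma fermion_basisVec_singleton_apply_empty (i : ℤ) (b : ℕ) :
    fermion K i (basisVec K {b}) ∅ = if i = -b then pairing K b else 0 := by
  rw [fermion_eq_create_add_annihilate, LinearMap.add_apply, LinearMap.smul_apply,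
    LinearMap.smul_apply, Finsupp.add_apply, Finsupp.smul_apply, Finsupp.smul_apply,
    create_apply_empty, annihilate_apply]
  by_cases h : i = -b
  · subst h; simp [basisVec, fermionSign]
  · have : i ≤ 0 → b ≠ i.natAbs := by omega
    by_cases hi : i ≤ 0 <;> simp [hi, h, basisVec, this]

lemma vev_fermion_mul_fermion {k m : ℤ} (h : k + m ≠ 0) :
    vev K (fermion K k * fermion K m) = 0 := by
  rw [vev, Module.End.mul_apply, fermion_vacuum]
  split_ifs with hm
  · rw [fermion_basisVec_singleton_apply_empty, if_neg (by omega)]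
  · rw [map_zero, Finsupp.zero_apply]

lemma normalOrd_eq_mul {k m : ℤ} (h : k + m ≠ 0) :
    normalOrd K k m = fermion K k * fermion K m := by
  rw [normalOrd, vev_fermion_mul_fermion h, zero_smul]
  exact sub_zero (fermion K k * fermion K m)

end Fermions

section Diagonal

variable {K : Type*} [Field K]

lemma diagonalElement_basisVec (w : ℕ → K) (S : Finset ℕ) :
    diagonalElement w (basisVec K S) = (∏ k ∈ S, w k) • basisVec K S := by
  simp [diagonalElement, basisVec]

lemma diagonalElement_apply (w : ℕ → K) (v : Fock K) (S : Finset ℕ) :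
    diagonalElement w v S = (∏ k ∈ S, w k) * v S := by
  suffices h : Finsupp.lapply S ∘ₗ diagonalElement w = (∏ k ∈ S, w k) • Finsupp.lapply S from
    LinearMap.congr_fun h v
  refine Fock.linearMap_ext fun U => ?_
  simp only [LinearMap.comp_apply, diagonalElement_basisVec, map_smul, LinearMap.smul_apply]
  by_cases h : U = S <;> simp [basisVec, h]

lemma diagonalElement_mul (w w' : ℕ → K) :
    diagonalElement w * diagonalElement w' = diagonalElement (w * w') := by
  refine Fock.linearMap_ext fun S => ?_
  simp only [Module.End.mul_apply, diagonalElement_basisVec, map_smul, smul_smul, Pi.mul_apply,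
    Finset.prod_mul_distrib, mul_comm]

lemma diagonalElement_one : diagonalElement (1 : ℕ → K) = 1 := by
  refine Fock.linearMap_ext fun S => ?_
  simp [diagonalElement_basisVec]

lemma diagonalElement_mul_create (w : ℕ → K) (j : ℕ) :
    diagonalElement w * create K j = w j • (create K j * diagonalElement w) := by
  refine Fock.linearMap_ext fun S => ?_
  simp only [Module.End.mul_apply, LinearMap.smul_apply, diagonalElement_basisVec, map_smul,
    create_basisVec]
  split_ifs with h
  · simp
  · rw [map_smul, diagonalElement_basisVec, Finset.prod_insert h, smul_smul, smul_smul, smul_smul]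
    ring_nf

lemma smul_diagonalElement_mul_annihilate (w : ℕ → K) (j : ℕ) :
    w j • (diagonalElement w * annihilate K j) = annihilate K j * diagonalElement w := by
  refine Fock.linearMap_ext fun S => ?_
  simp only [Module.End.mul_apply, LinearMap.smul_apply, diagonalElement_basisVec, map_smul,
    annihilate_basisVec]
  split_ifs with h
  · rw [map_smul, diagonalElement_basisVec, ← Finset.mul_prod_erase S w h, smul_smul, smul_smul,
      smul_smul]
    ring_nf
  · simp

/-- The weights of `diagonalElement w` extended to all integers by `w (-k) = (w k)⁻¹`. They are the
factors by which conjugation with `diagonalElement w` rescales the fermions. -/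
def weightInt (w : ℕ → K) (j : ℤ) : K := if 0 ≤ j then w j.natAbs else (w j.natAbs)⁻¹

lemma diagonalElement_mul_fermion {w : ℕ → K} (h0 : w 0 * w 0 = 1) (hw : ∀ k, w k ≠ 0) (j : ℤ) :
    diagonalElement w * fermion K j = weightInt w j • (fermion K j * diagonalElement w) := by
  have annihilate_comm (a : ℕ) :
      diagonalElement w * annihilate K a = (w a)⁻¹ • (annihilate K a * diagonalElement w) := by
    rw [← smul_diagonalElement_mul_annihilate, inv_smul_smul₀ (hw a)]
  have inv_zero : (w 0)⁻¹ = w 0 := inv_eq_of_mul_eq_one_left h0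
  rw [fermion_eq_create_add_annihilate, mul_add, mul_smul_comm, mul_smul_comm,
    diagonalElement_mul_create, annihilate_comm, add_mul, smul_mul_assoc, smul_mul_assoc, smul_add,
    weightInt]
  rcases lt_trichotomy j 0 with hj | rfl | hj
  · simp [not_le.2 hj, hj.le, smul_smul, mul_comm]
  · simp [inv_zero, smul_smul, mul_comm]
  · simp [hj.le, not_le.2 hj]

lemma weightInt_neg_one (j : ℤ) : weightInt (fun _ => (-1 : K)) j = -1 := by
  simp [weightInt, inv_neg]

lemma weightInt_pow (t : K) (j : ℤ) : weightInt (fun k => t ^ k) j = t ^ j := by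
  unfold weightInt
  split_ifs with hj
  · beta_reduce
    rw [← zpow_natCast, Int.natAbs_of_nonneg hj]
  · beta_reduce
    rw [← zpow_natCast, ← zpow_neg, Int.ofNat_natAbs_of_nonpos (by omega), neg_neg]

end Diagonal

section Quadratic

variable {K : Type*} [Field K]

/-- The field `∑ x_j φ_j` of a finitely supported sequence. -/
def field : (ℤ →₀ K) →ₗ[K] Module.End K (Fock K) := Finsupp.linearCombination K (fermion K)

lemma field_single (j : ℤ) (c : K) : field (Finsupp.single j c) = c • fermion K j := by
  simp [field]

lemma field_singleton_apply_empty (x : ℤ →₀ K) (b : ℕ) :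
    field x (basisVec K {b}) ∅ = x (-b) * pairing K b := by
  induction x using Finsupp.induction_linear with
  | zero => simp
  | add x y hx hy => simp only [map_add, LinearMap.add_apply, Finsupp.add_apply, hx, hy, add_mul]
  | single j c =>
    rw [field_single, LinearMap.smul_apply, Finsupp.smul_apply,
      fermion_basisVec_singleton_apply_empty, Finsupp.single_apply]
    split_ifs <;> simp

lemma field_vacuum_apply_singleton (x : ℤ →₀ K) (b : ℕ) :
    field x (basisVec K ∅) {b} = x b := by
  induction x using Finsupp.induction_linear with
  | zero => simp
  | add x y hx hy => simp only [map_add, LinearMap.add_apply, Finsupp.add_apply, hx, hy]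
  | single j c =>
    rw [field_single, LinearMap.smul_apply, Finsupp.smul_apply, fermion_vacuum,
      Finsupp.single_apply]
    by_cases hj : 0 ≤ j
    · have : j.natAbs = b ↔ j = b := by omega
      by_cases h : j = b <;> simp [hj, basisVec, this, h]
    · have : j ≠ b := by omega
      simp [hj, this]

lemma field_vacuum_apply_of_ne_singleton (x : ℤ →₀ K) {S : Finset ℕ} (hS : ∀ b, S ≠ {b}) :
    field x (basisVec K ∅) S = 0 := by
  induction x using Finsupp.induction_linear with
  | zero => simp
  | add x y hx hy => simp only [map_add, LinearMap.add_apply, Finsupp.add_apply, hx, hy, add_zero]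
  | single j c =>
    rw [field_single, LinearMap.smul_apply, Finsupp.smul_apply, fermion_vacuum]
    split_ifs
    · simp [basisVec, (hS j.natAbs).symm]
    · simp

/-- `P` is even and `[P, ∑ x_j φ_j] = ∑ (A x)_j φ_j`: the operator `P` behaves like a combination
of bilinears `φ_i φ_j`, with one-particle action `A`. Evenness is commutation with the fermion
parity, which is the diagonal element with all weights `-1`. -/
structure IsQuad (P : Module.End K (Fock K)) (A : Module.End K (ℤ →₀ K)) : Prop where
  comm : ∀ x, P * field x = field x * P + field (A x)
  even : diagonalElement (fun _ => -1) * P = P * diagonalElement fun _ => -1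

variable {P P' : Module.End K (Fock K)} {A A' : Module.End K (ℤ →₀ K)}

namespace IsQuad

lemma of_comm_fermion
    (h : ∀ j, P * fermion K j = fermion K j * P + field (A (Finsupp.single j 1)))
    (even : diagonalElement (fun _ => -1) * P = P * diagonalElement fun _ => -1) : IsQuad P A := by
  refine ⟨fun x => ?_, even⟩
  induction x using Finsupp.induction_linear with
  | zero => simp
  | add x y hx hy => simp only [map_add, mul_add, add_mul, hx, hy]; abel
  | single j c =>
    have : Finsupp.single j c = c • Finsupp.single j (1 : K) := by simp
    rw [this, map_smul, map_smul, map_smul, field_single, one_smul, mul_smul_comm, h, smul_add,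
      smul_mul_assoc]

lemma comm_fermion (h : IsQuad P A) (j : ℤ) :
    P * fermion K j = fermion K j * P + field (A (Finsupp.single j 1)) := by
  have := h.comm (Finsupp.single j 1)
  rwa [field_single, one_smul] at this

lemma add (h : IsQuad P A) (h' : IsQuad P' A') : IsQuad (P + P') (A + A') :=
  ⟨fun x => by simp only [add_mul, mul_add, LinearMap.add_apply, map_add, h.comm, h'.comm]; abel,
    by rw [add_mul, mul_add, h.even, h'.even]⟩

lemma smul (h : IsQuad P A) (c : K) : IsQuad (c • P) (c • A) :=
  ⟨fun x => by
    simp only [smul_mul_assoc, mul_smul_comm, LinearMap.smul_apply, map_smul, h.comm, smul_add],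
    by rw [smul_mul_assoc, mul_smul_comm, h.even]⟩

lemma zero : IsQuad (0 : Module.End K (Fock K)) 0 := ⟨fun x => by simp, by simp⟩

lemma sum {ι : Type*} (s : Finset ι) {P : ι → Module.End K (Fock K)}
    {A : ι → Module.End K (ℤ →₀ K)} (h : ∀ i ∈ s, IsQuad (P i) (A i)) :
    IsQuad (∑ i ∈ s, P i) (∑ i ∈ s, A i) := by
  classical
  induction s using Finset.induction_on with
  | empty => simpa using zero
  | insert i s hi ih =>
    rw [Finset.sum_insert hi, Finset.sum_insert hi]
    exact (h i (by simp)).add (ih fun j hj => h j (by simp [hj]))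

lemma commutator (h : IsQuad P A) (h' : IsQuad P' A') :
    IsQuad (P * P' - P' * P) (A * A' - A' * A) := by
  refine ⟨fun x => LinearMap.ext fun v => ?_, LinearMap.ext fun v => ?_⟩
  · have comm (x v) : P (field x v) = field x (P v) + field (A x) v :=
      LinearMap.congr_fun (h.comm x) v
    have comm' (x v) : P' (field x v) = field x (P' v) + field (A' x) v :=
      LinearMap.congr_fun (h'.comm x) v
    simp only [Module.End.mul_apply, LinearMap.sub_apply, LinearMap.add_apply, comm, comm', map_add,
      map_sub]
    abel
  · have even (v) := LinearMap.congr_fun h.even v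
    have even' (v) := LinearMap.congr_fun h'.even v
    simp only [Module.End.mul_apply] at even even'
    simp only [Module.End.mul_apply, LinearMap.sub_apply, map_sub, even, even']

lemma apply_vacuum_apply_insert (h : IsQuad P A) {a : ℕ} {S : Finset ℕ} (ha : 0 < a)
    (hS : ∀ i ∈ S, i < a) : P (basisVec K ∅) (insert a S) =
      -(-1) ^ a * field (A (Finsupp.single (-a : ℤ) 1)) (basisVec K ∅) S := by
  have notMem : a ∉ S := fun h' => lt_irrefl _ (hS a h')
  have noLarger : S.filter (fun i => a < i) = ∅ :=
    Finset.filter_eq_empty_iff.2 fun i hi => not_lt.2 (hS i hi).le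
  have comm := DFunLike.congr_fun (LinearMap.congr_fun (h.comm_fermion (-a)) (basisVec K ∅)) S
  rw [Module.End.mul_apply, fermion_basisVec_of_neg (by omega) (by simp), map_zero,
    LinearMap.add_apply, Finsupp.add_apply, Module.End.mul_apply, fermion_eq_annihilate ha,
    LinearMap.smul_apply, Finsupp.smul_apply, annihilate_apply, if_neg notMem, fermionSign,
    noLarger, Finset.card_empty, pow_zero, one_mul, smul_eq_mul, Finsupp.zero_apply] at comm
  have sign_sq : ((-1 : K) ^ a) * (-1) ^ a = 1 := by rw [← mul_pow]; simp
  linear_combination -(-1) ^ a * comm - P (basisVec K ∅) (insert a S) * sign_sq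

lemma apply_vacuum_apply_zero [NeZero (2 : K)] (h : IsQuad P A) : P (basisVec K ∅) {0} = 0 := by
  have even := DFunLike.congr_fun (LinearMap.congr_fun h.even (basisVec K ∅)) {0}
  rw [Module.End.mul_apply, Module.End.mul_apply, diagonalElement_basisVec, diagonalElement_apply,
    Finset.prod_singleton, Finset.prod_empty, one_smul] at even
  have : (2 : K) * P (basisVec K ∅) {0} = 0 := by linear_combination -even
  exact (mul_eq_zero.1 this).resolve_left (NeZero.ne 2)

lemma apply_basisVec_insert_apply_empty (h : IsQuad P A) {a : ℕ} (ha : 0 < a) {S : Finset ℕ}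
    (hS : ∀ i ∈ S, i < a) : P (basisVec K (insert a S)) ∅ =
      field (A (Finsupp.single (a : ℤ) 1)) (basisVec K S) ∅ := by
  rw [basisVec_insert ha hS, ← Module.End.mul_apply, h.comm_fermion, LinearMap.add_apply,
    Finsupp.add_apply, Module.End.mul_apply, fermion_apply_empty_of_pos (by omega), zero_add]

end IsQuad

lemma insert_eq_insert_iff_of_lt {α : Type*} [LinearOrder α] {a a' : α} {S S' : Finset α}
    (hS : ∀ i ∈ S, i < a) (hS' : ∀ i ∈ S', i < a') :
    insert a S = insert a' S' ↔ a = a' ∧ S = S' := by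
  refine ⟨fun h => ?_, fun ⟨h, h'⟩ => h ▸ h' ▸ rfl⟩
  have le_a' : a ≤ a' := by
    have : a ∈ insert a' S' := h ▸ Finset.mem_insert_self a S
    exact (Finset.mem_insert.1 this).elim le_of_eq fun h => (hS' a h).le
  have a'_le : a' ≤ a := by
    have : a' ∈ insert a S := h ▸ Finset.mem_insert_self a' S'
    exact (Finset.mem_insert.1 this).elim le_of_eq fun h => (hS a' h).le
  obtain rfl := le_antisymm le_a' a'_le
  refine ⟨rfl, ?_⟩
  rw [← Finset.erase_insert fun h => lt_irrefl a (hS a h), h,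
    Finset.erase_insert fun h => lt_irrefl a (hS' a h)]

lemma sum_smul_basisVec_pair_apply (N : ℕ) (c : ℕ → ℕ → K) {a : ℕ} {S : Finset ℕ}
    (hS : ∀ i ∈ S, i < a) :
    (∑ a' ∈ Finset.range N, ∑ b ∈ Finset.range a', c a' b • basisVec K (insert a' {b}))
        (insert a S) =
      if a < N then ∑ b ∈ Finset.range a, if S = {b} then c a b else 0 else 0 := by
  have apply (a' b : ℕ) (hb : b ∈ Finset.range a') :
      (c a' b • basisVec K (insert a' {b})) (insert a S) =
        if a' = a then if S = {b} then c a b else 0 else 0 := by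
    have pair_iff : insert a' {b} = insert a S ↔ a' = a ∧ {b} = S :=
      insert_eq_insert_iff_of_lt (by simpa using hb) hS
    simp only [Finsupp.smul_apply, basisVec, Finsupp.single_apply, pair_iff, ← ite_and,
      eq_comm (a := S)]
    split_ifs with h
    · rw [h.1, smul_eq_mul, mul_one]
    · rw [smul_zero]
  simp only [Finsupp.finsetSum_apply]
  rw [Finset.sum_congr rfl fun a' _ => Finset.sum_congr rfl (apply a')]
  simp only [Finset.sum_ite_irrel, Finset.sum_const_zero, Finset.sum_ite_eq', Finset.mem_range]

lemma IsQuad.apply_vacuum [NeZero (2 : K)] (h : IsQuad P A) (N : ℕ)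
    (hN : ∀ a b : ℕ, N ≤ a → A (Finsupp.single (-a : ℤ) 1) b = 0) :
    P (basisVec K ∅) = vev K P • basisVec K ∅ + ∑ a ∈ Finset.range N, ∑ b ∈ Finset.range a,
      (-(-1) ^ a * A (Finsupp.single (-a : ℤ) 1) b) • basisVec K (insert a {b}) := by
  ext T
  rw [Finsupp.add_apply, Finsupp.smul_apply]
  rcases T.eq_empty_or_nonempty with rfl | hT
  · simp [vev, basisVec]
  obtain ⟨a, S, hS, rfl⟩ : ∃ a S, (∀ i ∈ S, i < a) ∧ T = insert a S :=
    ⟨T.max' hT, T.erase (T.max' hT), fun i hi => T.lt_max'_of_mem_erase_max' hT hi,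
      (Finset.insert_erase (T.max'_mem hT)).symm⟩
  rw [sum_smul_basisVec_pair_apply N _ hS, basisVec_apply_of_ne (by simp), smul_zero, zero_add]
  rcases a.eq_zero_or_pos with rfl | ha
  · obtain rfl : S = ∅ := Finset.eq_empty_of_forall_notMem fun i hi => by simpa using hS i hi
    simpa using h.apply_vacuum_apply_zero
  rw [h.apply_vacuum_apply_insert ha hS]
  by_cases hSb : ∃ b, S = {b}
  · obtain ⟨b, rfl⟩ := hSb
    have hb : b < a := hS b (Finset.mem_singleton_self b)
    rw [field_vacuum_apply_singleton]
    by_cases haN : a < N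
    · simp [haN, Finset.singleton_inj, hb]
    · simp [haN, hN a b (not_lt.1 haN)]
  · push Not at hSb
    rw [field_vacuum_apply_of_ne_singleton _ hSb]
    simp [hSb]

lemma IsQuad.eq_zero [NeZero (2 : K)] (h : IsQuad P 0) (h0 : vev K P = 0) : P = 0 := by
  have vacuum : P (basisVec K ∅) = 0 := by
    simpa [h0] using h.apply_vacuum 0 (by simp)
  refine Fock.linearMap_ext fun S => ?_
  rw [LinearMap.zero_apply]
  induction S using Finset.induction_on_max with
  | empty => exact vacuum
  | insert a S hS ih =>
    have comm (j : ℤ) (v : Fock K) (hv : P v = 0) : P (fermion K j v) = 0 := by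
      rw [← Module.End.mul_apply, h.comm_fermion, LinearMap.zero_apply, map_zero, add_zero,
        Module.End.mul_apply, hv, map_zero]
    rcases a.eq_zero_or_pos with rfl | ha
    · obtain rfl : S = ∅ := Finset.eq_empty_of_forall_notMem fun i hi => by simpa using hS i hi
      have zero_mode : fermion K 0 (basisVec K ∅) = basisVec K (insert 0 ∅) := by
        simpa using fermion_vacuum (K := K) 0
      exact zero_mode ▸ comm 0 _ vacuum
    · rw [basisVec_insert ha hS]
      exact comm a _ ih

/-- Wick's theorem for two quadratic operators. -/
theorem IsQuad.vev_mul [NeZero (2 : K)] (h : IsQuad P A) (h' : IsQuad P' A') (N : ℕ)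
    (hN : ∀ a b : ℕ, N ≤ a → A' (Finsupp.single (-a : ℤ) 1) b = 0) :
    vev K (P * P') = vev K P * vev K P' + ∑ a ∈ Finset.range N, ∑ b ∈ Finset.range a,
      -(-1) ^ a * pairing K b *
        (A (Finsupp.single (a : ℤ) 1) (-b) * A' (Finsupp.single (-a : ℤ) 1) b) := by
  rw [vev, Module.End.mul_apply, h'.apply_vacuum N hN, map_add, map_smul, Finsupp.add_apply,
    Finsupp.smul_apply, smul_eq_mul, mul_comm, ← vev]
  congr 1
  simp only [map_sum, map_smul, Finsupp.finsetSum_apply, Finsupp.smul_apply, smul_eq_mul]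
  refine Finset.sum_congr rfl fun a _ => Finset.sum_congr rfl fun b hb => ?_
  have hb : b < a := Finset.mem_range.1 hb
  rw [h.apply_basisVec_insert_apply_empty (by omega) (by simpa using hb),
    field_singleton_apply_empty]
  ring

end Quadratic

section Bosons

variable {K : Type*} [Field K]

/-- The truncation of `J_k`, `k ≠ 0`, to the summands with `|m| ≤ M`. -/
def bosonTrunc (K : Type*) [Field K] (k : ℤ) (M : ℕ) : Module.End K (Fock K) :=
  (1 / 2 : K) • ∑ m ∈ Finset.Icc (-M : ℤ) M,
    ((-1 : K) ^ (m + 1)) • (fermion K m * fermion K (-m - k))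

lemma ne_zero_of_odd {k : ℤ} (hk : Odd k) : k ≠ 0 := by
  rintro rfl
  simp at hk

section Truncation

variable [NeZero (2 : K)] {k : ℤ}

lemma fermion_fermion_basisVec_eq_zero {m : ℤ} {S : Finset ℕ} (hk : k ≠ 0)
    (hm : k.natAbs + S.sup id < m.natAbs) :
    fermion K m (fermion K (-m - k) (basisVec K S)) = 0 := by
  have annihilated (n : ℤ) (hn : n < 0) (hS : S.sup id < n.natAbs) :
      fermion K n (basisVec K S) = 0 := by
    refine fermion_basisVec_of_neg hn fun h => ?_
    have : n.natAbs ≤ S.sup id := Finset.le_sup (f := id) h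
    omega
  rcases lt_or_ge m 0 with h | h
  · rw [← Module.End.mul_apply, fermion_mul_fermion_swap (by omega), LinearMap.neg_apply,
      Module.End.mul_apply, annihilated m h (by omega), map_zero, neg_zero]
  · rw [annihilated (-m - k) (by omega) (by omega), map_zero]

lemma boson_basisVec (hk : k ≠ 0) (S : Finset ℕ) {M : ℕ} (hM : k.natAbs + S.sup id ≤ M) :
    boson K k (basisVec K S) = bosonTrunc K k M (basisVec K S) := by
  have normalOrd_eq (m : ℤ) : normalOrd K m (-m - k) = fermion K m * fermion K (-m - k) :=
    normalOrd_eq_mul (by omega)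
  have boson_eq : boson K k (basisVec K S) = (1 / 2 : K) • ∑ᶠ m : ℤ,
      ((-1 : K) ^ (m + 1)) • (fermion K m * fermion K (-m - k)) (basisVec K S) := by
    simp [boson, basisVec, normalOrd_eq]
  rw [boson_eq, finsum_eq_sum_of_support_subset (s := Finset.Icc (-M : ℤ) M)]
  · simp [bosonTrunc]
  · intro m hm
    by_contra hm'
    rw [Finset.coe_Icc, Set.mem_Icc] at hm'
    refine hm ?_
    beta_reduce
    rw [Module.End.mul_apply, fermion_fermion_basisVec_eq_zero hk (by omega), smul_zero]

lemma eventually_boson_eq (hk : k ≠ 0) (v : Fock K) :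
    ∀ᶠ M in Filter.atTop, boson K k v = bosonTrunc K k M v := by
  induction v using Finsupp.induction_linear with
  | zero => simp
  | add x y hx hy =>
    filter_upwards [hx, hy] with M hx hy
    rw [map_add, map_add, hx, hy]
  | single S c =>
    filter_upwards [Filter.eventually_ge_atTop (k.natAbs + S.sup id)] with M hM
    have : Finsupp.single S c = c • basisVec K S := by simp [basisVec]
    rw [this, map_smul, map_smul, boson_basisVec hk S hM]

lemma fermion_fermion_apply (m j : ℤ) (v : Fock K) :
    fermion K m (fermion K j v) =
      (if m + j = 0 then (-1 : K) ^ m else 0) • v - fermion K j (fermion K m v) := by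
  have := LinearMap.congr_fun (fermion_anticomm (K := K) m j) v
  rw [eq_sub_iff_add_eq]
  split_ifs at this ⊢ <;> simpa using this

lemma bilinear_mul_fermion (m n j : ℤ) :
    fermion K m * fermion K n * fermion K j = fermion K j * (fermion K m * fermion K n) +
      ((if n + j = 0 then (-1 : K) ^ n else 0) • fermion K m +
        (if m + j = 0 then -(-1 : K) ^ m else 0) • fermion K n) := by
  refine LinearMap.ext fun v => ?_
  have neg_ite : (if m + j = 0 then -(-1 : K) ^ m else 0) =
      -(if m + j = 0 then (-1 : K) ^ m else 0) := by split_ifs <;> simp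
  simp only [Module.End.mul_apply, LinearMap.add_apply, LinearMap.smul_apply, neg_ite]
  rw [fermion_fermion_apply n j, map_sub, map_smul, fermion_fermion_apply m j]
  module

lemma bosonTrunc_mul_fermion (hk : Odd k) (j : ℤ) {M : ℕ} (hM : j.natAbs + k.natAbs ≤ M) :
    bosonTrunc K k M * fermion K j = fermion K j * bosonTrunc K k M + fermion K (j - k) := by
  have sign_left : (-1 : K) ^ (j - k + 1) * (-1) ^ (-(j - k) - k) = 1 := by
    rw [← zpow_add₀ (by simp), Even.neg_one_zpow]
    obtain ⟨c, rfl⟩ := hk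
    exact ⟨-c, by ring⟩
  have sign_right : (-1 : K) ^ (-j + 1) * -(-1) ^ (-j) = 1 := by
    rw [mul_neg, ← zpow_add₀ (by simp), Odd.neg_one_zpow ⟨-j, by ring⟩, neg_neg]
  have left_iff (m : ℤ) : -m - k + j = 0 ↔ m = j - k := by omega
  have right_iff (m : ℤ) : m + j = 0 ↔ m = -j := by omega
  have left_mem : j - k ∈ Finset.Icc (-M : ℤ) M := by rw [Finset.mem_Icc]; omega
  have right_mem : -j ∈ Finset.Icc (-M : ℤ) M := by rw [Finset.mem_Icc]; omega
  simp only [bosonTrunc, smul_mul_assoc, mul_smul_comm, Finset.sum_mul, Finset.mul_sum,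
    bilinear_mul_fermion, left_iff, right_iff, smul_add, Finset.sum_add_distrib, ite_smul,
    smul_ite, smul_zero, zero_smul, Finset.sum_ite_eq', left_mem, right_mem, if_true]
  simp only [smul_smul, sign_left, sign_right, show -(-j) - k = j - k by ring, mul_one]
  rw [← add_smul, add_halves, one_smul]

lemma boson_mul_fermion (hk : Odd k) (j : ℤ) :
    boson K k * fermion K j = fermion K j * boson K k + fermion K (j - k) := by
  refine LinearMap.ext fun v => ?_
  obtain ⟨M, hv, hjv, hM⟩ := ((eventually_boson_eq (ne_zero_of_odd hk) v).and
    ((eventually_boson_eq (ne_zero_of_odd hk) (fermion K j v)).and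
      (Filter.eventually_ge_atTop (j.natAbs + k.natAbs)))).exists
  rw [LinearMap.add_apply, Module.End.mul_apply, Module.End.mul_apply, hv, hjv]
  exact LinearMap.congr_fun (bosonTrunc_mul_fermion hk j hM) v

lemma mul_boson_of_mul_bilinear (hk : k ≠ 0) {X : Module.End K (Fock K)} {c : K}
    (h : ∀ m, X * (fermion K m * fermion K (-m - k)) =
      c • (fermion K m * fermion K (-m - k) * X)) :
    X * boson K k = c • (boson K k * X) := by
  have trunc (M : ℕ) : X * bosonTrunc K k M = c • (bosonTrunc K k M * X) := by
    simp only [bosonTrunc, smul_mul_assoc, mul_smul_comm, Finset.sum_mul, Finset.mul_sum, h,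
      Finset.smul_sum, smul_comm c]
  refine LinearMap.ext fun v => ?_
  obtain ⟨M, hv, hXv⟩ :=
    ((eventually_boson_eq hk v).and (eventually_boson_eq hk (X v))).exists
  rw [LinearMap.smul_apply, Module.End.mul_apply, Module.End.mul_apply, hv, hXv]
  exact LinearMap.congr_fun (trunc M) v

lemma boson_apply_empty (hk : k < 0) (v : Fock K) : boson K k v ∅ = 0 := by
  have bilinear (m : ℤ) : (fermion K m * fermion K (-m - k)) v ∅ = 0 := by
    rcases lt_or_ge 0 m with hm | hm
    · rw [Module.End.mul_apply, fermion_apply_empty_of_pos hm]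
    · rw [fermion_mul_fermion_swap (by omega), LinearMap.neg_apply, Finsupp.neg_apply,
        Module.End.mul_apply, fermion_apply_empty_of_pos (by omega), neg_zero]
  obtain ⟨M, hM⟩ := (eventually_boson_eq hk.ne v).exists
  rw [hM, bosonTrunc, LinearMap.smul_apply, LinearMap.sum_apply, Finsupp.smul_apply,
    Finsupp.finsetSum_apply, Finset.sum_eq_zero, smul_zero]
  intro m _
  rw [LinearMap.smul_apply, Finsupp.smul_apply, bilinear, smul_zero]

lemma diagonalElement_mul_boson {w : ℕ → K} (h0 : w 0 * w 0 = 1) (hw : ∀ k, w k ≠ 0)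
    (hk : k ≠ 0) {c : K} (hc : ∀ m, weightInt w m * weightInt w (-m - k) = c) :
    diagonalElement w * boson K k = c • (boson K k * diagonalElement w) := by
  refine mul_boson_of_mul_bilinear hk fun m => ?_
  rw [← mul_assoc, diagonalElement_mul_fermion h0 hw, smul_mul_assoc, mul_assoc,
    diagonalElement_mul_fermion h0 hw, mul_smul_comm, smul_smul, hc, mul_assoc]

end Truncation

/-- The operator `z^j ↦ f j z^{j-k}` on Laurent polynomials, which are encoded by their
coefficients. -/
def shiftOp (f : ℤ → K) (k : ℤ) : Module.End K (ℤ →₀ K) :=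
  Finsupp.linearCombination K fun j => Finsupp.single (j - k) (f j)

lemma shiftOp_single (f : ℤ → K) (k j : ℤ) :
    shiftOp f k (Finsupp.single j 1) = Finsupp.single (j - k) (f j) := by
  simp [shiftOp]

lemma isQuad_boson [NeZero (2 : K)] {k : ℤ} (hk : Odd k) :
    IsQuad (boson K k) (shiftOp 1 k) := by
  refine IsQuad.of_comm_fermion (fun j => ?_) ?_
  · rw [shiftOp_single, field_single, boson_mul_fermion hk, Pi.one_apply, one_smul]
  · rw [diagonalElement_mul_boson (c := 1) (by simp) (by simp) (ne_zero_of_odd hk)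
      (by simp [weightInt_neg_one]), one_smul]

/-- `P` raises the energy `∑_{i ∈ S} i` by `c`. The energy grading is encoded multiplicatively, by
the diagonal element with eigenvalues `2 ^ ∑_{i ∈ S} i`. -/
def HasEnergy (P : Module.End K (Fock K)) (c : ℤ) : Prop :=
  diagonalElement (fun k => 2 ^ k) * P = (2 : K) ^ c • (P * diagonalElement fun k => 2 ^ k)

namespace HasEnergy

lemma one : HasEnergy (1 : Module.End K (Fock K)) 0 := by simp [HasEnergy]

lemma mul [NeZero (2 : K)] {P Q : Module.End K (Fock K)} {c d : ℤ} (hP : HasEnergy P c)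
    (hQ : HasEnergy Q d) : HasEnergy (P * Q) (c + d) := by
  unfold HasEnergy at *
  rw [← mul_assoc, hP, smul_mul_assoc, mul_assoc, hQ, mul_smul_comm, smul_smul, mul_assoc,
    zpow_add₀ (NeZero.ne 2)]

lemma smul {P : Module.End K (Fock K)} {c : ℤ} (hP : HasEnergy P c) (r : K) :
    HasEnergy (r • P) c := by
  rw [HasEnergy, mul_smul_comm, hP, smul_mul_assoc, smul_comm]

lemma vev_eq_zero [CharZero K] {P : Module.End K (Fock K)} {c : ℤ} (hP : HasEnergy P c)
    (hc : c ≠ 0) : vev K P = 0 := by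
  have h := DFunLike.congr_fun (LinearMap.congr_fun hP (basisVec K ∅)) ∅
  rw [LinearMap.smul_apply, Finsupp.smul_apply, Module.End.mul_apply, Module.End.mul_apply,
    diagonalElement_basisVec, diagonalElement_apply, Finset.prod_empty, one_smul, one_mul,
    smul_eq_mul] at h
  have two_zpow_ne : (2 : K) ^ c ≠ 1 := by
    have : (2 : ℚ) ^ c ≠ 1 := by
      rw [Ne, zpow_eq_one_iff_right₀ (by norm_num) (by norm_num)]
      exact hc
    exact fun h => this (by
      rw [← Rat.cast_inj (α := K), Rat.cast_zpow, Rat.cast_ofNat, Rat.cast_one, h])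
  have : ((2 : K) ^ c - 1) * vev K P = 0 := by
    rw [vev]
    linear_combination -h
  exact (mul_eq_zero.1 this).resolve_left (sub_ne_zero.2 two_zpow_ne)

end HasEnergy

lemma hasEnergy_boson [NeZero (2 : K)] {k : ℤ} (hk : k ≠ 0) : HasEnergy (boson K k) (-k) := by
  refine diagonalElement_mul_boson (by simp) (fun k => pow_ne_zero k (NeZero.ne 2)) hk fun m => ?_
  rw [weightInt_pow, weightInt_pow, ← zpow_add₀ (NeZero.ne 2), show m + (-m - k) = -k by ring]

lemma hasEnergy_diagonalElement (w : ℕ → K) : HasEnergy (diagonalElement w) 0 := by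
  rw [HasEnergy, zpow_zero, one_smul, diagonalElement_mul, diagonalElement_mul, mul_comm]

end Bosons

section Tau

variable {K : Type*} [Field K]

lemma vev_add (P Q : Module.End K (Fock K)) : vev K (P + Q) = vev K P + vev K Q := by
  simp [vev]

lemma vev_smul (c : K) (P : Module.End K (Fock K)) : vev K (c • P) = c * vev K P := by
  simp [vev]

lemma vev_sum {ι : Type*} (s : Finset ι) (P : ι → Module.End K (Fock K)) :
    vev K (∑ i ∈ s, P i) = ∑ i ∈ s, vev K (P i) := by
  simp [vev, Finsupp.finsetSum_apply]

lemma vev_diagonalElement_mul (w : ℕ → K) (P : Module.End K (Fock K)) :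
    vev K (diagonalElement w * P) = vev K P := by
  rw [vev, Module.End.mul_apply, diagonalElement_apply, Finset.prod_empty, one_mul, vev]

lemma diagonalElement_inv_mul {w : ℕ → K} (hw : ∀ k, w k ≠ 0) :
    diagonalElement w⁻¹ * diagonalElement w = 1 := by
  rw [diagonalElement_mul, show w⁻¹ * w = 1 from funext fun k => inv_mul_cancel₀ (hw k),
    diagonalElement_one]

lemma commute_diagonalElement (w w' : ℕ → K) :
    Commute (diagonalElement w) (diagonalElement w') := by
  rw [Commute, SemiconjBy, diagonalElement_mul, diagonalElement_mul, mul_comm]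

lemma weightInt_inv (w : ℕ → K) (j : ℤ) : weightInt w⁻¹ j = (weightInt w j)⁻¹ := by
  unfold weightInt
  split_ifs <;> simp

lemma weightInt_ne_zero {w : ℕ → K} (hw : ∀ k, w k ≠ 0) (j : ℤ) : weightInt w j ≠ 0 := by
  unfold weightInt
  split_ifs <;> simp [hw]

/-- The conjugate `D⁻¹ J_k D` of a boson by the diagonal group element `D`. -/
def dressedBoson (w : ℕ → K) (k : ℤ) : Module.End K (Fock K) :=
  diagonalElement w⁻¹ * boson K k * diagonalElement w

lemma boson_mul_diagonalElement {w : ℕ → K} (hw : ∀ k, w k ≠ 0) (k : ℤ) :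
    boson K k * diagonalElement w = diagonalElement w * dressedBoson w k := by
  rw [dressedBoson, ← mul_assoc, ← mul_assoc, (commute_diagonalElement w w⁻¹).eq,
    diagonalElement_inv_mul hw, one_mul]

lemma isQuad_dressedBoson [NeZero (2 : K)] {w : ℕ → K} (h0 : w 0 * w 0 = 1) (hw : ∀ k, w k ≠ 0)
    {k : ℤ} (hk : Odd k) :
    IsQuad (dressedBoson w k) (shiftOp (fun j => weightInt w j / weightInt w (j - k)) k) := by
  refine IsQuad.of_comm_fermion (fun j => ?_) ?_
  · have inv_comm (i : ℤ) : diagonalElement w⁻¹ * fermion K i =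
        (weightInt w i)⁻¹ • (fermion K i * diagonalElement w⁻¹) := by
      rw [diagonalElement_mul_fermion (by simp [← mul_inv, h0]) (by simp [hw]), weightInt_inv]
    calc dressedBoson w k * fermion K j
        = weightInt w j •
            (diagonalElement w⁻¹ * (boson K k * fermion K j) * diagonalElement w) := by
          rw [dressedBoson, mul_assoc, diagonalElement_mul_fermion h0 hw, mul_smul_comm,
            ← mul_assoc, mul_assoc _ (boson K k)]
      _ = weightInt w j • ((weightInt w j)⁻¹ • (fermion K j * dressedBoson w k) +
            (weightInt w (j - k))⁻¹ • fermion K (j - k)) := by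
          rw [boson_mul_fermion hk, mul_add, add_mul, ← mul_assoc, inv_comm, inv_comm,
            smul_mul_assoc, smul_mul_assoc, smul_mul_assoc, mul_assoc (fermion K (j - k)),
            diagonalElement_inv_mul hw, mul_one, dressedBoson, mul_assoc, mul_assoc, mul_assoc]
      _ = fermion K j * dressedBoson w k + field (shiftOp
            (fun j => weightInt w j / weightInt w (j - k)) k (Finsupp.single j 1)) := by
          rw [shiftOp_single, field_single, smul_add, smul_inv_smul₀ (weightInt_ne_zero hw j),
            smul_smul, div_eq_mul_inv]
  · exact ((commute_diagonalElement _ _).mul_right (isQuad_boson hk).even).mul_right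
      (commute_diagonalElement _ _)

/-- The lists of length `l` with entries less than `N`. They index the monomials in the expansion
of the `l`-th power of a sum of `N` noncommuting terms. -/
def listsBelow (N : ℕ) : ℕ → Finset (List ℕ)
  | 0 => {[]}
  | l + 1 => (Finset.range N ×ˢ listsBelow N l).image fun p => p.1 :: p.2

lemma mem_listsBelow {N l : ℕ} {L : List ℕ} :
    L ∈ listsBelow N l ↔ L.length = l ∧ ∀ x ∈ L, x < N := by
  induction l generalizing L with
  | zero => simp +contextual [listsBelow, List.length_eq_zero_iff]
  | succ l ih =>
    cases L with
    | nil => simp [listsBelow]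
    | cons a L => simp [listsBelow, ih]; tauto

lemma sum_listsBelow_succ {M : Type*} [AddCommMonoid M] (N l : ℕ) (f : List ℕ → M) :
    ∑ L ∈ listsBelow N (l + 1), f L = ∑ j ∈ Finset.range N, ∑ L ∈ listsBelow N l, f (j :: L) := by
  rw [listsBelow, Finset.sum_image, Finset.sum_product]
  rintro ⟨a, b⟩ _ ⟨c, d⟩ _ h
  simpa using h

lemma sum_pow_eq_sum_listsBelow {R : Type*} [Semiring R] (N l : ℕ) (A : ℕ → R) :
    (∑ j ∈ Finset.range N, A j) ^ l = ∑ L ∈ listsBelow N l, (L.map A).prod := by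
  induction l with
  | zero => simp [listsBelow]
  | succ l ih => simp [sum_listsBelow_succ, pow_succ', ih, Finset.sum_mul_sum]

lemma sum_biUnion_listsBelow {M : Type*} [AddCommMonoid M] (N Λ : ℕ) (f : List ℕ → M) :
    ∑ L ∈ (Finset.range Λ).biUnion (listsBelow N), f L =
      ∑ l ∈ Finset.range Λ, ∑ L ∈ listsBelow N l, f L := by
  refine Finset.sum_biUnion fun l _ l' _ hne => Finset.disjoint_left.2 fun L hL hL' => hne ?_
  rw [← (mem_listsBelow.1 hL).1, (mem_listsBelow.1 hL').1]

lemma prod_map_smul {R : Type*} [Semiring R] [Algebra K R] (s : ℕ → K) (A : ℕ → R) (L : List ℕ) :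
    (L.map fun j => s j • A j).prod = (L.map s).prod • (L.map A).prod := by
  induction L with
  | nil => simp
  | cons a L ih => simp [ih, smul_smul, mul_comm]

lemma mem_lists_toMultiset_iff {b : ℕ →₀ ℕ} {L : List ℕ} :
    L ∈ (Finsupp.toMultiset b).lists.toFinset ↔ Multiset.toFinsupp (L : Multiset ℕ) = b := by
  rw [Multiset.mem_toFinset, Multiset.mem_lists_iff]
  constructor
  · intro h
    rw [show (L : Multiset ℕ) = Finsupp.toMultiset b from h.symm, Finsupp.toMultiset_toFinsupp]
  · rintro rfl
    rw [Multiset.toFinsupp_toMultiset]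
    rfl

lemma finsum_sum_lists {M : Type*} [AddCommMonoid M] {G : List ℕ → M} {U : Finset (List ℕ)}
    (hG : ∀ L, G L ≠ 0 → L ∈ U) :
    ∑ᶠ b : ℕ →₀ ℕ, ∑ L ∈ (Finsupp.toMultiset b).lists.toFinset, G L = ∑ L ∈ U, G L := by
  have fiber (b : ℕ →₀ ℕ) : ∑ L ∈ (Finsupp.toMultiset b).lists.toFinset, G L =
      ∑ L ∈ U.filter fun L : List ℕ => Multiset.toFinsupp (L : Multiset ℕ) = b, G L := by
    refine Finset.sum_congr_of_eq_on_inter (fun L hL hL' => ?_) (fun L hL hL' => ?_)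
      fun _ _ _ => rfl
    · by_contra h0
      exact hL' (Finset.mem_filter.2 ⟨hG L h0, mem_lists_toMultiset_iff.1 hL⟩)
    · exact absurd (mem_lists_toMultiset_iff.2 (Finset.mem_filter.1 hL).2) hL'
  simp only [fiber]
  rw [finsum_eq_sum_of_support_subset
    (s := U.image fun L : List ℕ => Multiset.toFinsupp (L : Multiset ℕ))]
  · exact Finset.sum_fiberwise_of_maps_to (fun L hL => Finset.mem_image_of_mem _ hL) G
  · intro b hb
    obtain ⟨L, hL, _⟩ := Finset.exists_ne_zero_of_sum_ne_zero hb
    rw [Finset.mem_filter] at hL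
    exact Finset.mem_coe.2 (Finset.mem_image.2 ⟨L, hL⟩)

lemma hasEnergy_prod_boson [NeZero (2 : K)] (L : List ℕ) :
    HasEnergy (L.map fun j : ℕ => boson K (-(2 * j + 1))).prod
      ((L.map fun j => 2 * j + 1).sum : ℕ) := by
  induction L with
  | nil => simpa using HasEnergy.one
  | cons a L ih =>
    have h : HasEnergy (boson K (-(2 * a + 1))) ((2 * a + 1 : ℕ) : ℤ) := by
      simpa using hasEnergy_boson (K := K) (k := -(2 * a + 1)) (by omega)
    simpa using h.mul ih

lemma length_le_sum_map (L : List ℕ) : L.length ≤ (L.map fun j => 2 * j + 1).sum := by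
  simp

lemma lt_sum_map_of_mem {L : List ℕ} {x : ℕ} (hx : x ∈ L) : x < (L.map fun j => 2 * j + 1).sum :=
  lt_of_lt_of_le (by omega)
    (List.single_le_sum (by simp) (2 * x + 1) (List.mem_map_of_mem (f := fun j => 2 * j + 1) hx))

lemma coeff_tau_mul_prod (w s : ℕ → K) (a b : ℕ →₀ ℕ) :
    MvPowerSeries.coeff (Finsupp.sumFinsuppEquivProdFinsupp.symm (a, b)) (tau w) *
        b.prod (fun j e => s j ^ e) =
      ∑ L ∈ (Finsupp.toMultiset b).lists.toFinset, (L.length ! : K)⁻¹ * ((L.map s).prod *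
        vev K (expCoeff (fun j => boson K (2 * j + 1)) a * diagonalElement w *
          (L.map fun j : ℕ => boson K (-(2 * j + 1))).prod)) := by
  have coeff_tau :
      MvPowerSeries.coeff (Finsupp.sumFinsuppEquivProdFinsupp.symm (a, b)) (tau w) =
      vev K (expCoeff (fun j => boson K (2 * j + 1)) a * diagonalElement w *
        expCoeff (fun j => boson K (-(2 * j + 1))) b) := by
    simp only [MvPowerSeries.coeff_apply, tau, Equiv.apply_symm_apply]
  rw [coeff_tau]
  generalize expCoeff (fun j => boson K (2 * j + 1)) a * diagonalElement w = E
  rw [expCoeff, mul_smul_comm, vev_smul, Finset.mul_sum, vev_sum,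
    Finset.mul_sum, Finset.sum_mul]
  refine Finset.sum_congr rfl fun L hL => ?_
  have content : Finsupp.toMultiset b = L := by
    rwa [Multiset.mem_toFinset, Multiset.mem_lists_iff] at hL
  have prod_eq : b.prod (fun j e => s j ^ e) = (L.map s).prod := by
    rw [← Multiset.prod_coe, ← Multiset.map_coe, ← content, Finsupp.toMultiset_map,
      Finsupp.prod_toMultiset, Finsupp.prod_mapDomain_index] <;> simp [pow_add]
  rw [prod_eq, content, Multiset.coe_card]
  ring

/-- The operator `∑_{j < N} s_{2j+1} J_{-(2j+1)}`, a truncation of `J₋(s)`. -/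
def bosonMinus (s : ℕ → K) (N : ℕ) : Module.End K (Fock K) :=
  ∑ j ∈ Finset.range N, s j • boson K (-(2 * j + 1))

lemma vev_mul_bosonMinus_pow (E : Module.End K (Fock K)) (s : ℕ → K) (N l : ℕ) :
    vev K (E * bosonMinus s N ^ l) = ∑ L ∈ listsBelow N l, (L.map s).prod *
      vev K (E * (L.map fun j : ℕ => boson K (-(2 * j + 1))).prod) := by
  simp only [bosonMinus, sum_pow_eq_sum_listsBelow, Finset.mul_sum, vev_sum, prod_map_smul,
    mul_smul_comm, vev_smul]

/-- Only finitely many monomials in `s` contribute, since an operator of nonzero energy has no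
vacuum expectation value. -/
lemma coeff_tauAt [CharZero K] (w s : ℕ → K) (a : ℕ →₀ ℕ) {e N Λ : ℕ}
    (he : HasEnergy (expCoeff (fun j => boson K (2 * j + 1)) a) (-e)) (hN : e ≤ N) (hΛ : e < Λ) :
    tauAt w s a = ∑ l ∈ Finset.range Λ, ((l ! : K)⁻¹) *
      vev K (expCoeff (fun j => boson K (2 * j + 1)) a * diagonalElement w *
        bosonMinus s N ^ l) := by
  set E := expCoeff (fun j => boson K (2 * j + 1)) a * diagonalElement w with hE
  have support (L : List ℕ) (hL : (L.length ! : K)⁻¹ * ((L.map s).prod *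
      vev K (E * (L.map fun j : ℕ => boson K (-(2 * j + 1))).prod)) ≠ 0) :
      L ∈ (Finset.range Λ).biUnion (listsBelow N) := by
    have energy := (he.mul (hasEnergy_diagonalElement w)).mul (hasEnergy_prod_boson L)
    have sum_eq : (L.map fun j => 2 * j + 1).sum = e := by
      by_contra hne
      exact hL (by rw [energy.vev_eq_zero (by omega), mul_zero, mul_zero])
    have length_le := length_le_sum_map L
    simp only [Finset.mem_biUnion, Finset.mem_range, mem_listsBelow]
    exact ⟨L.length, by omega, rfl, fun x hx => by have := lt_sum_map_of_mem hx; omega⟩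
  rw [tauAt]
  simp only [coeff_tau_mul_prod, ← hE]
  rw [finsum_sum_lists support, sum_biUnion_listsBelow]
  refine Finset.sum_congr rfl fun l _ => ?_
  rw [vev_mul_bosonMinus_pow, Finset.mul_sum]
  exact Finset.sum_congr rfl fun L hL => by rw [(mem_listsBelow.1 hL).1]

end Tau

section NestedCommutators

variable {K : Type*} [Field K]

/-- The iterated commutator `[⋯[[P, J], J], ⋯, J]`. -/
def nested {α : Type*} (J P : Module.End K (α →₀ K)) : ℕ → Module.End K (α →₀ K)
  | 0 => P
  | i + 1 => nested J P i * J - J * nested J P i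

lemma IsQuad.nested {J P : Module.End K (Fock K)} {S A : Module.End K (ℤ →₀ K)}
    (hP : IsQuad P A) (hJ : IsQuad J S) (i : ℕ) : IsQuad (nested J P i) (nested S A i) := by
  induction i with
  | zero => exact hP
  | succ i ih => exact ih.commutator hJ

lemma nested_mul {α : Type*} (J P : Module.End K (α →₀ K)) (i : ℕ) :
    nested J P i * J = nested J P (i + 1) + J * nested J P i :=
  LinearMap.ext fun v => by simp [nested]

lemma vev_mul_of_apply_empty {J : Module.End K (Fock K)} (hJ : ∀ v, J v ∅ = 0)
    (Q : Module.End K (Fock K)) : vev K (J * Q) = 0 := hJ _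

lemma vev_nested_mul_pow {J : Module.End K (Fock K)} (hJ : ∀ v, J v ∅ = 0)
    (P : Module.End K (Fock K)) (i l : ℕ) :
    vev K (nested J P i * J ^ l) = vev K (nested J P (i + l)) := by
  induction l generalizing i with
  | zero => simp
  | succ l ih =>
    rw [pow_succ', ← mul_assoc, nested_mul, add_mul, vev_add, ih, mul_assoc,
      vev_mul_of_apply_empty hJ, add_zero, add_right_comm, add_assoc]

lemma eq_sum_antidiagonal_of_pascal {R : Type*} [CommSemiring R] (f : ℕ → ℕ → ℕ → R)
    (hf : ∀ i j l, f i j (l + 1) = f (i + 1) j l + f i (j + 1) l) (i j l : ℕ) :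
    f i j l = ∑ p ∈ Finset.HasAntidiagonal.antidiagonal l,
      (l.choose p.1 : R) * f (i + p.1) (j + p.2) 0 := by
  induction l generalizing i j with
  | zero => simp
  | succ l ih =>
    rw [hf, ih, ih, Finset.sum_antidiagonal_choose_succ_mul (fun p q => f (i + p) (j + q) 0),
      add_comm]
    simp only [add_assoc, add_comm 1]
    congr 1
    refine Finset.sum_congr rfl fun x hx => ?_
    rw [Nat.choose_symm_of_eq_add (Finset.HasAntidiagonal.mem_antidiagonal.1 hx).symm]

lemma vev_mul_mul_pow {J : Module.End K (Fock K)} (hJ : ∀ v, J v ∅ = 0)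
    (P P' : Module.End K (Fock K)) (l : ℕ) :
    vev K (P * P' * J ^ l) = ∑ p ∈ Finset.HasAntidiagonal.antidiagonal l,
      (l.choose p.1 : K) * vev K (nested J P p.1 * nested J P' p.2) := by
  have pascal (i j l : ℕ) : vev K (nested J P i * nested J P' j * J ^ (l + 1)) =
      vev K (nested J P (i + 1) * nested J P' j * J ^ l) +
        vev K (nested J P i * nested J P' (j + 1) * J ^ l) := by
    rw [pow_succ', ← mul_assoc, mul_assoc (nested J P i), nested_mul, mul_add,
      ← mul_assoc (nested J P i) J, nested_mul, add_mul, add_mul, add_mul, vev_add, vev_add,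
      mul_assoc J, mul_assoc J, vev_mul_of_apply_empty hJ, add_zero, add_comm]
  simpa [nested] using eq_sum_antidiagonal_of_pascal
    (fun i j l => vev K (nested J P i * nested J P' j * J ^ l)) pascal 0 0 l

end NestedCommutators

section Derivatives

variable {K : Type*} [Field K]

lemma boson_commute [CharZero K] {k m : ℤ} (hk : Odd k) (hm : Odd m) (h : k + m ≠ 0) :
    Commute (boson K k) (boson K m) := by
  have vev_eq_zero {k m : ℤ} (hk : Odd k) (hm : Odd m) (h : k + m ≠ 0) :
      vev K (boson K k * boson K m) = 0 :=
    ((hasEnergy_boson (ne_zero_of_odd hk)).mul (hasEnergy_boson (ne_zero_of_odd hm))).vev_eq_zero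
      (by omega)
  have shift_comm : shiftOp (1 : ℤ → K) k * shiftOp 1 m - shiftOp 1 m * shiftOp 1 k = 0 := by
    refine Finsupp.lhom_ext' fun j => LinearMap.ext_ring ?_
    simp [shiftOp, sub_right_comm]
  have quad := (isQuad_boson (K := K) hk).commutator (isQuad_boson hm)
  rw [shift_comm] at quad
  refine sub_eq_zero.1 (quad.eq_zero ?_)
  calc vev K (boson K k * boson K m - boson K m * boson K k)
      = vev K (boson K k * boson K m) - vev K (boson K m * boson K k) := rfl
    _ = 0 := by rw [vev_eq_zero hk hm h, vev_eq_zero hm hk (by omega), sub_zero]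

lemma bosonMinus_apply_empty [NeZero (2 : K)] (s : ℕ → K) (N : ℕ) (v : Fock K) :
    bosonMinus s N v ∅ = 0 := by
  rw [bosonMinus, LinearMap.sum_apply, Finsupp.finsetSum_apply]
  refine Finset.sum_eq_zero fun j _ => ?_
  rw [LinearMap.smul_apply, Finsupp.smul_apply, boson_apply_empty (by omega), smul_zero]

lemma expCoeff_single (A : ℕ → Module.End K (Fock K)) (j : ℕ) :
    expCoeff A (Finsupp.single j 1) = A j := by
  have content : Finsupp.toMultiset (Finsupp.single j 1) = (([j] : List ℕ) : Multiset ℕ) := by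
    simp
  rw [expCoeff, content, Multiset.lists_coe]
  simp [List.permutations]

lemma expCoeff_single_add_single [CharZero K] (A : ℕ → Module.End K (Fock K)) (i j : ℕ) :
    expCoeff A (Finsupp.single i 1 + Finsupp.single j 1) =
      (2 * if i = j then 2 else 1 : K)⁻¹ • (A i * A j + A j * A i) := by
  have content : Finsupp.toMultiset (Finsupp.single i 1 + Finsupp.single j 1) =
      (([i, j] : List ℕ) : Multiset ℕ) := by
    simp only [map_add, Finsupp.toMultiset_single, one_smul]
    rfl
  rw [expCoeff, content, Multiset.lists_coe]
  rcases eq_or_ne i j with rfl | h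
  · simp [List.permutations, ← two_smul K, smul_smul]
  · simp [List.permutations, h, h.symm]

lemma derivAtZero_singleton (f : MvPowerSeries ℕ K) (j : ℕ) :
    derivAtZero f [j] = f (Finsupp.single j 1) := by
  rw [derivAtZero, ← MvPowerSeries.coeff_zero_eq_constantCoeff_apply, List.foldr_cons,
    List.foldr_nil, MvPowerSeries.coeff_pderiv]
  simp [MvPowerSeries.coeff_apply]

lemma derivAtZero_pair (f : MvPowerSeries ℕ K) (i j : ℕ) :
    derivAtZero f [i, j] =
      (if i = j then 2 else 1) * f (Finsupp.single i 1 + Finsupp.single j 1) := by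
  rw [derivAtZero, ← MvPowerSeries.coeff_zero_eq_constantCoeff_apply, List.foldr_cons,
    List.foldr_cons, List.foldr_nil, MvPowerSeries.coeff_pderiv, MvPowerSeries.coeff_pderiv,
    zero_add, MvPowerSeries.coeff_apply]
  rcases eq_or_ne i j with rfl | h
  · simp [mul_comm, one_add_one_eq_two]
  · simp [h]

lemma hasEnergy_boson_odd [NeZero (2 : K)] (j : ℕ) :
    HasEnergy (boson K (2 * j + 1)) (-(2 * j + 1 : ℕ)) := by
  exact_mod_cast hasEnergy_boson (K := K) (k := 2 * j + 1) (by omega)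

lemma derivAtZero_tauAt_singleton [CharZero K] {w : ℕ → K} (hw : ∀ k, w k ≠ 0) (s : ℕ → K)
    (j : ℕ) {N Λ : ℕ} (hN : 2 * j + 1 ≤ N) (hΛ : 2 * j + 1 < Λ) :
    derivAtZero (tauAt w s) [j] = ∑ l ∈ Finset.range Λ,
      (l ! : K)⁻¹ * vev K (nested (bosonMinus s N) (dressedBoson w (2 * j + 1)) l) := by
  rw [derivAtZero_singleton,
    coeff_tauAt w s _ (by simpa only [expCoeff_single] using hasEnergy_boson_odd j) hN hΛ]
  refine Finset.sum_congr rfl fun l _ => ?_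
  rw [expCoeff_single, boson_mul_diagonalElement hw, mul_assoc, vev_diagonalElement_mul]
  congr 1
  simpa [nested] using vev_nested_mul_pow (bosonMinus_apply_empty s N) _ 0 l

lemma expCoeff_boson_pair [CharZero K] (i j : ℕ) :
    expCoeff (fun j => boson K (2 * j + 1)) (Finsupp.single i 1 + Finsupp.single j 1) =
      (if i = j then 2 else 1 : K)⁻¹ • (boson K (2 * i + 1) * boson K (2 * j + 1)) := by
  rw [expCoeff_single_add_single, ← (boson_commute (K := K) (k := 2 * i + 1) (m := 2 * j + 1)
    ⟨i, rfl⟩ ⟨j, rfl⟩ (by omega)).eq, ← two_smul K, smul_smul, mul_inv_rev,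
    inv_mul_cancel_right₀ two_ne_zero]

lemma inv_factorial_mul_choose [CharZero K] (p q : ℕ) :
    ((p + q)! : K)⁻¹ * (p + q).choose p = (p ! : K)⁻¹ * (q ! : K)⁻¹ := by
  have factorial_ne (n : ℕ) : (n ! : K) ≠ 0 := by exact_mod_cast n.factorial_ne_zero
  have choose_mul : ((p + q).choose p : K) * p ! * q ! = (p + q)! := by
    rw [Nat.choose_symm_add]
    exact_mod_cast Nat.add_choose_mul_factorial_mul_factorial p q
  have := factorial_ne p
  have := factorial_ne q
  have := factorial_ne (p + q)
  field_simp
  linear_combination choose_mul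

lemma derivAtZero_tauAt_pair [CharZero K] {w : ℕ → K} (hw : ∀ k, w k ≠ 0) (s : ℕ → K)
    (i j : ℕ) {N Λ : ℕ} (hN : 2 * i + 1 + (2 * j + 1) ≤ N) (hΛ : 2 * i + 1 + (2 * j + 1) < Λ) :
    derivAtZero (tauAt w s) [i, j] =
      ∑ l ∈ Finset.range Λ, ∑ p ∈ Finset.HasAntidiagonal.antidiagonal l,
        ((p.1 ! : K)⁻¹ * (p.2 ! : K)⁻¹) *
          vev K (nested (bosonMinus s N) (dressedBoson w (2 * i + 1)) p.1 *
            nested (bosonMinus s N) (dressedBoson w (2 * j + 1)) p.2) := by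
  have energy : HasEnergy (boson K (2 * i + 1) * boson K (2 * j + 1))
      (-(2 * i + 1 + (2 * j + 1) : ℕ)) := by
    rw [Nat.cast_add, neg_add]
    exact (hasEnergy_boson_odd i).mul (hasEnergy_boson_odd j)
  have mult_ne : (if i = j then 2 else 1 : K) ≠ 0 := by split_ifs <;> norm_num
  rw [derivAtZero_pair, coeff_tauAt w s _ (by rw [expCoeff_boson_pair]; exact energy.smul _) hN hΛ,
    Finset.mul_sum]
  refine Finset.sum_congr rfl fun l _ => ?_
  rw [expCoeff_boson_pair, mul_assoc, smul_mul_assoc, vev_smul, mul_left_comm,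
    mul_inv_cancel_left₀ mult_ne, ← mul_assoc, mul_assoc (boson K _),
    boson_mul_diagonalElement hw, ← mul_assoc, boson_mul_diagonalElement hw, mul_assoc, mul_assoc,
    vev_diagonalElement_mul, ← mul_assoc, vev_mul_mul_pow (bosonMinus_apply_empty s N),
    Finset.mul_sum]
  refine Finset.sum_congr rfl fun p hp => ?_
  rw [← Finset.HasAntidiagonal.mem_antidiagonal.1 hp, ← mul_assoc, inv_factorial_mul_choose]

end Derivatives

section Substitution

open PowerSeries

variable {R : Type*} [CommRing R]

lemma coeff_pow_eq_zero_of_lt {g : PowerSeries R} (hg : constantCoeff g = 0) {N n : ℕ}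
    (h : N < n) : coeff N (g ^ n) = 0 :=
  X_pow_dvd_iff.1 (pow_dvd_pow_of_dvd (X_dvd_iff.2 hg) n) N h

lemma coeff_subst_eq_sum (f : PowerSeries R) {g : PowerSeries R} (hg : constantCoeff g = 0)
    {N M : ℕ} (h : N < M) :
    coeff N (f.subst g) = ∑ n ∈ Finset.range M, coeff n f * coeff N (g ^ n) := by
  rw [coeff_subst' (HasSubst.of_constantCoeff_zero' hg),
    finsum_eq_sum_of_support_subset (s := Finset.range M)]
  · simp only [smul_eq_mul]
  · intro n hn
    by_contra hnM
    simp only [Finset.coe_range, Set.mem_Iio, not_lt] at hnM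
    exact hn (by simp [coeff_pow_eq_zero_of_lt hg (h.trans_le hnM)])

lemma constantCoeff_subst_eq (f : PowerSeries R) {g : PowerSeries R}
    (hg : constantCoeff g = 0) : constantCoeff (f.subst g) = constantCoeff f := by
  simpa using coeff_subst_eq_sum f hg one_pos

end Substitution

section Exponential

open PowerSeries

lemma hasSubst_sub_C_constantCoeff {R : Type*} [CommRing R] (f : PowerSeries R) :
    HasSubst (f - C (constantCoeff f)) :=
  HasSubst.of_constantCoeff_zero' (by simp)

lemma constantCoeff_expSeries (f : PowerSeries ℂ) :
    constantCoeff (expSeries f) = Complex.exp (constantCoeff f) := by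
  rw [expSeries, map_mul, constantCoeff_subst_eq _ (by simp), constantCoeff_C,
    constantCoeff_exp, mul_one]

lemma derivative_expSeries (f : PowerSeries ℂ) :
    derivative ℂ (expSeries f) = derivative ℂ f * expSeries f := by
  rw [expSeries, Derivation.leibniz, derivative_subst (hasSubst_sub_C_constantCoeff f),
    derivative_exp]
  simp only [map_sub, derivative_C, smul_eq_mul, sub_zero, mul_zero, add_zero]
  ring

lemma expSeries_mul_neg (f : PowerSeries ℂ) : expSeries f * expSeries (-f) = 1 := by
  refine derivative.ext ?_ ?_
  · rw [Derivation.leibniz, derivative_expSeries, derivative_expSeries]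
    simp only [smul_eq_mul, map_neg, derivative_one]
    ring
  · rw [map_mul, constantCoeff_expSeries, constantCoeff_expSeries, map_neg, ← Complex.exp_add]
    simp

lemma expSeries_add (f g : PowerSeries ℂ) : expSeries (f + g) = expSeries f * expSeries g := by
  have expSeries_add_mul_neg : expSeries (f + g) * (expSeries (-f) * expSeries (-g)) = 1 := by
    refine derivative.ext ?_ ?_
    · simp only [Derivation.leibniz, derivative_expSeries, smul_eq_mul, map_neg, map_add,
        derivative_one]
      ring
    · simp only [map_mul, constantCoeff_expSeries, ← Complex.exp_add, map_neg, map_add]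
      rw [← neg_add, add_neg_cancel, Complex.exp_zero, map_one]
  calc expSeries (f + g)
      = expSeries (f + g) * ((expSeries f * expSeries (-f)) *
          (expSeries g * expSeries (-g))) := by
        rw [expSeries_mul_neg, expSeries_mul_neg, mul_one, mul_one]
    _ = expSeries (f + g) * (expSeries (-f) * expSeries (-g)) *
          (expSeries f * expSeries g) := by ring
    _ = expSeries f * expSeries g := by rw [expSeries_add_mul_neg, one_mul]

lemma expSeries_zero : expSeries 0 = 1 := by
  refine derivative.ext ?_ ?_
  · rw [derivative_expSeries]; simp
  · rw [constantCoeff_expSeries]; simp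

lemma expSeries_nsmul (n : ℕ) (f : PowerSeries ℂ) : expSeries (n • f) = expSeries f ^ n := by
  induction n with
  | zero => simp [expSeries_zero]
  | succ n ih => rw [succ_nsmul, expSeries_add, ih, pow_succ]

lemma expSeries_subst (f : PowerSeries ℂ) {g : PowerSeries ℂ} (hg : constantCoeff g = 0) :
    (expSeries f).subst g = expSeries (f.subst g) := by
  have hsubst : HasSubst g := HasSubst.of_constantCoeff_zero' hg
  have subst_C_eq (c : ℂ) : (C c).subst g = C c := subst_C _
  rw [expSeries, subst_mul hsubst, subst_C_eq,
    subst_comp_subst_apply (hasSubst_sub_C_constantCoeff f) hsubst, subst_sub hsubst, subst_C_eq,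
    expSeries, constantCoeff_subst_eq f hg]

lemma coeff_expSeries (f : PowerSeries ℂ) (N : ℕ) :
    coeff N (expSeries f) = coeff N (C (Complex.exp (constantCoeff f)) *
      ∑ n ∈ Finset.range (N + 1), C ((n ! : ℂ)⁻¹) * (f + C (-constantCoeff f)) ^ n) := by
  rw [expSeries, coeff_C_mul, coeff_C_mul, map_sum, coeff_subst_eq_sum _ (by simp) N.lt_succ_self]
  congr 1
  refine Finset.sum_congr rfl fun n _ => ?_
  rw [coeff_C_mul, coeff_exp, map_neg, sub_eq_add_neg]
  simp

end Exponential

section Taylor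

variable {R : Type*} [CommRing R] {p : Polynomial R} {N : ℕ}

lemma coeff_taylor_of_natDegree_le (h : p.natDegree ≤ N) (b : R) :
    (p.taylor b).coeff N = p.coeff N := by
  rcases h.eq_or_lt with rfl | h
  · rw [Polynomial.coeff_taylor_natDegree, Polynomial.leadingCoeff]
  · rw [Polynomial.coeff_eq_zero_of_natDegree_lt h,
      Polynomial.coeff_eq_zero_of_natDegree_lt (by rwa [Polynomial.natDegree_taylor])]

lemma coeff_taylor_of_natDegree_le_succ (h : p.natDegree ≤ N + 1) (b : R) :
    (p.taylor b).coeff N = p.coeff N + (N + 1) * b * p.coeff (N + 1) := by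
  rw [Polynomial.taylor_coeff, Polynomial.eval_eq_sum_range' (n := 2)
    (Nat.lt_succ_of_le ((Polynomial.natDegree_hasseDeriv_le p N).trans (by omega)))]
  simp only [Finset.sum_range_succ, Finset.sum_range_zero, Polynomial.hasseDeriv_coeff]
  rw [zero_add, zero_add, Nat.choose_self, add_comm 1 N, Nat.choose_succ_self_right]
  push_cast
  ring

end Taylor

section Symbols

open PowerSeries

variable {R : Type*} [CommRing R]

/-- `h j = H(ħ, ħ j)` for a series `H(ħ, x)` with `H(0, x) = σ(x)`: the coefficient of `ħ ^ N` in
`h j` is a polynomial in `j` of degree at most `N`, whose coefficient at `j ^ N` is that of `σ`. -/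
def HasSymbol (h : ℤ → PowerSeries R) (σ : PowerSeries R) : Prop :=
  ∀ N, ∃ p : Polynomial R, p.natDegree ≤ N ∧ p.coeff N = coeff N σ ∧
    ∀ j : ℤ, coeff N (h j) = p.eval (j : R)

lemma HasSymbol.constantCoeff {h : ℤ → PowerSeries R} {σ : PowerSeries R} (hh : HasSymbol h σ)
    (j : ℤ) : constantCoeff (h j) = constantCoeff σ := by
  obtain ⟨p, hdeg, htop, heval⟩ := hh 0
  rw [← coeff_zero_eq_constantCoeff_apply, ← coeff_zero_eq_constantCoeff_apply, heval, ← htop,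
    Polynomial.eq_C_of_natDegree_le_zero hdeg, Polynomial.eval_C, Polynomial.coeff_C_zero]

lemma hasSymbol_const (c : PowerSeries R) :
    HasSymbol (fun _ => c) (C (PowerSeries.constantCoeff c)) := by
  intro N
  refine ⟨Polynomial.C (coeff N c), by simp, ?_, by simp⟩
  rcases N with _ | N <;> simp [Polynomial.coeff_C]

lemma HasSymbol.add {h h' : ℤ → PowerSeries R} {σ σ' : PowerSeries R} (hh : HasSymbol h σ)
    (hh' : HasSymbol h' σ') : HasSymbol (fun j => h j + h' j) (σ + σ') := by
  intro N
  obtain ⟨p, hpdeg, hptop, hpeval⟩ := hh N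
  obtain ⟨q, hqdeg, hqtop, hqeval⟩ := hh' N
  exact ⟨p + q, Polynomial.natDegree_add_le_of_degree_le hpdeg hqdeg, by simp [hptop, hqtop],
    fun j => by simp [hpeval, hqeval]⟩

lemma HasSymbol.sum {ι : Type*} (s : Finset ι) {h : ι → ℤ → PowerSeries R}
    {σ : ι → PowerSeries R} (hh : ∀ i ∈ s, HasSymbol (h i) (σ i)) :
    HasSymbol (fun j => ∑ i ∈ s, h i j) (∑ i ∈ s, σ i) := by
  classical
  induction s using Finset.induction_on with
  | empty => simpa using hasSymbol_const (0 : PowerSeries R)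
  | insert i s hi ih =>
    simp only [Finset.sum_insert hi]
    exact (hh i (by simp)).add (ih fun j hj => hh j (by simp [hj]))

lemma HasSymbol.mul {h h' : ℤ → PowerSeries R} {σ σ' : PowerSeries R} (hh : HasSymbol h σ)
    (hh' : HasSymbol h' σ') : HasSymbol (fun j => h j * h' j) (σ * σ') := by
  intro N
  choose p hpdeg hptop hpeval using hh
  choose q hqdeg hqtop hqeval using hh'
  refine ⟨∑ x ∈ Finset.HasAntidiagonal.antidiagonal N, p x.1 * q x.2, ?_, ?_, fun j => ?_⟩
  · refine Polynomial.natDegree_sum_le_of_forall_le _ _ fun x hx => ?_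
    rw [← Finset.HasAntidiagonal.mem_antidiagonal.1 hx]
    exact Polynomial.natDegree_mul_le_of_le (hpdeg _) (hqdeg _)
  · rw [Polynomial.finsetSum_coeff, coeff_mul]
    refine Finset.sum_congr rfl fun x hx => ?_
    rw [← Finset.HasAntidiagonal.mem_antidiagonal.1 hx,
      Polynomial.coeff_mul_add_eq_of_natDegree_le (hpdeg _) (hqdeg _), hptop, hqtop]
  · rw [coeff_mul, Polynomial.eval_finsetSum]
    exact Finset.sum_congr rfl fun x _ => by rw [hpeval, hqeval, Polynomial.eval_mul]

lemma HasSymbol.const_mul {h : ℤ → PowerSeries R} {σ : PowerSeries R} (hh : HasSymbol h σ)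
    (c : PowerSeries R) :
    HasSymbol (fun j => c * h j) (C (PowerSeries.constantCoeff c) * σ) :=
  (hasSymbol_const c).mul hh

lemma HasSymbol.pow {h : ℤ → PowerSeries R} {σ : PowerSeries R} (hh : HasSymbol h σ) (n : ℕ) :
    HasSymbol (fun j => h j ^ n) (σ ^ n) := by
  induction n with
  | zero => simpa using hasSymbol_const (1 : PowerSeries R)
  | succ n ih => simpa only [pow_succ] using ih.mul hh

/- `H(ħ, x + ħ b) = H(ħ, x) + ħ b ∂ₓ H(ħ, x) + O(ħ²)`, so a shift by `b` differentiates the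
symbol. -/
lemma HasSymbol.difference {h : ℤ → PowerSeries R} {σ : PowerSeries R} (hh : HasSymbol h σ)
    (b : ℤ) : ∃ h' : ℤ → PowerSeries R, (∀ j, h (j + b) = h j + X * h' j) ∧
      HasSymbol h' (C (b : R) * derivative R σ) := by
  refine ⟨fun j => mk fun N => coeff (N + 1) (h (j + b) - h j), fun j => ?_, fun N => ?_⟩
  · ext N
    rcases N with _ | N
    · simp [hh.constantCoeff]
    · rw [map_add, coeff_succ_X_mul, coeff_mk, map_sub]; ring
  · obtain ⟨p, hdeg, htop, heval⟩ := hh (N + 1)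
    refine ⟨p.taylor (b : R) - p, ?_, ?_, fun j => ?_⟩
    · rw [Polynomial.natDegree_le_iff_coeff_eq_zero]
      intro m hm
      rw [Polynomial.coeff_sub, coeff_taylor_of_natDegree_le (by omega), sub_self]
    · rw [Polynomial.coeff_sub, coeff_taylor_of_natDegree_le_succ hdeg, coeff_C_mul,
        coeff_derivative, ← htop]
      ring
    · rw [coeff_mk, map_sub, heval, heval, Polynomial.taylor_apply]; simp

lemma HasSymbol.expSeries {h : ℤ → PowerSeries ℂ} {σ : PowerSeries ℂ} (hh : HasSymbol h σ) :
    HasSymbol (fun j => expSeries (h j)) (expSeries σ) := by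
  intro N
  set c := PowerSeries.constantCoeff σ
  have symbol_sub_const : HasSymbol (fun j => h j + C (-c)) (σ + C (-c)) := by
    simpa using hh.add (hasSymbol_const (C (-c)))
  have symbol_truncated_exp := (HasSymbol.sum (Finset.range (N + 1)) fun n _ =>
    (symbol_sub_const.pow n).const_mul (C ((n ! : ℂ)⁻¹))).const_mul (C (Complex.exp c))
  simp only [constantCoeff_C] at symbol_truncated_exp
  obtain ⟨p, hdeg, htop, heval⟩ := symbol_truncated_exp N
  refine ⟨p, hdeg, ?_, fun j => ?_⟩
  · rw [htop, coeff_expSeries]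
  · rw [← heval, coeff_expSeries, hh.constantCoeff]

end Symbols

section WeightSymbols

open PowerSeries

lemma hasSymbol_psiBarAt (psi : ℕ → PowerSeries ℂ) (c : ℂ) :
    HasSymbol (fun j => psiBarAt psi (j + c)) (psi 0) := by
  intro N
  have natDegree_term_le (d : ℕ) : (Polynomial.C (coeff (N - 2 * d) (psi d)) *
      (Polynomial.X + Polynomial.C c) ^ (N - 2 * d)).natDegree ≤ N - 2 * d :=
    (Polynomial.natDegree_C_mul_le _ _).trans (by simp)
  refine ⟨∑ d ∈ Finset.range (N / 2 + 1), Polynomial.C (coeff (N - 2 * d) (psi d)) *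
    (Polynomial.X + Polynomial.C c) ^ (N - 2 * d), ?_, ?_, fun j => ?_⟩
  · exact Polynomial.natDegree_sum_le_of_forall_le _ _ fun d _ =>
      (natDegree_term_le d).trans (by omega)
  · rw [Polynomial.finsetSum_coeff, Finset.sum_eq_single 0]
    · rw [Polynomial.coeff_C_mul, Polynomial.coeff_X_add_C_pow]; simp
    · intro d hd hd0
      rw [Finset.mem_range] at hd
      exact Polynomial.coeff_eq_zero_of_natDegree_lt
        ((natDegree_term_le d).trans_lt (by omega))
    · simp
  · simp [psiBarAt, Polynomial.eval_finsetSum]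

lemma psiBarAt_neg {psi : ℕ → PowerSeries ℂ} (hpsi : ∀ d n, Odd n → coeff n (psi d) = 0)
    (c : ℂ) : psiBarAt psi (-c) = psiBarAt psi c := by
  ext N
  simp only [psiBarAt, coeff_mk]
  refine Finset.sum_congr rfl fun d _ => ?_
  rcases Nat.even_or_odd (N - 2 * d) with h | h
  · rw [h.neg_pow]
  · rw [hpsi d _ h, zero_mul, zero_mul]

/-- The extension of `T_k` to all integers `k` by `T_{-k} = -T_k`. -/
def TInt (psi : ℕ → PowerSeries ℂ) (j : ℤ) : PowerSeries ℂ :=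
  if 0 ≤ j then T psi j.natAbs else -T psi j.natAbs

lemma T_succ (psi : ℕ → PowerSeries ℂ) (k : ℕ) :
    T psi (k + 1) = T psi k + psiBarAt psi (k + 1 / 2) := by
  rw [T, Finset.sum_range_succ, T]

lemma TInt_neg_natCast (psi : ℕ → PowerSeries ℂ) (k : ℕ) : TInt psi (-k) = -T psi k := by
  rcases k.eq_zero_or_pos with rfl | hk
  · simp [TInt, T]
  · rw [TInt, if_neg (by omega), Int.natAbs_neg, Int.natAbs_natCast]

lemma TInt_succ {psi : ℕ → PowerSeries ℂ} (hpsi : ∀ d n, Odd n → coeff n (psi d) = 0) (j : ℤ) :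
    TInt psi (j + 1) = TInt psi j + psiBarAt psi (j + 1 / 2) := by
  rcases le_or_gt 0 j with h | h
  · lift j to ℕ using h
    rw [TInt, if_pos (by omega), TInt, if_pos (by omega),
      show ((j : ℤ) + 1).natAbs = j + 1 by omega, T_succ,
      Int.natAbs_natCast, Int.cast_natCast]
  · obtain ⟨n, rfl⟩ : ∃ n : ℕ, j = -(n + 1 : ℕ) := ⟨j.natAbs - 1, by omega⟩
    have midpoint_eq : ((-((n + 1 : ℕ) : ℤ) : ℤ) : ℂ) + 1 / 2 = -(n + 1 / 2) := by
      push_cast; ring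
    rw [midpoint_eq, psiBarAt_neg hpsi, TInt_neg_natCast, T_succ,
      show -((n + 1 : ℕ) : ℤ) + 1 = -n by push_cast; ring, TInt_neg_natCast]
    ring

lemma TInt_sub {psi : ℕ → PowerSeries ℂ} (hpsi : ∀ d n, Odd n → coeff n (psi d) = 0) (j : ℤ)
    (k : ℕ) : TInt psi j - TInt psi (j - k) =
      ∑ i ∈ Finset.range k, psiBarAt psi (j + (i - k + 1 / 2)) := by
  have telescope := Finset.sum_range_sub (fun i : ℕ => TInt psi (j - k + i)) k
  simp only [Nat.cast_zero, add_zero, sub_add_cancel] at telescope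
  rw [← telescope]
  refine Finset.sum_congr rfl fun i _ => ?_
  rw [Nat.cast_add, Nat.cast_one, ← add_assoc, TInt_succ hpsi, add_sub_cancel_left]
  congr 1
  push_cast
  ring

lemma weightInt_weight (psi : ℕ → PowerSeries ℂ) (j : ℤ) :
    weightInt (weight psi) j = ((expSeries (2 * TInt psi j) : PowerSeries ℂ) : HSeries) := by
  rw [weightInt, TInt]
  split_ifs with h
  · rfl
  · rw [weight]
    refine inv_eq_of_mul_eq_one_right ?_
    rw [← PowerSeries.coe_mul, mul_neg, expSeries_mul_neg, PowerSeries.coe_one]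

lemma weight_ne_zero (psi : ℕ → PowerSeries ℂ) (k : ℕ) : weight psi k ≠ 0 := by
  refine left_ne_zero_of_mul_eq_one
    (b := ((expSeries (-(2 * T psi k)) : PowerSeries ℂ) : HSeries)) ?_
  rw [weight, ← PowerSeries.coe_mul, expSeries_mul_neg, PowerSeries.coe_one]

lemma weight_zero (psi : ℕ → PowerSeries ℂ) : weight psi 0 = 1 := by
  simp [weight, T, expSeries_zero]

lemma exists_hasSymbol_weight_div {psi : ℕ → PowerSeries ℂ}
    (hpsi : ∀ d n, Odd n → coeff n (psi d) = 0) (k : ℕ) :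
    ∃ h : ℤ → PowerSeries ℂ, HasSymbol h (expSeries (2 * psi 0) ^ k) ∧ ∀ j : ℤ,
      weightInt (weight psi) j / weightInt (weight psi) (j - k) =
        ((h j : PowerSeries ℂ) : HSeries) := by
  have C_two : (C 2 : PowerSeries ℂ) = 2 := map_ofNat C 2
  refine ⟨fun j => expSeries (C 2 * ∑ i ∈ Finset.range k, psiBarAt psi (j + (i - k + 1 / 2))), ?_,
    fun j => ?_⟩
  · have symbol := ((HasSymbol.sum (Finset.range k) fun i _ =>
      hasSymbol_psiBarAt psi (i - k + 1 / 2)).const_mul (C 2)).expSeries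
    rw [← expSeries_nsmul]
    convert symbol using 2
    rw [constantCoeff_C, C_two]
    simp [mul_left_comm]
  · dsimp only
    rw [div_eq_iff (weightInt_ne_zero (weight_ne_zero psi) _), weightInt_weight,
      weightInt_weight, ← TInt_sub hpsi, ← PowerSeries.coe_mul, ← expSeries_add, C_two,
      ← mul_add, sub_add_cancel]

end WeightSymbols

section Parity

open PowerSeries

variable {R : Type*} [CommRing R]

lemma rescale_neg_one_of_odd {f : PowerSeries R} (hf : ∀ n, Even n → coeff n f = 0) :
    rescale (-1 : R) f = -f := by
  ext n
  rw [coeff_rescale, map_neg]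
  rcases Nat.even_or_odd n with h | h
  · rw [hf n h, mul_zero, neg_zero]
  · rw [h.neg_one_pow, neg_one_mul]

lemma rescale_neg_one_of_even {f : PowerSeries R} (hf : ∀ n, Odd n → coeff n f = 0) :
    rescale (-1 : R) f = f := by
  ext n
  rw [coeff_rescale]
  rcases Nat.even_or_odd n with h | h
  · rw [h.neg_one_pow, one_mul]
  · rw [hf n h, mul_zero]

lemma coeff_eq_zero_of_rescale_neg_one [NoZeroDivisors R] [CharZero R] {f : PowerSeries R}
    {p m : ℕ} (h : rescale (-1 : R) f = (-1) ^ p * f) (hpm : Odd (p + m)) : coeff m f = 0 := by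
  have coeff_eq := congrArg (coeff m) h
  have C_pow : (-1 : PowerSeries R) ^ p = C ((-1 : R) ^ p) := by simp
  rw [coeff_rescale, C_pow, coeff_C_mul] at coeff_eq
  rcases Nat.even_or_odd p with hp | hp
  · rw [hp.neg_one_pow, ((Nat.odd_add'.1 hpm).2 hp).neg_one_pow, neg_one_mul, one_mul] at coeff_eq
    exact neg_eq_self.1 coeff_eq
  · rw [hp.neg_one_pow, ((Nat.odd_add.1 hpm).1 hp).neg_one_pow, neg_one_mul, one_mul] at coeff_eq
    exact self_eq_neg.1 coeff_eq

lemma rescale_expSeries (f : PowerSeries ℂ) (r : ℂ) :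
    rescale r (expSeries f) = expSeries (rescale r f) := by
  rw [rescale_eq_subst, rescale_eq_subst, expSeries_subst]
  simp

lemma rescale_neg_one_expSeries_two_mul_pow {f : PowerSeries ℂ}
    (hf : ∀ n, Odd n → coeff n f = 0) (k : ℕ) :
    rescale (-1 : ℂ) (expSeries (2 * f) ^ k) = expSeries (2 * f) ^ k := by
  rw [map_pow, rescale_expSeries, map_mul, rescale_neg_one_of_even hf, map_ofNat]

end Parity

section OddTruncation

open PowerSeries

variable {R : Type*} [CommRing R]

/-- The truncation `∑_{j < N} f_{2j+1} z^{2j+1}` of an odd series `f`. -/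
def oddTrunc (f : PowerSeries R) (N : ℕ) : PowerSeries R :=
  ∑ j ∈ Finset.range N, C (coeff (2 * j + 1) f) * X ^ (2 * j + 1)

lemma constantCoeff_oddTrunc (f : PowerSeries R) (N : ℕ) :
    constantCoeff (oddTrunc f N) = 0 := by
  simp [oddTrunc]

lemma rescale_neg_one_oddTrunc (f : PowerSeries R) (N : ℕ) :
    rescale (-1 : R) (oddTrunc f N) = -oddTrunc f N := by
  refine rescale_neg_one_of_odd fun n hn => ?_
  rw [oddTrunc, map_sum]
  refine Finset.sum_eq_zero fun j _ => ?_
  rw [coeff_C_mul, coeff_X_pow, if_neg, mul_zero]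
  rintro rfl
  simp [parity_simps] at hn

lemma coeff_oddTrunc {f : PowerSeries R} (hf : ∀ n, Even n → coeff n f = 0) {N m : ℕ}
    (hm : m < 2 * N + 1) : coeff m (oddTrunc f N) = coeff m f := by
  simp only [oddTrunc, map_sum, coeff_C_mul, coeff_X_pow, mul_ite, mul_one, mul_zero]
  rcases Nat.even_or_odd m with hm_even | ⟨r, rfl⟩
  · rw [hf m hm_even]
    refine Finset.sum_eq_zero fun j _ => if_neg ?_
    rintro rfl
    simp [parity_simps] at hm_even
  · rw [Finset.sum_eq_single r (fun j _ hj => if_neg (by omega))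
      (fun hr => absurd (Finset.mem_range.2 (by omega)) hr), if_pos rfl]

lemma coeff_oddTrunc_pow {f : PowerSeries R} (hf : ∀ n, Even n → coeff n f = 0) {N m : ℕ}
    (hm : m < 2 * N + 1) (l : ℕ) : coeff m (oddTrunc f N ^ l) = coeff m (f ^ l) := by
  have X_pow_dvd_sub : X ^ (2 * N + 1) ∣ f - oddTrunc f N :=
    X_pow_dvd_iff.2 fun n hn => by rw [map_sub, coeff_oddTrunc hf hn, sub_self]
  have coeff_sub := X_pow_dvd_iff.1 (X_pow_dvd_sub.trans (sub_dvd_pow_sub_pow _ _ l)) m hm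
  rw [map_sub, sub_eq_zero] at coeff_sub
  exact coeff_sub.symm

lemma coeff_subst_eq_sum_oddTrunc {f : PowerSeries R} (hf : ∀ n, Even n → coeff n f = 0)
    (E : PowerSeries R) {N M m : ℕ} (hN : m < 2 * N + 1) (hM : m < M) :
    coeff m (E.subst f) = ∑ p ∈ Finset.range M, coeff p E * coeff m (oddTrunc f N ^ p) := by
  have constantCoeff_eq : constantCoeff f = 0 := by
    rw [← coeff_zero_eq_constantCoeff_apply, hf 0 Even.zero]
  rw [coeff_subst_eq_sum E constantCoeff_eq hM]
  simp only [coeff_oddTrunc_pow hf hN]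

/-- The coefficient of `z ^ m` of a power series for `m ∈ ℤ`, so `0` for negative `m`. It makes
the entries of matrices indexed by `ℤ` uniform in the index. -/
def coeffInt (m : ℤ) (f : PowerSeries R) : R := if 0 ≤ m then coeff m.natAbs f else 0

lemma coeffInt_natCast (m : ℕ) (f : PowerSeries R) : coeffInt m f = coeff m f := by
  simp [coeffInt]

lemma coeffInt_of_neg {m : ℤ} (hm : m < 0) (f : PowerSeries R) : coeffInt m f = 0 :=
  if_neg hm.not_ge

lemma coeffInt_X_pow_mul (m : ℤ) (n : ℕ) (g : PowerSeries R) :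
    coeffInt m (X ^ n * g) = coeffInt (m - n) g := by
  unfold coeffInt
  rcases lt_or_ge m 0 with hm | hm
  · rw [if_neg (by omega), if_neg (by omega)]
  · rw [if_pos hm, coeff_X_pow_mul', show (m - n).natAbs = if n ≤ m.natAbs then m.natAbs - n else
      (m - n).natAbs by split_ifs <;> omega]
    by_cases hn : n ≤ m.natAbs
    · rw [if_pos hn, if_pos (by omega), if_pos hn]
    · rw [if_neg hn, if_neg (by omega)]

lemma coeffInt_oddTrunc_mul (f g : PowerSeries R) (N : ℕ) (m : ℤ) :
    coeffInt m (oddTrunc f N * g) =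
      ∑ j ∈ Finset.range N, coeff (2 * j + 1) f * coeffInt (m - (2 * j + 1)) g := by
  have coeffInt_sum (F : ℕ → PowerSeries R) : coeffInt m (∑ j ∈ Finset.range N, F j) =
      ∑ j ∈ Finset.range N, coeffInt m (F j) := by
    unfold coeffInt
    split_ifs <;> simp
  have coeffInt_C_mul (c : R) (F : PowerSeries R) : coeffInt m (C c * F) = c * coeffInt m F := by
    unfold coeffInt
    split_ifs <;> simp
  rw [oddTrunc, Finset.sum_mul, coeffInt_sum]
  refine Finset.sum_congr rfl fun j _ => ?_
  rw [mul_assoc, coeffInt_C_mul, coeffInt_X_pow_mul, Nat.cast_add, Nat.cast_mul, Nat.cast_ofNat,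
    Nat.cast_one]

end OddTruncation

section ShiftMinus

variable {K : Type*} [Field K]

lemma shiftOp_apply (f : ℤ → K) (k : ℤ) (v : ℤ →₀ K) (m : ℤ) :
    shiftOp f k v m = f (m + k) * v (m + k) := by
  suffices (Finsupp.lapply m ∘ₗ shiftOp f k : (ℤ →₀ K) →ₗ[K] K) =
      f (m + k) • Finsupp.lapply (m + k) from LinearMap.congr_fun this v
  refine Finsupp.lhom_ext' fun j => LinearMap.ext_ring ?_
  simp only [LinearMap.comp_apply, Finsupp.lsingle_apply, shiftOp_single, Finsupp.lapply_apply,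
    LinearMap.smul_apply, smul_eq_mul]
  by_cases h : j = m + k
  · subst h; simp
  · rw [Finsupp.single_eq_of_ne (by omega), Finsupp.single_eq_of_ne (by omega), mul_zero]

/-- The one-particle operator of `bosonMinus`. -/
def shiftMinus (s : ℕ → K) (N : ℕ) : Module.End K (ℤ →₀ K) :=
  ∑ j ∈ Finset.range N, s j • shiftOp 1 (-(2 * j + 1))

lemma isQuad_bosonMinus [NeZero (2 : K)] (s : ℕ → K) (N : ℕ) :
    IsQuad (bosonMinus s N) (shiftMinus s N) :=
  IsQuad.sum _ fun j _ => (isQuad_boson ⟨-(j + 1 : ℤ), by ring⟩).smul (s j)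

lemma shiftMinus_apply (s : ℕ → K) (N : ℕ) (v : ℤ →₀ K) (m : ℤ) :
    shiftMinus s N v m = ∑ j ∈ Finset.range N, s j * v (m - (2 * j + 1)) := by
  simp [shiftMinus, Finsupp.finsetSum_apply, shiftOp_apply, sub_eq_add_neg]

lemma shiftMinus_single (s : ℕ → K) (N : ℕ) (i : ℤ) :
    shiftMinus s N (Finsupp.single i 1) =
      ∑ j ∈ Finset.range N, s j • Finsupp.single (i + (2 * j + 1)) 1 := by
  simp only [shiftMinus, LinearMap.sum_apply, LinearMap.smul_apply, shiftOp_single, sub_neg_eq_add,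
    Pi.one_apply]

lemma nested_shiftMinus_succ (s : ℕ → K) (N : ℕ) (A : Module.End K (ℤ →₀ K)) (l : ℕ) (i m : ℤ) :
    nested (shiftMinus s N) A (l + 1) (Finsupp.single i 1) m = ∑ j ∈ Finset.range N, s j *
      (nested (shiftMinus s N) A l (Finsupp.single (i + (2 * j + 1)) 1) m -
        nested (shiftMinus s N) A l (Finsupp.single i 1) (m - (2 * j + 1))) := by
  calc nested (shiftMinus s N) A (l + 1) (Finsupp.single i 1) m
      = nested (shiftMinus s N) A l (shiftMinus s N (Finsupp.single i 1)) m -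
          shiftMinus s N (nested (shiftMinus s N) A l (Finsupp.single i 1)) m := rfl
    _ = _ := by
      rw [shiftMinus_apply, shiftMinus_single, map_sum, Finsupp.finsetSum_apply,
        ← Finset.sum_sub_distrib]
      refine Finset.sum_congr rfl fun j _ => ?_
      rw [map_smul, Finsupp.smul_apply, smul_eq_mul, mul_sub]

lemma nested_shiftMinus_apply_eq_zero (s : ℕ → K) (N : ℕ) (f : ℤ → K)
    (k : ℤ) (l : ℕ) (i m : ℤ) (h : i - k + 2 * N * l < m) :
    nested (shiftMinus s N) (shiftOp f k) l (Finsupp.single i 1) m = 0 := by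
  induction l generalizing i m with
  | zero =>
    simp only [nested, shiftOp_single]
    exact Finsupp.single_eq_of_ne (by push_cast at h; omega)
  | succ l ih =>
    rw [nested_shiftMinus_succ]
    refine Finset.sum_eq_zero fun j hj => ?_
    have hj : (j : ℤ) + 1 ≤ N := by exact_mod_cast Finset.mem_range.1 hj
    push_cast at h
    rw [ih _ _ (by linarith), ih _ _ (by linarith), sub_self, mul_zero]

end ShiftMinus

section MatrixSymbols

open PowerSeries

/-- The matrix entries of `A` on the `n`-th diagonal, i.e. the coefficients of `e_{i-n}` in
`A e_i`, are power series in `ħ` with symbol `σ n`. -/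
def HasMatrixSymbol (A : Module.End HSeries (ℤ →₀ HSeries)) (σ : ℤ → PowerSeries ℂ) : Prop :=
  ∀ n : ℤ, ∃ h : ℤ → PowerSeries ℂ, HasSymbol h (σ n) ∧
    ∀ i : ℤ, A (Finsupp.single i 1) (i - n) = ((h i : PowerSeries ℂ) : HSeries)

lemma sTimeRescaled_mul (y : ℕ → PowerSeries ℂ) (j : ℕ) (f : PowerSeries ℂ) :
    sTimeRescaled y j * ((X * f : PowerSeries ℂ) : HSeries) =
      ((sTime y j * f : PowerSeries ℂ) : HSeries) := by
  have single_mul_single :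
      HahnSeries.single (-1 : ℤ) (1 : ℂ) * HahnSeries.single (1 : ℤ) (1 : ℂ) = 1 := by
    rw [HahnSeries.single_mul_single]; simp
  rw [sTimeRescaled, PowerSeries.coe_mul, PowerSeries.coe_mul, PowerSeries.coe_X]
  linear_combination ((sTime y j : PowerSeries ℂ) : HSeries) * (f : HSeries) * single_mul_single

lemma constantCoeff_sTime (y : ℕ → PowerSeries ℂ) (j : ℕ) :
    constantCoeff (sTime y j) = coeff (2 * j + 1) (y 0) / (2 * j + 1) := by
  rw [← coeff_zero_eq_constantCoeff_apply, sTime, coeff_mk]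
  simp

lemma two_mul_natCast_add_one_ne_zero {R : Type*} [Semiring R] [CharZero R] (j : ℕ) :
    2 * (j : R) + 1 ≠ 0 := by
  exact_mod_cast Nat.succ_ne_zero (2 * j)

/- A commutator with `ħ⁻¹ s_k J_{-k}` is `ħ⁻¹` times a finite difference of step `k`, so to leading
order it differentiates the symbol. -/
lemma HasMatrixSymbol.nested_succ {A : Module.End HSeries (ℤ →₀ HSeries)}
    {y : ℕ → PowerSeries ℂ} {N l : ℕ} {σ : ℤ → PowerSeries ℂ}
    (hA : HasMatrixSymbol (nested (shiftMinus (sTimeRescaled y) N) A l) σ) :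
    HasMatrixSymbol (nested (shiftMinus (sTimeRescaled y) N) A (l + 1))
      fun n => ∑ j ∈ Finset.range N,
        C (coeff (2 * j + 1) (y 0)) * derivative ℂ (σ (n + (2 * j + 1))) := by
  intro n
  choose h symbol_h entry_h using hA
  choose h' shift_h symbol_h' using
    fun j : ℕ => (symbol_h (n + (2 * j + 1))).difference (2 * j + 1)
  refine ⟨fun i => ∑ j ∈ Finset.range N, sTime y j * h' j i, ?_, fun i => ?_⟩
  · refine HasSymbol.sum _ fun j _ => ?_
    have symbol_term := (symbol_h' j).const_mul (sTime y j)
    rw [constantCoeff_sTime, ← mul_assoc, ← map_mul] at symbol_term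
    convert symbol_term using 3
    push_cast
    rw [div_mul_cancel₀ _ (two_mul_natCast_add_one_ne_zero j)]
  · rw [nested_shiftMinus_succ, map_sum]
    refine Finset.sum_congr rfl fun j _ => ?_
    have entry_source := entry_h (n + (2 * j + 1)) (i + (2 * j + 1))
    have entry_target := entry_h (n + (2 * j + 1)) i
    rw [show i + (2 * (j : ℤ) + 1) - (n + (2 * j + 1)) = i - n by ring] at entry_source
    rw [show i - (n + (2 * (j : ℤ) + 1)) = i - n - (2 * j + 1) by ring] at entry_target
    rw [entry_source, entry_target, ← PowerSeries.coe_sub, shift_h, add_sub_cancel_left,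
      sTimeRescaled_mul]

lemma hasMatrixSymbol_nested {A : Module.End HSeries (ℤ →₀ HSeries)} {k : ℤ}
    {E : PowerSeries ℂ} (hA : HasMatrixSymbol A fun n => if n = k then E else 0)
    (y : ℕ → PowerSeries ℂ) (N l : ℕ) :
    HasMatrixSymbol (nested (shiftMinus (sTimeRescaled y) N) A l)
      fun n => C (coeffInt (k - n) (oddTrunc (y 0) N ^ l)) * (derivative ℂ)^[l] E := by
  induction l with
  | zero =>
    refine (congrArg (HasMatrixSymbol A) (funext fun n => ?_)).mp hA
    rw [Function.iterate_zero, id, pow_zero]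
    rcases lt_trichotomy n k with h | rfl | h
    · obtain ⟨r, hr⟩ : ∃ r : ℕ, k - n = (r + 1 : ℕ) := ⟨(k - n).natAbs - 1, by omega⟩
      rw [if_neg h.ne, hr, coeffInt_natCast, coeff_one, if_neg r.succ_ne_zero, map_zero, zero_mul]
    · simp [coeffInt]
    · rw [if_neg h.ne', coeffInt_of_neg (by omega), map_zero, zero_mul]
  | succ l ih =>
    refine (congrArg (HasMatrixSymbol _) (funext fun n => ?_)).mp ih.nested_succ
    rw [pow_succ', coeffInt_oddTrunc_mul, map_sum, Finset.sum_mul]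
    refine Finset.sum_congr rfl fun j _ => ?_
    rw [Derivation.leibniz, derivative_C, smul_zero, add_zero, smul_eq_mul, map_mul,
      Function.iterate_succ_apply', ← mul_assoc]
    congr 4
    ring

lemma hasMatrixSymbol_shiftOp_weight_div {psi : ℕ → PowerSeries ℂ}
    (hpsi : ∀ d n, Odd n → coeff n (psi d) = 0) (k : ℕ) :
    HasMatrixSymbol
      (shiftOp (fun j => weightInt (weight psi) j / weightInt (weight psi) (j - k)) k)
      fun n => if n = (k : ℤ) then expSeries (2 * psi 0) ^ k else 0 := by
  intro n
  obtain ⟨h, symbol_h, entry_h⟩ := exists_hasSymbol_weight_div hpsi k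
  by_cases hn : n = k
  · subst hn
    refine ⟨h, by simpa only [↓reduceIte] using symbol_h, fun i => ?_⟩
    rw [shiftOp_single, Finsupp.single_eq_same, entry_h]
  · refine ⟨fun _ => 0, by simpa [hn] using hasSymbol_const (0 : PowerSeries ℂ), fun i => ?_⟩
    rw [shiftOp_single, Finsupp.single_eq_of_ne (by omega), map_zero]

end MatrixSymbols

section PairingSums

lemma sum_range_sum_range_add {R : Type*} [AddCommMonoid R] {M : ℕ} {G : ℕ → ℕ → R}
    (hG : ∀ n b, M ≤ n → G n b = 0) :
    ∑ a ∈ Finset.range M, ∑ b ∈ Finset.range a, G (a + b) b =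
      ∑ n ∈ Finset.range M, ∑ b ∈ Finset.range ((n + 1) / 2), G n b := by
  simp only [Finset.sum_sigma']
  refine Finset.sum_bij_ne_zero (fun p _ _ => ⟨p.1 + p.2, p.2⟩) ?_ ?_ ?_ fun _ _ _ => rfl
  · rintro ⟨a, b⟩ hp hne
    simp only [Finset.mem_sigma, Finset.mem_range] at hp ⊢
    have : ¬ M ≤ a + b := fun h => hne (hG _ _ h)
    omega
  · rintro ⟨a, b⟩ _ _ ⟨c, d⟩ _ _ h
    simp only [Sigma.mk.injEq, heq_eq_eq] at h ⊢
    omega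
  · rintro ⟨n, b⟩ hp hne
    simp only [Finset.mem_sigma, Finset.mem_range] at hp
    have sub_add : n - b + b = n := by omega
    refine ⟨⟨n - b, b⟩, ?_, by simpa only [sub_add] using hne, by simp only [sub_add]⟩
    simp only [Finset.mem_sigma, Finset.mem_range]
    omega

variable {K : Type*} [Field K] [NeZero (2 : K)]

lemma sum_neg_neg_one_pow_mul_pairing (r : ℕ) :
    ∑ b ∈ Finset.range (r + 1), -(-1) ^ (2 * r + 1 - b) * pairing K b = (2 * r + 1) / 2 := by
  have term_eq_one (b : ℕ) (hb : b ∈ Finset.range r) :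
      -(-1 : K) ^ (2 * r + 1 - (b + 1)) * pairing K (b + 1) = 1 := by
    have hb := Finset.mem_range.1 hb
    rw [pairing, if_neg b.succ_ne_zero, neg_mul, ← pow_add, Odd.neg_one_pow ⟨r, by omega⟩, neg_neg]
  rw [Finset.sum_range_succ', Finset.sum_congr rfl term_eq_one, Finset.sum_const,
    Finset.card_range, nsmul_one, Nat.sub_zero, Odd.neg_one_pow ⟨r, rfl⟩, pairing, if_pos rfl]
  have := two_ne_zero (α := K)
  field_simp

lemma sum_pairing {F : ℕ → K} {M : ℕ} (heven : ∀ n, Even n → F n = 0)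
    (hM : ∀ n, M ≤ n → F n = 0) :
    ∑ a ∈ Finset.range M, ∑ b ∈ Finset.range a, -(-1) ^ a * pairing K b * F (a + b) =
      ∑ n ∈ Finset.range M, n / 2 * F n := by
  have reindex := sum_range_sum_range_add (M := M)
    (G := fun n b => -(-1) ^ (n - b) * pairing K b * F n) fun n b hn => by rw [hM n hn, mul_zero]
  simp only [Nat.add_sub_cancel] at reindex
  rw [reindex]
  refine Finset.sum_congr rfl fun n _ => ?_
  rw [← Finset.sum_mul]
  rcases Nat.even_or_odd n with hn | ⟨r, rfl⟩
  · rw [heven n hn, mul_zero, mul_zero]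
  · rw [show (2 * r + 1 + 1) / 2 = r + 1 by omega, sum_neg_neg_one_pow_mul_pairing]
    push_cast
    rfl

end PairingSums

section LeadingEntries

open PowerSeries

/-- The inclusion of the constants into `HSeries`. -/
def constH : ℂ →+* HSeries := (HahnSeries.ofPowerSeries ℤ ℂ).comp (C : ℂ →+* PowerSeries ℂ)

instance instCharZeroHSeries : CharZero HSeries := charZero_of_injective_ringHom constH.injective

lemma coeff_constH_mul (c : ℂ) (x : HSeries) (n : ℤ) :
    (constH c * x).coeff n = c * x.coeff n := by
  rw [constH, RingHom.comp_apply, PowerSeries.coe_C, HahnSeries.C_mul_eq_smul,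
    HahnSeries.coeff_smul, smul_eq_mul]

lemma constH_neg_neg_one_pow_mul_pairing (a b : ℕ) :
    constH (-(-1) ^ a * pairing ℂ b) = -(-1) ^ a * pairing HSeries b := by
  rw [map_mul, map_neg, map_pow, map_neg, map_one]
  unfold pairing
  split_ifs
  · rw [map_div₀, map_one, map_ofNat]
  · rw [map_pow, map_neg, map_one]

lemma constH_inv_factorial (l : ℕ) : constH (l ! : ℂ)⁻¹ = (l ! : HSeries)⁻¹ := by
  rw [map_inv₀, map_natCast]

lemma coeff_single_mul_coe (m : ℤ) (f : PowerSeries ℂ) :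
    (HahnSeries.single m (1 : ℂ) * (f : HSeries)).coeff m = constantCoeff f := by
  have coeff_eq := HahnSeries.coeff_single_mul_add (r := (1 : ℂ)) (x := (f : HSeries)) (a := 0)
    (b := m)
  rw [zero_add, one_mul] at coeff_eq
  rw [coeff_eq, ← coeff_zero_eq_constantCoeff_apply]
  exact LaurentSeries.coeff_coe_powerSeries f 0

/-- The matrix entries of `A` on the `n`-th diagonal, i.e. the coefficients of `e_{i-n}` in
`A e_i`, are of the form `a n * ħ ^ m + O(ħ ^ (m + 1))`. -/
def HasLeadingEntries (A : Module.End HSeries (ℤ →₀ HSeries)) (m : ℤ) (a : ℤ → ℂ) : Prop :=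
  ∀ n i : ℤ, ∃ f : PowerSeries ℂ,
    A (Finsupp.single i 1) (i - n) = HahnSeries.single m (1 : ℂ) * (f : HSeries) ∧
      constantCoeff f = a n

lemma hasLeadingEntries_nested {psi : ℕ → PowerSeries ℂ}
    (hpsi : ∀ d n, Odd n → coeff n (psi d) = 0) (y : ℕ → PowerSeries ℂ) (k N l : ℕ) :
    HasLeadingEntries
      (nested (shiftMinus (sTimeRescaled y) N)
        (shiftOp (fun j => weightInt (weight psi) j / weightInt (weight psi) (j - k)) k) l) 0
      fun n => (l ! : ℂ) * (coeff l (expSeries (2 * psi 0) ^ k) *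
        coeffInt (k - n) (oddTrunc (y 0) N ^ l)) := by
  intro n i
  obtain ⟨h, symbol_h, entry_h⟩ :=
    hasMatrixSymbol_nested (hasMatrixSymbol_shiftOp_weight_div hpsi k) y N l n
  refine ⟨h i, ?_, ?_⟩
  · rw [entry_h, show HahnSeries.single (0 : ℤ) (1 : ℂ) = 1 from rfl, one_mul]
  · rw [symbol_h.constantCoeff, map_mul, constantCoeff_C, constantCoeff_iterate_derivative]
    ring

lemma hasLeadingEntries_shiftMinus (y : ℕ → PowerSeries ℂ) (N : ℕ) :
    HasLeadingEntries (shiftMinus (sTimeRescaled y) N) (-1) fun n => ∑ j ∈ Finset.range N,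
      if n = -(2 * j + 1) then coeff (2 * j + 1) (y 0) / (2 * j + 1) else 0 := by
  intro n i
  refine ⟨∑ j ∈ Finset.range N, if n = -(2 * j + 1) then sTime y j else 0, ?_, ?_⟩
  · rw [shiftMinus_apply, map_sum, Finset.mul_sum]
    refine Finset.sum_congr rfl fun j _ => ?_
    split_ifs with hn
    · rw [show i - n - (2 * j + 1) = i by omega, Finsupp.single_eq_same, mul_one, sTimeRescaled]
    · rw [Finsupp.single_eq_of_ne (by omega), map_zero, mul_zero, mul_zero]
  · rw [map_sum]
    refine Finset.sum_congr rfl fun j _ => ?_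
    split_ifs
    · exact constantCoeff_sTime y j
    · exact map_zero _

lemma IsQuad.coeff_vev_mul {P P' : Module.End HSeries (Fock HSeries)}
    {A A' : Module.End HSeries (ℤ →₀ HSeries)} (h : IsQuad P A) (h' : IsQuad P' A') {m m' : ℤ}
    {a a' : ℤ → ℂ} (ha : HasLeadingEntries A m a) (ha' : HasLeadingEntries A' m' a')
    (heven : ∀ n : ℕ, Even n → a n * a' (-n) = 0) {N : ℕ}
    (hN : ∀ i j : ℕ, N ≤ i → A' (Finsupp.single (-i : ℤ) 1) j = 0) :
    (vev HSeries (P * P') - vev HSeries P * vev HSeries P').coeff (m + m') =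
      ∑ n ∈ Finset.range N, (n / 2 : ℂ) * (a n * a' (-n)) := by
  have coeff_entry (i j : ℕ) :
      (-(-1) ^ i * pairing HSeries j * (A (Finsupp.single (i : ℤ) 1) (-j) *
        A' (Finsupp.single (-i : ℤ) 1) j)).coeff (m + m') =
      -(-1) ^ i * pairing ℂ j * (a (i + j : ℕ) * a' (-(i + j : ℕ))) := by
    obtain ⟨f, entry_f, f_zero⟩ := ha (i + j : ℕ) i
    obtain ⟨f', entry_f', f'_zero⟩ := ha' (-(i + j : ℕ)) (-i)
    rw [show (i : ℤ) - (i + j : ℕ) = -j by push_cast; ring] at entry_f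
    rw [show -(i : ℤ) - -(i + j : ℕ) = j by push_cast; ring] at entry_f'
    rw [← constH_neg_neg_one_pow_mul_pairing, coeff_constH_mul, entry_f, entry_f',
      mul_mul_mul_comm, HahnSeries.single_mul_single, one_mul, ← PowerSeries.coe_mul,
      coeff_single_mul_coe, map_mul, f_zero, f'_zero]
  have vanish (n : ℕ) (hn : N ≤ n) : a n * a' (-n) = 0 := by
    obtain ⟨f', entry_f', f'_zero⟩ := ha' (-n) (-n)
    have coeff_zero : (0 : HSeries).coeff m' = constantCoeff f' := by
      rw [← coeff_single_mul_coe, ← entry_f', sub_self]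
      exact congrArg (fun x : HSeries => x.coeff m') (hN n 0 hn).symm
    rw [← f'_zero, ← coeff_zero, HahnSeries.coeff_zero, mul_zero]
  rw [h.vev_mul h' N hN, add_sub_cancel_left, HahnSeries.coeff_sum]
  simp only [HahnSeries.coeff_sum, coeff_entry]
  exact sum_pairing (F := fun n => a n * a' (-n)) heven vanish

end LeadingEntries

section OnePointLeading

open PowerSeries

lemma shiftMinus_apply_eq_zero {K : Type*} [Field K] (s : ℕ → K) {N i j : ℕ} (h : 2 * N ≤ i + j) :
    shiftMinus s N (Finsupp.single (-i : ℤ) 1) j = 0 := by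
  rw [shiftMinus_apply]
  refine Finset.sum_eq_zero fun r hr => ?_
  have hr := Finset.mem_range.1 hr
  rw [Finsupp.single_eq_of_ne (by omega), mul_zero]

lemma isQuad_nested_dressedBoson (psi y : ℕ → PowerSeries ℂ) {k : ℕ} (hk : Odd k) (N l : ℕ) :
    IsQuad (nested (bosonMinus (sTimeRescaled y) N) (dressedBoson (weight psi) k) l)
      (nested (shiftMinus (sTimeRescaled y) N)
        (shiftOp (fun j => weightInt (weight psi) j / weightInt (weight psi) (j - k)) k) l) :=
  (isQuad_dressedBoson (by rw [weight_zero, mul_one]) (weight_ne_zero psi)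
    (by exact_mod_cast hk)).nested (isQuad_bosonMinus _ N) l

lemma coeff_vev_nested_succ {psi : ℕ → PowerSeries ℂ}
    (hpsi : ∀ d n, Odd n → coeff n (psi d) = 0) (y : ℕ → PowerSeries ℂ) {k : ℕ} (hk : Odd k)
    (N l : ℕ) :
    (vev HSeries (nested (bosonMinus (sTimeRescaled y) N)
      (dressedBoson (weight psi) k) (l + 1))).coeff (-1) =
      1 / 2 * (l ! * (coeff l (expSeries (2 * psi 0) ^ k) *
        coeff k (oddTrunc (y 0) N ^ (l + 1)))) := by
  set J := bosonMinus (sTimeRescaled y) N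
  set P := nested J (dressedBoson (weight psi) k)
  have hJ (v : Fock HSeries) : J v ∅ = 0 := bosonMinus_apply_empty _ _ v
  have vev_succ : vev HSeries (P (l + 1)) =
      vev HSeries (P l * J) - vev HSeries (P l) * vev HSeries J := by
    rw [nested_mul, vev_add, vev_mul_of_apply_empty hJ, add_zero, vev, vev, vev, hJ, mul_zero,
      sub_zero]
  have neg_ne_neg_odd {n j : ℕ} (hn : Even n) : ¬ -(n : ℤ) = -(2 * j + 1) := by
    obtain ⟨r, rfl⟩ := hn
    omega
  have leading := (isQuad_nested_dressedBoson psi y hk N l).coeff_vev_mul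
    (isQuad_bosonMinus (sTimeRescaled y) N) (hasLeadingEntries_nested hpsi y k N l)
    (hasLeadingEntries_shiftMinus y N)
    (fun n hn => by
      simp only [neg_ne_neg_odd hn, ↓reduceIte, Finset.sum_const_zero, mul_zero])
    (N := 2 * N) (fun i j hi => shiftMinus_apply_eq_zero _ (by omega))
  rw [zero_add] at leading
  rw [vev_succ, leading, pow_succ', ← coeffInt_natCast k, coeffInt_oddTrunc_mul]
  simp only [Finset.mul_sum]
  rw [Finset.sum_comm]
  refine Finset.sum_congr rfl fun j hj => ?_
  have hj := Finset.mem_range.1 hj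
  rw [Finset.sum_eq_single_of_mem (2 * j + 1) (Finset.mem_range.2 (by omega))
    fun n _ hn => by rw [if_neg (by omega), mul_zero, mul_zero], if_pos (by push_cast; rfl)]
  have := two_mul_natCast_add_one_ne_zero (R := ℂ) j
  push_cast
  field_simp

lemma vev_dressedBoson {K : Type*} [Field K] [CharZero K] {w : ℕ → K} (hw : ∀ k, w k ≠ 0) {k : ℤ}
    (hk : k ≠ 0) : vev K (dressedBoson w k) = 0 := by
  rw [← vev_diagonalElement_mul w, ← boson_mul_diagonalElement hw]
  exact ((hasEnergy_boson hk).mul (hasEnergy_diagonalElement w)).vev_eq_zero (by omega)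

lemma coeff_derivAtZero_singleton {psi y : ℕ → PowerSeries ℂ}
    (hpsi : ∀ d n, Odd n → coeff n (psi d) = 0) (hy : ∀ n, Even n → coeff n (y 0) = 0) (j : ℕ)
    {F : PowerSeries ℂ} (hF : derivative ℂ F = expSeries (2 * psi 0) ^ (2 * j + 1))
    (hF0 : constantCoeff F = 0) :
    (derivAtZero (tauAt (weight psi) (sTimeRescaled y)) [j]).coeff (-1) =
      1 / 2 * coeff (2 * j + 1) (F.subst (y 0)) := by
  rw [coeff_subst_eq_sum_oddTrunc hy F (N := 2 * j + 1) (by omega) (Nat.lt_succ_self _),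
    Finset.sum_range_succ', coeff_zero_eq_constantCoeff_apply, hF0, zero_mul, add_zero,
    derivAtZero_tauAt_singleton (weight_ne_zero psi) (sTimeRescaled y) j le_rfl
    (Nat.lt_succ_self _), Finset.sum_range_succ', nested,
    vev_dressedBoson (weight_ne_zero psi) (by omega), mul_zero, add_zero, HahnSeries.coeff_sum,
    Finset.mul_sum]
  refine Finset.sum_congr rfl fun l _ => ?_
  have leading := coeff_vev_nested_succ hpsi y (k := 2 * j + 1) ⟨j, rfl⟩ (2 * j + 1) l
  push_cast at leading
  rw [← constH_inv_factorial, coeff_constH_mul, leading, ← hF, coeff_derivative,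
    Nat.factorial_succ]
  have := Nat.cast_ne_zero (R := ℂ).2 l.factorial_ne_zero
  have := Nat.cast_add_one_ne_zero (R := ℂ) l
  push_cast
  field_simp

end OnePointLeading

section TwoPointLeading

open PowerSeries

lemma coeffInt_oddTrunc_pow_mul_coeff_eq_zero {f g : PowerSeries ℂ}
    (hf : ∀ n, Odd n → coeff n f = 0) {N k l : ℕ} {m : ℤ} (hm : Odd m) :
    coeff l (expSeries (2 * f) ^ k) * coeffInt m (oddTrunc g N ^ l) = 0 := by
  rcases Nat.even_or_odd l with hl | hl
  · unfold coeffInt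
    split_ifs
    · rw [coeff_eq_zero_of_rescale_neg_one (f := oddTrunc g N ^ l) (p := l) _
        (hl.add_odd (Int.natAbs_odd.2 hm)), mul_zero]
      rw [map_pow, rescale_neg_one_oddTrunc, neg_pow]
    · rw [mul_zero]
  · rw [coeff_eq_zero_of_rescale_neg_one (f := expSeries (2 * f) ^ k) (p := 0) _
      (by simpa only [zero_add] using hl), zero_mul]
    rw [rescale_neg_one_expSeries_two_mul_pow hf, pow_zero, one_mul]

lemma coeff_vev_nested_mul_nested {psi : ℕ → PowerSeries ℂ}
    (hpsi : ∀ d n, Odd n → coeff n (psi d) = 0) (y : ℕ → PowerSeries ℂ) {k k' : ℕ} (hk : Odd k)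
    (hk' : Odd k') (N p q : ℕ) :
    (vev HSeries (nested (bosonMinus (sTimeRescaled y) N) (dressedBoson (weight psi) k) p *
        nested (bosonMinus (sTimeRescaled y) N) (dressedBoson (weight psi) k') q) -
      vev HSeries (nested (bosonMinus (sTimeRescaled y) N) (dressedBoson (weight psi) k) p) *
        vev HSeries (nested (bosonMinus (sTimeRescaled y) N)
          (dressedBoson (weight psi) k') q)).coeff 0 =
      (p ! * q ! : ℂ) * ∑ n ∈ Finset.range (k + 1), (n / 2 : ℂ) *
        ((coeff p (expSeries (2 * psi 0) ^ k) * coeff (k - n) (oddTrunc (y 0) N ^ p)) *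
          (coeff q (expSeries (2 * psi 0) ^ k') * coeff (k' + n) (oddTrunc (y 0) N ^ q))) := by
  have leading := (isQuad_nested_dressedBoson psi y hk N p).coeff_vev_mul
    (isQuad_nested_dressedBoson psi y hk' N q) (hasLeadingEntries_nested hpsi y k N p)
    (hasLeadingEntries_nested hpsi y k' N q)
    (fun n hn => by
      rw [coeffInt_oddTrunc_pow_mul_coeff_eq_zero (hpsi 0), mul_zero, zero_mul]
      exact Odd.sub_even (by exact_mod_cast hk) (by exact_mod_cast hn))
    (N := k + 1 + 2 * N * q) (fun i j hi => nested_shiftMinus_apply_eq_zero _ _ _ _ _ _ _ (by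
      have : (k + 1 + 2 * N * q : ℤ) ≤ i := by exact_mod_cast hi
      omega))
  rw [add_zero] at leading
  rw [leading, ← Finset.sum_subset (Finset.range_subset_range.2 ((k + 1).le_add_right _)),
    Finset.mul_sum]
  · refine Finset.sum_congr rfl fun n hn => ?_
    have hn := Finset.mem_range_succ_iff.1 hn
    rw [← Nat.cast_sub hn, sub_neg_eq_add, ← Nat.cast_add, coeffInt_natCast, coeffInt_natCast]
    ring
  · intro n _ hn
    rw [Finset.mem_range, not_lt] at hn
    rw [coeffInt_of_neg (by omega), mul_zero, mul_zero, zero_mul, mul_zero]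

lemma sum_range_antidiagonal {R : Type*} [AddCommMonoid R] (F : ℕ → ℕ → R) {M : ℕ}
    (hleft : ∀ p q, M ≤ p → F p q = 0) (hright : ∀ p q, M ≤ q → F p q = 0) :
    ∑ l ∈ Finset.range (2 * M), ∑ x ∈ Finset.HasAntidiagonal.antidiagonal l, F x.1 x.2 =
      ∑ p ∈ Finset.range M, ∑ q ∈ Finset.range M, F p q := by
  rw [← Finset.sum_product' (Finset.range M) (Finset.range M) F,
    ← Finset.sum_fiberwise_of_maps_to (t := Finset.range (2 * M))
      (g := fun x : ℕ × ℕ => x.1 + x.2)]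
  · refine Finset.sum_congr rfl fun l _ =>
      Finset.sum_congr_of_eq_on_inter ?_ ?_ fun _ _ _ => rfl
    · rintro ⟨p, q⟩ hx hx'
      have hx := Finset.HasAntidiagonal.mem_antidiagonal.1 hx
      simp only [Finset.mem_filter, Finset.mem_product, Finset.mem_range, not_and_or, not_lt] at hx'
      rcases hx' with (h | h) | h
      · exact hleft _ _ h
      · exact hright _ _ h
      · exact absurd hx h
    · rintro ⟨p, q⟩ hx hx'
      exact absurd (Finset.HasAntidiagonal.mem_antidiagonal.2 (Finset.mem_filter.1 hx).2) hx'
  · rintro ⟨p, q⟩ hx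
    simp only [Finset.mem_product, Finset.mem_range] at hx ⊢
    omega

lemma sum_range_antidiagonal_mul {R : Type*} [NonUnitalNonAssocSemiring R] (g h : ℕ → R) {M : ℕ}
    (hg : ∀ p, M ≤ p → g p = 0) (hh : ∀ p, M ≤ p → h p = 0) :
    ∑ l ∈ Finset.range (2 * M), ∑ x ∈ Finset.HasAntidiagonal.antidiagonal l, g x.1 * h x.2 =
      (∑ p ∈ Finset.range M, g p) * ∑ q ∈ Finset.range M, h q := by
  rw [sum_range_antidiagonal (fun p q => g p * h q) (fun p q hp => by rw [hg p hp, zero_mul])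
    (fun p q hq => by rw [hh q hq, mul_zero]), Finset.sum_mul_sum]

lemma vev_nested_eq_zero {K : Type*} [Field K] [CharZero K] {w : ℕ → K} (hw : ∀ k, w k ≠ 0)
    (s : ℕ → K) (j : ℕ) {N l : ℕ} (hN : 2 * j + 1 ≤ N) (hl : 2 * j + 1 < l) :
    vev K (nested (bosonMinus s N) (dressedBoson w (2 * j + 1)) l) = 0 := by
  have sum_range_eq := derivAtZero_tauAt_singleton hw s j hN hl
  have sum_range_succ_eq := derivAtZero_tauAt_singleton hw s j hN (hl.trans (Nat.lt_succ_self l))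
  rw [Finset.sum_range_succ, ← sum_range_eq, left_eq_add] at sum_range_succ_eq
  exact (mul_eq_zero.1 sum_range_succ_eq).resolve_left
    (inv_ne_zero (Nat.cast_ne_zero.2 l.factorial_ne_zero))

lemma derivAtZero_tauAt_pair_sub_mul {K : Type*} [Field K] [CharZero K] {w : ℕ → K}
    (hw : ∀ k, w k ≠ 0) (s : ℕ → K) (i j : ℕ) {N : ℕ} (hN : 2 * i + 1 + (2 * j + 1) ≤ N) :
    derivAtZero (tauAt w s) [i, j] - derivAtZero (tauAt w s) [i] * derivAtZero (tauAt w s) [j] =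
      ∑ l ∈ Finset.range (2 * (N + 1)), ∑ p ∈ Finset.HasAntidiagonal.antidiagonal l,
        ((p.1 ! : K)⁻¹ * (p.2 ! : K)⁻¹) *
          (vev K (nested (bosonMinus s N) (dressedBoson w (2 * i + 1)) p.1 *
              nested (bosonMinus s N) (dressedBoson w (2 * j + 1)) p.2) -
            vev K (nested (bosonMinus s N) (dressedBoson w (2 * i + 1)) p.1) *
              vev K (nested (bosonMinus s N) (dressedBoson w (2 * j + 1)) p.2)) := by
  rw [derivAtZero_tauAt_pair hw s i j hN (Λ := 2 * (N + 1)) (by omega),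
    derivAtZero_tauAt_singleton hw s i (N := N) (Λ := N + 1) (by omega) (by omega),
    derivAtZero_tauAt_singleton hw s j (N := N) (Λ := N + 1) (by omega) (by omega),
    ← sum_range_antidiagonal_mul]
  · simp only [← Finset.sum_sub_distrib, mul_sub, mul_mul_mul_comm]
  · intro p hp
    rw [vev_nested_eq_zero hw s i (by omega) (by omega), mul_zero]
  · intro p hp
    rw [vev_nested_eq_zero hw s j (by omega) (by omega), mul_zero]

lemma coeff_derivAtZero_pair {psi y : ℕ → PowerSeries ℂ}
    (hpsi : ∀ d n, Odd n → coeff n (psi d) = 0) (hy : ∀ n, Even n → coeff n (y 0) = 0)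
    (i j : ℕ) :
    (derivAtZero (tauAt (weight psi) (sTimeRescaled y)) [i, j] -
      derivAtZero (tauAt (weight psi) (sTimeRescaled y)) [i] *
        derivAtZero (tauAt (weight psi) (sTimeRescaled y)) [j]).coeff 0 =
      ∑ n ∈ Finset.range (2 * i + 1 + 1), (n / 2 : ℂ) *
        (coeff (2 * i + 1 - n) ((expSeries (2 * psi 0) ^ (2 * i + 1)).subst (y 0)) *
          coeff (2 * j + 1 + n) ((expSeries (2 * psi 0) ^ (2 * j + 1)).subst (y 0))) := by
  set N := 2 * i + 1 + (2 * j + 1) with hN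
  have leading (p q : ℕ) := coeff_vev_nested_mul_nested hpsi y (k := 2 * i + 1) (k' := 2 * j + 1)
    ⟨i, rfl⟩ ⟨j, rfl⟩ N p q
  simp only [Nat.cast_add, Nat.cast_mul, Nat.cast_ofNat, Nat.cast_one] at leading
  have factorials_cancel (p q : ℕ) (x : ℂ) : (p ! : ℂ)⁻¹ * (q ! : ℂ)⁻¹ * (p ! * q ! * x) = x := by
    have := Nat.cast_ne_zero (R := ℂ).2 p.factorial_ne_zero
    have := Nat.cast_ne_zero (R := ℂ).2 q.factorial_ne_zero
    field_simp
  rw [derivAtZero_tauAt_pair_sub_mul (weight_ne_zero psi) (sTimeRescaled y) i j hN.ge]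
  simp only [HahnSeries.coeff_sum, ← constH_inv_factorial, ← map_mul, coeff_constH_mul, leading,
    factorials_cancel, Finset.sum_comm (s := Finset.HasAntidiagonal.antidiagonal _)]
  rw [Finset.sum_comm]
  refine Finset.sum_congr rfl fun n hn => ?_
  have hn := Finset.mem_range_succ_iff.1 hn
  simp only [← Finset.mul_sum]
  rw [sum_range_antidiagonal_mul
      (fun p => coeff p (expSeries (2 * psi 0) ^ (2 * i + 1)) *
        coeff (2 * i + 1 - n) (oddTrunc (y 0) N ^ p))
      (fun q => coeff q (expSeries (2 * psi 0) ^ (2 * j + 1)) *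
        coeff (2 * j + 1 + n) (oddTrunc (y 0) N ^ q)) (M := N + 1),
    coeff_subst_eq_sum_oddTrunc hy _ (N := N) (M := N + 1) (by omega) (by omega),
    coeff_subst_eq_sum_oddTrunc hy _ (N := N) (M := N + 1) (by omega) (by omega)]
  · intro p hp
    rw [coeff_pow_eq_zero_of_lt (constantCoeff_oddTrunc _ _) (by omega), mul_zero]
  · intro p hp
    rw [coeff_pow_eq_zero_of_lt (constantCoeff_oddTrunc _ _) (by omega), mul_zero]

end TwoPointLeading

section Correlators

open PowerSeries

lemma univ_finpartition_fin_one :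
    (Finset.univ : Finset (Finpartition (Finset.univ : Finset (Fin 1)))) = {⊥} := by decide

lemma univ_finpartition_fin_two :
    (Finset.univ : Finset (Finpartition (Finset.univ : Finset (Fin 2)))) =
      {⊥, Finpartition.indiscrete (by decide)} := by decide

lemma parts_bot_fin_one : (⊥ : Finpartition (Finset.univ : Finset (Fin 1))).parts = {{0}} := by
  decide

lemma parts_bot_fin_two :
    (⊥ : Finpartition (Finset.univ : Finset (Fin 2))).parts = {{0}, {1}} := by
  decide

lemma filter_finRange_mem_singleton {n : ℕ} (i : Fin n) :
    (List.finRange n).filter (· ∈ ({i} : Finset (Fin n))) = [i] := by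
  simpa [List.count_eq_one_of_mem (List.nodup_finRange n) (List.mem_finRange i), eq_comm]
    using List.filter_eq (l := List.finRange n) i

variable (psi y : ℕ → PowerSeries ℂ)

lemma HdiscCoeff_singleton {n : ℕ} (i : Fin n) (m : Fin n →₀ ℕ) :
    HdiscCoeff psi y {i} m = if Odd (m i) then
      derivAtZero (tauAt (weight psi) (sTimeRescaled y)) [m i / 2] / (m i : HSeries) else 0 := by
  rw [HdiscCoeff, filter_finRange_mem_singleton]
  simp

lemma HdiscCoeff_univ_two (m : Fin 2 →₀ ℕ) :
    HdiscCoeff psi y Finset.univ m = if Odd (m 0) ∧ Odd (m 1) then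
      derivAtZero (tauAt (weight psi) (sTimeRescaled y)) [m 0 / 2, m 1 / 2] /
        ((m 0 : HSeries) * (m 1 : HSeries)) else 0 := by
  rw [HdiscCoeff, show (List.finRange 2).filter (· ∈ (Finset.univ : Finset (Fin 2))) = [0, 1] by
    decide]
  simp [Fin.forall_fin_two]

lemma coeff_Wconn {n : ℕ} (m : Fin n →₀ ℕ) :
    MvPowerSeries.coeff m (Wconn psi y n) = (∏ i, (m i : HSeries)) *
      ∑ P : Finpartition (Finset.univ : Finset (Fin n)),
        (-1) ^ (P.parts.card - 1) * ((P.parts.card - 1)! : HSeries) *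
          ∏ B ∈ P.parts, HdiscCoeff psi y B m := rfl

lemma coeff_W (g : ℕ) {n : ℕ} (m : Fin n →₀ ℕ) :
    MvPowerSeries.coeff m (W psi y g n) =
      (MvPowerSeries.coeff m (Wconn psi y n)).coeff (2 * (g : ℤ) - 2 + n) := rfl

lemma coeff_Wconn_one (m : Fin 1 →₀ ℕ) :
    MvPowerSeries.coeff m (Wconn psi y 1) = if Odd (m 0) then
      derivAtZero (tauAt (weight psi) (sTimeRescaled y)) [m 0 / 2] else 0 := by
  rw [coeff_Wconn, univ_finpartition_fin_one, Finset.sum_singleton, parts_bot_fin_one,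
    Finset.prod_singleton, HdiscCoeff_singleton]
  split_ifs with odd_m
  · have cast_ne_zero : (m 0 : HSeries) ≠ 0 := Nat.cast_ne_zero.2 odd_m.pos.ne'
    simp [mul_div_cancel₀ _ cast_ne_zero]
  · simp

lemma coeff_Wconn_two (m : Fin 2 →₀ ℕ) :
    MvPowerSeries.coeff m (Wconn psi y 2) = if Odd (m 0) ∧ Odd (m 1) then
      derivAtZero (tauAt (weight psi) (sTimeRescaled y)) [m 0 / 2, m 1 / 2] -
      derivAtZero (tauAt (weight psi) (sTimeRescaled y)) [m 0 / 2] *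
        derivAtZero (tauAt (weight psi) (sTimeRescaled y)) [m 1 / 2] else 0 := by
  rw [coeff_Wconn, univ_finpartition_fin_two, Finset.sum_pair (by decide), parts_bot_fin_two,
    Finset.prod_pair (by decide), HdiscCoeff_singleton, HdiscCoeff_singleton,
    Finpartition.indiscrete_parts, Finset.prod_singleton, HdiscCoeff_univ_two, Fin.prod_univ_two,
    Finset.card_pair (by decide), Finset.card_singleton]
  by_cases odd_m : Odd (m 0) ∧ Odd (m 1)
  · have cast_zero_ne : (m 0 : HSeries) ≠ 0 := Nat.cast_ne_zero.2 odd_m.1.pos.ne'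
    have cast_one_ne : (m 1 : HSeries) ≠ 0 := Nat.cast_ne_zero.2 odd_m.2.pos.ne'
    rw [if_pos odd_m, if_pos odd_m, if_pos odd_m.1, if_pos odd_m.2]
    field_simp
    simp only [Nat.add_one_sub_one, pow_one, Nat.sub_self, pow_zero, Nat.factorial_one,
      Nat.factorial_zero, Nat.cast_one, mul_one, one_mul]
    ring
  · rw [if_neg odd_m, if_neg odd_m]
    rcases not_and_or.1 odd_m with h | h <;> simp [h]

variable {psi y}

lemma coeff_W_one_of_derivative_eq (hpsi : ∀ d n, Odd n → coeff n (psi d) = 0)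
    (hy : ∀ n, Even n → coeff n (y 0) = 0) (m : Fin 1 →₀ ℕ) {F : PowerSeries ℂ}
    (hF : derivative ℂ F = expSeries (2 * psi 0) ^ m 0) (hF0 : constantCoeff F = 0) :
    MvPowerSeries.coeff m (W psi y 0 1) =
      if Odd (m 0) then 1 / 2 * coeff (m 0) (F.subst (y 0)) else 0 := by
  rw [coeff_W, coeff_Wconn_one]
  split_ifs with odd_m
  · obtain ⟨j, hj⟩ := odd_m
    rw [hj] at hF
    rw [show m 0 / 2 = j by omega, hj, ← coeff_derivAtZero_singleton hpsi hy j hF hF0]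
    norm_num
  · rfl

lemma coeff_W_two (hpsi : ∀ d n, Odd n → coeff n (psi d) = 0)
    (hy : ∀ n, Even n → coeff n (y 0) = 0) (m : Fin 2 →₀ ℕ) :
    MvPowerSeries.coeff m (W psi y 0 2) = if Odd (m 0) ∧ Odd (m 1) then
      ∑ n ∈ Finset.range (m 0 + 1), (n / 2 : ℂ) *
        (coeff (m 0 - n) ((expSeries (2 * psi 0) ^ m 0).subst (y 0)) *
          coeff (m 1 + n) ((expSeries (2 * psi 0) ^ m 1).subst (y 0))) else 0 := by
  rw [coeff_W, coeff_Wconn_two]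
  split_ifs with odd_m
  · obtain ⟨⟨i, hi⟩, j, hj⟩ := odd_m
    rw [show m 0 / 2 = i by omega, show m 1 / 2 = j by omega, hi, hj,
      ← coeff_derivAtZero_pair hpsi hy i j]
    norm_num
  · rfl

end Correlators

section Lagrange

open PowerSeries

variable {R : Type*} [CommRing R]

lemma coeff_X_mul_derivative (f : PowerSeries R) (p : ℕ) :
    coeff p (X * derivative R f) = p * coeff p f := by
  rcases p with _ | p
  · simp
  · rw [coeff_succ_X_mul, coeff_derivative, Nat.cast_add_one, mul_comm]

lemma coeff_natCast_mul (k p : ℕ) (f : PowerSeries R) :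
    coeff p ((k : PowerSeries R) * f) = (k : R) * coeff p f := by
  rw [← map_natCast (C (R := R)), coeff_C_mul]

lemma derivative_pow_mul (f : PowerSeries R) (p : ℕ) :
    derivative R (f ^ p) * f = (p : PowerSeries R) * (f ^ p * derivative R f) := by
  rcases p with _ | p
  · simp
  · rw [Derivation.leibniz_pow]
    simp only [Nat.add_sub_cancel, smul_eq_mul, nsmul_eq_mul]
    ring

/-- The logarithmic derivative `z X' / X` of the coordinate `X = z u`, written without division
in terms of the inverse `v` of `u`. -/
def lagrangeQ (u v : PowerSeries R) : PowerSeries R := 1 - X * derivative R v * u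

lemma constantCoeff_lagrangeQ (u v : PowerSeries R) : constantCoeff (lagrangeQ u v) = 1 := by
  simp [lagrangeQ]

variable {u v : PowerSeries R}

lemma X_mul_derivative_X_mul (huv : u * v = 1) :
    X * derivative R (X * u) = lagrangeQ u v * (X * u) := by
  have derivative_mul : u * derivative R v + v * derivative R u = 0 := by
    simpa only [Derivation.leibniz, derivative_one, smul_eq_mul] using
      congrArg (derivative R) huv
  rw [Derivation.leibniz, lagrangeQ, derivative_X]
  simp only [smul_eq_mul]
  linear_combination X * X * u * derivative_mul - X * X * derivative R u * huv

lemma X_mul_derivative_X_mul_pow (huv : u * v = 1) (k : ℕ) :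
    X * derivative R ((X * u) ^ k) = (k : PowerSeries R) * (lagrangeQ u v * (X * u) ^ k) := by
  rcases k with _ | k
  · simp
  · rw [Derivation.leibniz_pow]
    simp only [Nat.add_sub_cancel, smul_eq_mul, nsmul_eq_mul]
    linear_combination ((k + 1 : ℕ) : PowerSeries R) * (X * u) ^ k * X_mul_derivative_X_mul huv

lemma natCast_mul_lagrangeQ_mul_pow (huv : u * v = 1) (p : ℕ) :
    (p : PowerSeries R) * (lagrangeQ u v * v ^ p) =
      (p : PowerSeries R) * v ^ p - X * derivative R (v ^ p) := by
  rw [lagrangeQ]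
  linear_combination (X * u) * derivative_pow_mul v p - X * derivative R (v ^ p) * huv

lemma natCast_mul_coeff_lagrangeQ_mul_mul_pow (huv : u * v = 1) (f : PowerSeries R) (k : ℕ) :
    (k : R) * coeff k (lagrangeQ u v * f * v ^ k) = coeff k (X * (derivative R f * v ^ k)) := by
  have by_parts : (k : PowerSeries R) * (lagrangeQ u v * f * v ^ k) =
      (k : PowerSeries R) * (f * v ^ k) - X * derivative R (f * v ^ k) +
        X * (derivative R f * v ^ k) := by
    rw [Derivation.leibniz, smul_eq_mul, smul_eq_mul]
    linear_combination f * natCast_mul_lagrangeQ_mul_pow huv k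
  rw [← coeff_natCast_mul, by_parts, map_add, map_sub, coeff_X_mul_derivative, coeff_natCast_mul,
    sub_self, zero_add]

lemma X_pow_dvd_of_coeff_lagrangeQ_mul_mul_pow_eq_zero (huv : u * v = 1) {f : PowerSeries R}
    {M : ℕ} (hf : ∀ p < M, coeff p (lagrangeQ u v * f * v ^ p) = 0) : X ^ M ∣ f := by
  induction M with
  | zero => simp
  | succ p ih =>
    obtain ⟨h, rfl⟩ := ih fun q hq => hf q (hq.trans p.lt_succ_self)
    have constantCoeff_v_isUnit : IsUnit (constantCoeff v) :=
      (IsUnit.of_mul_eq_one_right _ huv).map constantCoeff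
    have constantCoeff_mul_eq_zero : constantCoeff h * constantCoeff v ^ p = 0 := by
      have := hf p p.lt_succ_self
      rw [show lagrangeQ u v * (X ^ p * h) * v ^ p = X ^ p * (lagrangeQ u v * h * v ^ p) by ring,
        coeff_X_pow_mul', if_pos le_rfl, Nat.sub_self, coeff_zero_eq_constantCoeff_apply,
        map_mul, map_mul, constantCoeff_lagrangeQ, one_mul, map_pow] at this
      exact this
    rw [pow_succ]
    exact mul_dvd_mul_left _
      (X_dvd_iff.2 ((constantCoeff_v_isUnit.pow p).mul_left_eq_zero.1 constantCoeff_mul_eq_zero))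

variable [IsDomain R] [CharZero R]

lemma coeff_lagrangeQ_mul_pow (huv : u * v = 1) (p : ℕ) :
    coeff p (lagrangeQ u v * v ^ p) = if p = 0 then 1 else 0 := by
  split_ifs with hp
  · subst hp
    simp [constantCoeff_lagrangeQ]
  · have mul_coeff_eq_zero := natCast_mul_coeff_lagrangeQ_mul_mul_pow huv 1 p
    rw [mul_one, derivative_one, zero_mul, mul_zero, map_zero] at mul_coeff_eq_zero
    exact (mul_eq_zero.1 mul_coeff_eq_zero).resolve_left (Nat.cast_ne_zero.2 hp)

lemma coeff_lagrangeQ_mul_X_mul_pow_mul_pow (huv : u * v = 1) (p k : ℕ) :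
    coeff p (lagrangeQ u v * (X * u) ^ k * v ^ p) = if p = k then 1 else 0 := by
  rw [show lagrangeQ u v * (X * u) ^ k * v ^ p = X ^ k * (lagrangeQ u v * u ^ k * v ^ p) by ring,
    coeff_X_pow_mul']
  split_ifs with hkp hpk hpk
  · subst hpk
    rw [mul_assoc, ← mul_pow, huv, one_pow, mul_one, Nat.sub_self,
      coeff_zero_eq_constantCoeff_apply, constantCoeff_lagrangeQ]
  · obtain ⟨q, rfl⟩ := Nat.exists_eq_add_of_le hkp
    rw [pow_add, mul_assoc, ← mul_assoc (u ^ k), ← mul_pow, huv, one_pow, one_mul,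
      Nat.add_sub_cancel_left, coeff_lagrangeQ_mul_pow huv, if_neg (by omega)]
  · omega
  · rfl

theorem lagrange_inversion (huv : u * v = 1) (f : PowerSeries R) {i M : ℕ} (hi : i < M) :
    ∑ k ∈ Finset.range M, coeff i ((X * u) ^ k) * coeff k (lagrangeQ u v * f * v ^ k) =
      coeff i f := by
  set expansion := ∑ k ∈ Finset.range M, C (coeff k (lagrangeQ u v * f * v ^ k)) * (X * u) ^ k
    with expansion_eq
  have coeff_remainder (p : ℕ) (hp : p < M) :
      coeff p (lagrangeQ u v * (f - expansion) * v ^ p) = 0 := by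
    have coeff_expansion : coeff p (lagrangeQ u v * expansion * v ^ p) =
        coeff p (lagrangeQ u v * f * v ^ p) := by
      simp only [expansion_eq, Finset.mul_sum, Finset.sum_mul, mul_left_comm _ (C _), mul_assoc,
        map_sum, coeff_C_mul]
      simp only [← mul_assoc, coeff_lagrangeQ_mul_X_mul_pow_mul_pow huv]
      simp [hp]
    rw [mul_sub, sub_mul, map_sub, coeff_expansion, sub_self]
  have coeff_eq := X_pow_dvd_iff.1
    (X_pow_dvd_of_coeff_lagrangeQ_mul_mul_pow_eq_zero huv coeff_remainder) i hi
  rw [map_sub, sub_eq_zero, expansion_eq, map_sum] at coeff_eq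
  rw [coeff_eq]
  exact Finset.sum_congr rfl fun k _ => by rw [coeff_C_mul, mul_comm]

end Lagrange

section OddSeries

open PowerSeries

variable (R : Type*) [CommRing R]

/-- The series `∑ n t ^ n` over odd `n`, the expansion of `t (1 + t²) / (1 - t²)²`. It generates
the two-point kernel: with `t = z / w` the closed form is `B(z, w) / 2`. -/
def oddSeries : PowerSeries R := PowerSeries.mk fun n => if Odd n then (n : R) else 0

lemma coeff_oddSeries (n : ℕ) : coeff n (oddSeries R) = if Odd n then (n : R) else 0 :=
  coeff_mk _ _

variable {R} in
lemma map_coeff_oddSeries {S : Type*} [CommRing S] (ι : R →+* S) (n : ℕ) :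
    ι (coeff n (oddSeries R)) = coeff n (oddSeries S) := by
  rw [coeff_oddSeries, coeff_oddSeries, apply_ite ι, map_natCast, map_zero]

lemma one_sub_X_sq_sq_mul_oddSeries : (1 - X ^ 2) ^ 2 * oddSeries R = X * (1 + X ^ 2) := by
  rw [show (1 - X ^ 2) ^ 2 * oddSeries R =
      oddSeries R - X ^ 2 * (oddSeries R + oddSeries R) + X ^ 4 * oddSeries R by ring,
    show (X * (1 + X ^ 2) : PowerSeries R) = X ^ 1 + X ^ 3 by ring]
  ext n
  simp only [map_add, map_sub, coeff_X_pow_mul', coeff_oddSeries, coeff_X_pow]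
  rcases n with _ | _ | _ | _ | n
  · simp
  · simp
  · simp [parity_simps]
  · norm_num [show Odd 3 by decide]
  · rw [show n + 1 + 1 + 1 + 1 - 2 = n + 2 by omega, show n + 1 + 1 + 1 + 1 - 4 = n by omega]
    simp only [← Nat.not_even_iff_odd, parity_simps, if_pos (show 2 ≤ n + 1 + 1 + 1 + 1 by omega),
      if_pos (show 4 ≤ n + 1 + 1 + 1 + 1 by omega)]
    by_cases hn : Even n
    · simp [hn]
    · simp [hn]; ring

variable {R}

lemma one_sub_sq_sq_mul_oddSeries_subst {t : PowerSeries R} (ht : constantCoeff t = 0) :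
    (1 - t ^ 2) ^ 2 * (oddSeries R).subst t = t * (1 + t ^ 2) := by
  have substituted := congrArg (substAlgHom (R := R) (HasSubst.of_constantCoeff_zero' ht))
    (one_sub_X_sq_sq_mul_oddSeries R)
  simpa only [map_mul, map_sub, map_add, map_one, map_pow, substAlgHom_X, coe_substAlgHom]
    using substituted

lemma sq_sub_sq_sq_mul_oddSeries_subst {L : Type*} [Field L] {c : L} (hc : c ≠ 0)
    {f : PowerSeries L} (hf : constantCoeff f = 0) :
    (C c ^ 2 - f ^ 2) ^ 2 * (oddSeries L).subst (C c⁻¹ * f) = f * C c * (C c ^ 2 + f ^ 2) := by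
  have eq_C_mul : f = C c * (C c⁻¹ * f) := by
    rw [← mul_assoc, ← map_mul, mul_inv_cancel₀ hc, map_one, one_mul]
  have ratio_identity := one_sub_sq_sq_mul_oddSeries_subst (t := C c⁻¹ * f) (by simp [hf])
  generalize (oddSeries L).subst (C c⁻¹ * f) = G at ratio_identity ⊢
  generalize C c⁻¹ * f = t at eq_C_mul ratio_identity
  rw [eq_C_mul]
  linear_combination C c ^ 4 * ratio_identity

lemma coeff_subst_mul_eq_sum (f : PowerSeries R) {g : PowerSeries R}
    (hg : constantCoeff g = 0) (h : PowerSeries R) {N M : ℕ} (hNM : N < M) :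
    coeff N (f.subst g * h) = ∑ n ∈ Finset.range M, coeff n f * coeff N (g ^ n * h) := by
  have dvd_sub : X ^ M ∣ f.subst g - ∑ n ∈ Finset.range M, C (coeff n f) * g ^ n := by
    rw [X_pow_dvd_iff]
    intro m hm
    rw [map_sub, coeff_subst_eq_sum f hg hm, map_sum, sub_eq_zero]
    simp only [coeff_C_mul]
  have coeff_eq := X_pow_dvd_iff.1 (dvd_sub.mul_right h) N hNM
  rw [sub_mul, map_sub, sub_eq_zero, Finset.sum_mul, map_sum] at coeff_eq
  simpa only [mul_assoc, coeff_C_mul] using coeff_eq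

lemma sum_coeff_mul_coeff_X_pow_mul (f h : PowerSeries R) (k : ℕ) :
    ∑ n ∈ Finset.range (k + 1), coeff n f * coeff k (X ^ n * h) = coeff k (f * h) := by
  rw [coeff_mul, Finset.Nat.sum_antidiagonal_eq_sum_range_succ_mk]
  refine Finset.sum_congr rfl fun n hn => ?_
  rw [coeff_X_pow_mul', if_pos (Finset.mem_range_succ_iff.1 hn)]

variable {S : Type*} [CommRing S] (ι : R →+* S)

lemma coeff_oddSeries_subst_C_mul_X_mul (c d : S) (f : PowerSeries R) (m : ℕ) :
    coeff m ((oddSeries S).subst (C c * X : PowerSeries S) * (PowerSeries.map ι f * C d)) =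
      ∑ n ∈ Finset.range (m + 1),
        ι (coeff n (oddSeries R) * coeff m (X ^ n * f)) * (c ^ n * d) := by
  rw [coeff_subst_mul_eq_sum _ (by simp) _ m.lt_succ_self]
  refine Finset.sum_congr rfl fun n _ => ?_
  rw [show (C c * X) ^ n * (PowerSeries.map ι f * C d) =
      C (c ^ n * d) * PowerSeries.map ι (X ^ n * f) by
    simp only [map_mul, map_pow, PowerSeries.map_X]; ring,
    coeff_C_mul, coeff_map, map_mul ι, map_coeff_oddSeries]
  ring

lemma coeff_oddSeries_subst_C_mul_map (c : S) {f : PowerSeries R} (hf : constantCoeff f = 0)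
    (m : ℕ) :
    coeff m ((oddSeries S).subst (C c * PowerSeries.map ι f)) =
      ∑ j ∈ Finset.range (m + 1), ι (coeff j (oddSeries R) * coeff m (f ^ j)) * c ^ j := by
  have constantCoeff_eq_zero : constantCoeff (C c * PowerSeries.map ι f) = 0 := by
    rw [← coeff_zero_eq_constantCoeff_apply] at hf ⊢
    rw [coeff_C_mul, coeff_map, hf, map_zero, mul_zero]
  rw [coeff_subst_eq_sum _ constantCoeff_eq_zero m.lt_succ_self]
  refine Finset.sum_congr rfl fun j _ => ?_
  rw [mul_pow, ← map_pow C, ← map_pow (PowerSeries.map _), coeff_C_mul, coeff_map, map_mul ι,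
    map_coeff_oddSeries]
  ring

end OddSeries

section TailExpansion

open PowerSeries

variable {k : Type*} [Field k] {u v : PowerSeries k}

lemma lagrangeQ_mul_inv (u v : PowerSeries k) : lagrangeQ u v * (lagrangeQ u v)⁻¹ = 1 :=
  PowerSeries.mul_inv_cancel _ (by rw [constantCoeff_lagrangeQ]; exact one_ne_zero)

/-- The series `∑ [z ^ (b + n)] v ^ b · X ^ b` for `X = z u`, `u v = 1`: the part of the expansion
of `z ^ (-n) / Q` in powers of `X` that has nonnegative exponents. -/
def tailSer (u v : PowerSeries k) (n : ℕ) : PowerSeries k :=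
  (PowerSeries.mk fun b => coeff (b + n) (v ^ b)).subst (X * u)

variable [CharZero k]

lemma lagrange_inversion_mul_inv (huv : u * v = 1) (f : PowerSeries k) {i M : ℕ} (hi : i < M) :
    ∑ j ∈ Finset.range M, coeff i ((X * u) ^ j) * coeff j (f * v ^ j) =
      coeff i (f * (lagrangeQ u v)⁻¹) := by
  rw [← lagrange_inversion huv _ hi]
  refine Finset.sum_congr rfl fun j _ => ?_
  congr 2
  linear_combination -(f * v ^ j) * lagrangeQ_mul_inv u v

lemma sum_C_coeff_mul_pow_add_tailSer_mul_pow (huv : u * v = 1) (n : ℕ) :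
    ∑ j ∈ Finset.range n, C (coeff n ((X * u) ^ (n - j))) * (X * u) ^ j +
      tailSer u v n * (X * u) ^ n = u ^ n * (lagrangeQ u v)⁻¹ := by
  ext i
  rw [← lagrange_inversion_mul_inv huv _ (show i < n + (i + 1) by omega), Finset.sum_range_add,
    map_add, map_sum, tailSer, coeff_subst_mul_eq_sum _ (by simp) _ i.lt_succ_self]
  congr 1
  · refine Finset.sum_congr rfl fun j hj => ?_
    obtain ⟨q, rfl⟩ := Nat.exists_eq_add_of_le (Finset.mem_range.1 hj).le
    rw [coeff_C_mul, pow_add u, mul_right_comm, ← mul_pow, huv, one_pow, one_mul,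
      Nat.add_sub_cancel_left, mul_pow X u q, coeff_X_pow_mul', if_pos (by omega),
      Nat.add_sub_cancel, mul_comm]
  · refine Finset.sum_congr rfl fun b _ => ?_
    rw [pow_add v, ← mul_assoc, ← mul_pow, huv, one_pow, one_mul, coeff_mk, ← pow_add, mul_comm,
      add_comm b n]

lemma coeff_X_mul_pow_eq_zero_of_odd_add (hu : ∀ n, Odd n → coeff n u = 0) {j n : ℕ}
    (h : Odd (j + n)) : coeff n ((X * u) ^ j) = 0 := by
  refine coeff_eq_zero_of_rescale_neg_one (p := j) ?_ h
  rw [map_pow, map_mul, rescale_neg_one_of_even hu, rescale_X, ← mul_pow, ← mul_assoc]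
  simp

lemma coeff_oddSeries_mul_coeff_pow (huv : u * v = 1) (hu : ∀ n, Odd n → coeff n u = 0)
    (j n : ℕ) :
    coeff n (oddSeries k) * coeff n ((X * u) ^ j) =
      coeff j (oddSeries k) * coeff n (lagrangeQ u v * (X * u) ^ j) := by
  have cast_mul_eq :
      (n : k) * coeff n ((X * u) ^ j) = j * coeff n (lagrangeQ u v * (X * u) ^ j) := by
    rw [← coeff_X_mul_derivative, X_mul_derivative_X_mul_pow huv, coeff_natCast_mul]
  rw [coeff_oddSeries, coeff_oddSeries]
  by_cases odd_add : Odd (j + n)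
  · rw [coeff_X_mul_pow_eq_zero_of_odd_add hu odd_add, mul_zero] at cast_mul_eq ⊢
    split_ifs
    · exact cast_mul_eq
    · simp
  · rw [Nat.not_odd_iff_even, Nat.even_add] at odd_add
    simp only [← Nat.not_even_iff_odd, odd_add]
    split_ifs
    · simp
    · exact cast_mul_eq

lemma sum_oddSeries_mul_coeff (huv : u * v = 1) (hu : ∀ n, Odd n → coeff n u = 0) (j m : ℕ) :
    ∑ n ∈ Finset.range (m + 1), coeff n (oddSeries k) * coeff m (X ^ n * (lagrangeQ u v)⁻¹) *
      coeff n ((X * u) ^ j) = coeff j (oddSeries k) * coeff m ((X * u) ^ j) := by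
  have eq_mul_inv : (X * u) ^ j = lagrangeQ u v * (X * u) ^ j * (lagrangeQ u v)⁻¹ := by
    rw [mul_right_comm, lagrangeQ_mul_inv, one_mul]
  conv_rhs => rw [eq_mul_inv, ← sum_coeff_mul_coeff_X_pow_mul, Finset.mul_sum]
  refine Finset.sum_congr rfl fun n _ => ?_
  rw [mul_right_comm, coeff_oddSeries_mul_coeff_pow huv hu, mul_assoc]

variable {L : Type*} [Field L] (α : PowerSeries k →+* L)

lemma map_tailSer (huv : u * v = 1) (hα : α (X * u) ≠ 0) {n M : ℕ} (hn : n ≠ 0) (hM : n < M) :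
    α (tailSer u v n) = (α X)⁻¹ ^ n * α (lagrangeQ u v)⁻¹ -
      ∑ j ∈ Finset.range M, α (C (coeff n ((X * u) ^ j))) * (α (X * u))⁻¹ ^ j := by
  have sum_flip :
      ∑ j ∈ Finset.range M, α (C (coeff n ((X * u) ^ j))) * (α (X * u))⁻¹ ^ j =
        ∑ j ∈ Finset.range n, α (C (coeff n ((X * u) ^ (n - j)))) * (α (X * u))⁻¹ ^ (n - j) := by
    rw [← Finset.sum_subset (Finset.range_subset_range.2 (Nat.succ_le_of_lt hM)),
      ← Finset.sum_flip, Finset.sum_range_succ, Nat.sub_self, pow_zero, coeff_one, if_neg hn]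
    · simp
    · intro j _ hj
      rw [coeff_pow_eq_zero_of_lt (by simp) (by simpa using hj)]
      simp
  have α_X_ne_zero : α X ≠ 0 := left_ne_zero_of_mul (map_mul α X u ▸ hα)
  have α_u_ne_zero : α u ≠ 0 := right_ne_zero_of_mul (map_mul α X u ▸ hα)
  have mapped := congrArg α (sum_C_coeff_mul_pow_add_tailSer_mul_pow huv n)
  simp only [map_add, map_sum, map_mul α _ ((X * u) ^ _), map_mul α (u ^ n), map_pow] at mapped
  rw [sum_flip, eq_sub_iff_add_eq']
  refine mul_right_cancel₀ (pow_ne_zero n hα) ?_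
  have cancel_inv : ∀ j ∈ Finset.range n,
      α (C (coeff n ((X * u) ^ (n - j)))) * (α (X * u))⁻¹ ^ (n - j) * α (X * u) ^ n =
        α (C (coeff n ((X * u) ^ (n - j)))) * α (X * u) ^ j := fun j hj => by
    rw [mul_assoc, inv_pow, pow_sub₀ _ hα (Finset.mem_range.1 hj).le]
    field_simp
  rw [add_mul, Finset.sum_mul, Finset.sum_congr rfl cancel_inv, mapped, map_mul α X u, mul_pow,
    inv_pow]
  field_simp

lemma sum_map_mul_map_tailSer (huv : u * v = 1) (hu : ∀ n, Odd n → coeff n u = 0)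
    (hα : α (X * u) ≠ 0) (m : ℕ) :
    ∑ n ∈ Finset.range (m + 1),
        α (C (coeff n (oddSeries k) * coeff m (X ^ n * (lagrangeQ u v)⁻¹))) *
          α (tailSer u v n) =
      coeff m ((oddSeries L).subst (C (α X)⁻¹ * X : PowerSeries L) *
          (PowerSeries.map (α.comp C) (lagrangeQ u v)⁻¹ * C (α (lagrangeQ u v)⁻¹)) -
        (oddSeries L).subst (C (α (X * u))⁻¹ * PowerSeries.map (α.comp C) (X * u))) := by
  rw [map_sub, coeff_oddSeries_subst_C_mul_X_mul,
    coeff_oddSeries_subst_C_mul_map _ _ (by simp)]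
  simp only [← sum_oddSeries_mul_coeff huv hu, map_sum, Finset.sum_mul]
  rw [Finset.sum_comm, ← Finset.sum_sub_distrib]
  refine Finset.sum_congr rfl fun n hn => ?_
  by_cases odd_n : Odd n
  · rw [map_tailSer α huv hα odd_n.pos.ne' (Finset.mem_range.1 hn), mul_sub, Finset.mul_sum]
    simp only [RingHom.comp_apply, map_mul, mul_assoc]
  · rw [coeff_oddSeries, if_neg odd_n]
    simp

end TailExpansion

section SubstVariables

open PowerSeries

variable {R : Type*} [CommRing R] {n : ℕ}

lemma coeff_subst_X (f : PowerSeries R) (i : Fin n) (e : Fin n →₀ ℕ) :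
    MvPowerSeries.coeff e (f.subst (MvPowerSeries.X i : MvPowerSeries (Fin n) R)) =
      if e = Finsupp.single i (e i) then coeff (e i) f else 0 := by
  rw [coeff_subst (HasSubst.X i), finsum_eq_single _ (e i)]
  · rw [MvPowerSeries.coeff_X_pow, smul_eq_mul, mul_ite, mul_one, mul_zero]
  · intro d hd
    rw [MvPowerSeries.coeff_X_pow, if_neg, smul_zero]
    rintro rfl
    simp at hd

lemma constantCoeff_subst_X {f : PowerSeries R} (hf : constantCoeff f = 0) (i : Fin n) :
    MvPowerSeries.constantCoeff (f.subst (MvPowerSeries.X i : MvPowerSeries (Fin n) R)) = 0 := by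
  rw [← MvPowerSeries.coeff_zero_eq_constantCoeff_apply, coeff_subst_X]
  simpa using hf

lemma subst_X_injective (i : Fin n) : Function.Injective fun f : PowerSeries R =>
    f.subst (MvPowerSeries.X i : MvPowerSeries (Fin n) R) := by
  intro f g h
  ext m
  simpa [coeff_subst_X] using congrArg (MvPowerSeries.coeff (Finsupp.single i m)) h

lemma coeff_fin_one (f : PowerSeries R) (e : Fin 1 →₀ ℕ) :
    MvPowerSeries.coeff e (f.subst (MvPowerSeries.X 0 : MvPowerSeries (Fin 1) R)) =
      coeff (e 0) f := by
  rw [coeff_subst_X, if_pos (Finsupp.unique_ext (by simp))]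

lemma finSuccEquiv_subst_X_zero (f : PowerSeries R) :
    MvPowerSeries.finSuccEquiv R n (f.subst (MvPowerSeries.X 0 : MvPowerSeries (Fin (n + 1)) R)) =
      PowerSeries.map MvPowerSeries.C f := by
  ext m x
  rw [MvPowerSeries.coeff_coeff_finSuccEquiv, coeff_subst_X, coeff_map, MvPowerSeries.coeff_C,
    Finsupp.cons_zero]
  exact if_congr (Finsupp.cons_eq_single_zero_iff.trans (by simp)) rfl rfl

lemma finSuccEquiv_subst_X_succ (f : PowerSeries R) (i : Fin n) :
    MvPowerSeries.finSuccEquiv R n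
        (f.subst (MvPowerSeries.X i.succ : MvPowerSeries (Fin (n + 1)) R)) =
      PowerSeries.C (f.subst (MvPowerSeries.X i : MvPowerSeries (Fin n) R)) := by
  ext m x
  rw [MvPowerSeries.coeff_coeff_finSuccEquiv, coeff_subst_X, coeff_C]
  simp only [Finsupp.cons_succ, Finsupp.cons_eq_single_succ_iff]
  by_cases hm : m = 0
  · rw [if_pos hm, coeff_subst_X]
    simp only [hm, and_true]
  · rw [if_neg hm, if_neg fun h => hm h.2, map_zero]

lemma coeff_prod_subst_X (h : Fin n → PowerSeries R) (e : Fin n →₀ ℕ) :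
    MvPowerSeries.coeff e
        (∏ i, (h i).subst (MvPowerSeries.X i : MvPowerSeries (Fin n) R)) =
      ∏ i, coeff (e i) (h i) := by
  rw [MvPowerSeries.coeff_prod,
    Finset.sum_eq_single (Finsupp.equivFunOnFinite.symm fun i => Finsupp.single i (e i))]
  · refine Finset.prod_congr rfl fun i _ => ?_
    simp [coeff_subst_X]
  · intro l hl l_ne
    rw [Finset.mem_finsuppAntidiag] at hl
    by_contra prod_ne_zero
    have l_eq_single : ∀ i, l i = Finsupp.single i (l i i) := fun i => by
      have factor_ne_zero := mt (Finset.prod_eq_zero (Finset.mem_univ i)) prod_ne_zero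
      rw [coeff_subst_X] at factor_ne_zero
      exact (ite_ne_right_iff.1 factor_ne_zero).1
    refine l_ne (Finsupp.ext fun i => ?_)
    rw [Finsupp.equivFunOnFinite_symm_apply_apply, l_eq_single, ← hl.1, Finsupp.finsetSum_apply,
      Finset.sum_eq_single i]
    · intro j _ hj
      rw [l_eq_single, Finsupp.single_eq_of_ne hj.symm]
    · simp
  · intro h_not_mem
    refine absurd ?_ h_not_mem
    rw [Finset.mem_finsuppAntidiag]
    exact ⟨Finsupp.univ_sum_single e, Finset.subset_univ _⟩

lemma hasSubst_subst_X {g : PowerSeries R} (hg : constantCoeff g = 0) :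
    MvPowerSeries.HasSubst fun i => g.subst (MvPowerSeries.X i : MvPowerSeries (Fin n) R) :=
  MvPowerSeries.hasSubst_of_constantCoeff_zero (constantCoeff_subst_X hg)

lemma coeff_subst_subst_X {g : PowerSeries R} (hg : constantCoeff g = 0)
    (f : MvPowerSeries (Fin n) R) (e : Fin n →₀ ℕ) :
    MvPowerSeries.coeff e
        (f.subst fun i => g.subst (MvPowerSeries.X i : MvPowerSeries (Fin n) R)) =
      ∑ p ∈ Fintype.piFinset fun i => Finset.range (e i + 1),
        MvPowerSeries.coeff (Finsupp.equivFunOnFinite.symm p) f * ∏ i, coeff (e i) (g ^ p i) := by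
  have coeff_prod_pow : ∀ d : Fin n →₀ ℕ, MvPowerSeries.coeff e
      (d.prod fun i m => (g.subst (MvPowerSeries.X i : MvPowerSeries (Fin n) R)) ^ m) =
        ∏ i, coeff (e i) (g ^ d i) := fun d => by
    rw [Finsupp.prod_fintype _ _ fun _ => pow_zero _]
    simp only [← subst_pow (HasSubst.X _)]
    exact coeff_prod_subst_X _ e
  rw [MvPowerSeries.coeff_subst (hasSubst_subst_X hg),
    ← finsum_comp_equiv Finsupp.equivFunOnFinite.symm]
  simp only [coeff_prod_pow, smul_eq_mul, Finsupp.equivFunOnFinite_symm_apply_apply]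
  refine finsum_eq_sum_of_support_subset _ fun p hp => ?_
  rw [Finset.mem_coe, Fintype.mem_piFinset]
  intro i
  by_contra p_large
  refine hp (mul_eq_zero_of_right _ (Finset.prod_eq_zero (Finset.mem_univ i) ?_))
  exact coeff_pow_eq_zero_of_lt hg (by simpa using p_large)

end SubstVariables

section EvenSeries

open PowerSeries

variable {R : Type*} [CommRing R]

lemma constantCoeff_eq_zero_of_odd {f : PowerSeries R} (hf : ∀ n, Even n → coeff n f = 0) :
    constantCoeff f = 0 := by
  rw [← coeff_zero_eq_constantCoeff_apply, hf 0 Even.zero]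

lemma hasSubst_of_odd {f : PowerSeries R} (hf : ∀ n, Even n → coeff n f = 0) : HasSubst f :=
  HasSubst.of_constantCoeff_zero' (constantCoeff_eq_zero_of_odd hf)

lemma rescale_neg_one_lagrangeQ {u v : PowerSeries R} (hu : ∀ n, Odd n → coeff n u = 0)
    (hv : ∀ n, Odd n → coeff n v = 0) :
    rescale (-1 : R) (lagrangeQ u v) = lagrangeQ u v := by
  have derivative_odd : ∀ n, Even n → coeff n (derivative R v) = 0 := fun n hn => by
    rw [coeff_derivative, hv _ hn.add_one, zero_mul]
  rw [lagrangeQ, map_sub, map_mul, map_mul, map_one, rescale_neg_one_of_odd derivative_odd,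
    rescale_neg_one_of_even hu, rescale_X, map_neg, map_one]
  ring

lemma coeff_oddSeries_mul_coeff_mul_coeff_of_even {f g : PowerSeries R}
    (hf : ∀ n, Odd n → coeff n f = 0) (hg : ∀ n, Odd n → coeff n g = 0) (a b n : ℕ) :
    coeff n (oddSeries R) * (coeff a (X ^ n * f) * coeff (b + n) g) =
      if Odd a ∧ Odd b ∧ n ≤ a then (n : R) * (coeff (a - n) f * coeff (b + n) g) else 0 := by
  rw [coeff_oddSeries, coeff_X_pow_mul']
  by_cases hn : n ≤ a
  · by_cases odd_sub : Odd (a - n)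
    · simp [hf _ odd_sub]
    by_cases odd_add : Odd (b + n)
    · simp [hg _ odd_add]
    rw [Nat.not_odd_iff_even, Nat.even_sub hn] at odd_sub
    rw [Nat.not_odd_iff_even, Nat.even_add] at odd_add
    simp only [← Nat.not_even_iff_odd, odd_sub, odd_add, hn, and_self, and_true, if_true,
      ite_mul, zero_mul]
  · simp [hn]

variable [NoZeroDivisors R] [CharZero R]

lemma coeff_pow_of_even {f : PowerSeries R} (hf : ∀ n, Odd n → coeff n f = 0) (k : ℕ) {n : ℕ}
    (hn : Odd n) : coeff n (f ^ k) = 0 := by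
  refine coeff_eq_zero_of_rescale_neg_one (p := 0) ?_ (by rwa [zero_add])
  rw [map_pow, rescale_neg_one_of_even hf, pow_zero, one_mul]

lemma coeff_subst_of_even {f g : PowerSeries R} (hf : ∀ n, Odd n → coeff n f = 0)
    (hg : ∀ n, Even n → coeff n g = 0) {N : ℕ} (hN : Odd N) : coeff N (f.subst g) = 0 := by
  rw [coeff_subst_eq_sum f (constantCoeff_eq_zero_of_odd hg) N.lt_succ_self]
  refine Finset.sum_eq_zero fun n _ => ?_
  rcases Nat.even_or_odd n with even_n | odd_n
  · rw [coeff_eq_zero_of_rescale_neg_one (p := n) _ (even_n.add_odd hN), mul_zero]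
    rw [map_pow, rescale_neg_one_of_odd hg, neg_pow]
  · rw [hf n odd_n, zero_mul]

lemma coeff_lagrangeQ_mul_mul_pow_of_derivative_eq {u v : PowerSeries R} (huv : u * v = 1)
    {f F : PowerSeries R} {k : ℕ} (hk : k ≠ 0) (hF : derivative R F = derivative R f * v ^ k) :
    coeff k (lagrangeQ u v * f * v ^ k) = coeff k F := by
  have cast_mul_eq := natCast_mul_coeff_lagrangeQ_mul_mul_pow huv f k
  rw [← hF, coeff_X_mul_derivative] at cast_mul_eq
  exact mul_left_cancel₀ (Nat.cast_ne_zero.2 hk) cast_mul_eq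

end EvenSeries

section UnitPart

open PowerSeries

variable (psi y : ℕ → PowerSeries ℂ)

/-- The unit `X(z) / z = e^{-2 ψ(y(z))}`. -/
def unitPart : PowerSeries ℂ := expSeries (-2 * (psi 0).subst (y 0))

/-- The unit `z / X(z) = e^{2 ψ(y(z))}`. -/
def unitPartInv : PowerSeries ℂ := (expSeries (2 * psi 0)).subst (y 0)

/-- The series `Q(z) = z X'(z) / X(z)`. -/
def qSer : PowerSeries ℂ := lagrangeQ (unitPart psi y) (unitPartInv psi y)

lemma Xser_eq : Xser psi y = X * unitPart psi y := rfl

lemma constantCoeff_Xser : constantCoeff (Xser psi y) = 0 := by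
  rw [Xser_eq, map_mul, constantCoeff_X, zero_mul]

lemma exists_derivative_eq (E : PowerSeries ℂ) :
    ∃ F : PowerSeries ℂ, derivative ℂ F = E ∧ constantCoeff F = 0 := by
  refine ⟨PowerSeries.mk fun n => coeff (n - 1) E / n, ?_, by simp⟩
  ext n
  have := Nat.cast_add_one_ne_zero (R := ℂ) n
  simp [coeff_derivative, this]

variable {psi y}

lemma unitPart_mul_unitPartInv (hy : ∀ n, Even n → coeff n (y 0) = 0) :
    unitPart psi y * unitPartInv psi y = 1 := by
  have subst_two_mul : (2 * psi 0).subst (y 0) = 2 * (psi 0).subst (y 0) := by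
    rw [two_mul, two_mul, subst_add (hasSubst_of_odd hy)]
  rw [unitPart, unitPartInv, expSeries_subst _ (constantCoeff_eq_zero_of_odd hy), subst_two_mul,
    mul_comm, neg_mul, expSeries_mul_neg]

lemma subst_expSeries_pow (hy : ∀ n, Even n → coeff n (y 0) = 0) (k : ℕ) :
    (expSeries (2 * psi 0) ^ k).subst (y 0) = unitPartInv psi y ^ k :=
  subst_pow (hasSubst_of_odd hy) _ _

lemma coeff_unitPart_of_odd (hpsi : ∀ n, Odd n → coeff n (psi 0) = 0)
    (hy : ∀ n, Even n → coeff n (y 0) = 0) (n : ℕ) (hn : Odd n) :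
    coeff n (unitPart psi y) = 0 := by
  refine coeff_eq_zero_of_rescale_neg_one (p := 0) ?_ (by rwa [zero_add])
  rw [unitPart, rescale_expSeries, map_mul,
    rescale_neg_one_of_even fun _ => coeff_subst_of_even hpsi hy, map_neg, map_ofNat, pow_zero,
    one_mul]

lemma coeff_unitPartInv_of_odd (hpsi : ∀ n, Odd n → coeff n (psi 0) = 0)
    (hy : ∀ n, Even n → coeff n (y 0) = 0) (n : ℕ) (hn : Odd n) :
    coeff n (unitPartInv psi y) = 0 := by
  refine coeff_subst_of_even (fun m hm => ?_) hy hn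
  refine coeff_eq_zero_of_rescale_neg_one (p := 0) ?_ (by rwa [zero_add])
  rw [rescale_expSeries, map_mul, rescale_neg_one_of_even hpsi, map_ofNat, pow_zero, one_mul]

end UnitPart

section OnePoint

open PowerSeries

variable {psi y : ℕ → PowerSeries ℂ}

lemma coeff_W_one (hpsi : ∀ d n, Odd n → coeff n (psi d) = 0)
    (hy : ∀ n, Even n → coeff n (y 0) = 0) (m : Fin 1 →₀ ℕ) :
    MvPowerSeries.coeff m (W psi y 0 1) =
      1 / 2 * coeff (m 0) (qSer psi y * y 0 * unitPartInv psi y ^ m 0) := by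
  obtain ⟨F, hF, hF0⟩ := exists_derivative_eq (expSeries (2 * psi 0) ^ m 0)
  rw [coeff_W_one_of_derivative_eq hpsi hy m hF hF0, qSer]
  split_ifs with odd_m
  · rw [coeff_lagrangeQ_mul_mul_pow_of_derivative_eq (unitPart_mul_unitPartInv hy) odd_m.pos.ne']
    rw [derivative_subst (hasSubst_of_odd hy), hF, subst_expSeries_pow hy, mul_comm]
  · rw [coeff_eq_zero_of_rescale_neg_one (p := 1) _ (Nat.not_odd_iff_even.1 odd_m).one_add,
      mul_zero]
    rw [map_mul, map_mul, map_pow, rescale_neg_one_of_odd hy,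
      rescale_neg_one_of_even (coeff_unitPartInv_of_odd (hpsi 0) hy),
      rescale_neg_one_lagrangeQ (coeff_unitPart_of_odd (hpsi 0) hy)
        (coeff_unitPartInv_of_odd (hpsi 0) hy)]
    ring

theorem WofZ_one (hpsi : ∀ d n, Odd n → coeff n (psi d) = 0)
    (hy : ∀ n, Even n → coeff n (y 0) = 0) :
    WofZ psi y 0 1 =
      (C (1 / 2 : ℂ) * y 0).subst (MvPowerSeries.X 0 : MvPowerSeries (Fin 1) ℂ) := by
  ext e
  have sum_eq := Finset.prod_univ_sum (fun i : Fin 1 => Finset.range (e i + 1)) fun i k =>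
    coeff (e i) (Xser psi y ^ k) * coeff k (qSer psi y * y 0 * unitPartInv psi y ^ k)
  simp only [Fin.prod_univ_one] at sum_eq
  rw [WofZ, coeff_subst_subst_X (constantCoeff_Xser psi y), coeff_fin_one, coeff_C_mul,
    ← lagrange_inversion (unitPart_mul_unitPartInv (psi := psi) hy) (y 0) (e 0).lt_succ_self,
    ← Xser_eq, ← qSer, sum_eq, Finset.mul_sum]
  refine Finset.sum_congr rfl fun p _ => ?_
  rw [coeff_W_one hpsi hy, Fin.prod_univ_one, Finsupp.equivFunOnFinite_symm_apply_apply]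
  ring

end OnePoint

section TwoPoint

open PowerSeries

variable {psi y : ℕ → PowerSeries ℂ}

lemma coeff_W_two_eq_sum_oddSeries (hpsi : ∀ d n, Odd n → coeff n (psi d) = 0)
    (hy : ∀ n, Even n → coeff n (y 0) = 0) (m : Fin 2 →₀ ℕ) {M : ℕ} (hM : m 0 < M) :
    MvPowerSeries.coeff m (W psi y 0 2) =
      1 / 2 * ∑ n ∈ Finset.range M, coeff n (oddSeries ℂ) *
        (coeff (m 0) (X ^ n * unitPartInv psi y ^ m 0) *
          coeff (m 1 + n) (unitPartInv psi y ^ m 1)) := by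
  have even_pow : ∀ k n, Odd n → coeff n (unitPartInv psi y ^ k) = 0 := fun k n =>
    coeff_pow_of_even (coeff_unitPartInv_of_odd (hpsi 0) hy) k
  rw [coeff_W_two hpsi hy]
  simp only [coeff_oddSeries_mul_coeff_mul_coeff_of_even (even_pow _) (even_pow _),
    subst_expSeries_pow hy, ← and_assoc]
  split_ifs with odd_m
  · simp only [odd_m, true_and, ← Finset.sum_filter, and_self]
    have filter_range : {n ∈ Finset.range M | n ≤ m 0} = Finset.range (m 0 + 1) := by
      ext n
      simp only [Finset.mem_filter, Finset.mem_range]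
      omega
    rw [filter_range, Finset.mul_sum]
    exact Finset.sum_congr rfl fun n _ => by ring
  · simp [odd_m]

lemma coeff_mul_coeff_tailSer {k : Type*} [Field k] [CharZero k] {u v : PowerSeries k}
    (huv : u * v = 1) (f : PowerSeries k) (n : ℕ) (e : Fin 2 →₀ ℕ) :
    coeff (e 0) (f * (lagrangeQ u v)⁻¹) * coeff (e 1) (tailSer u v n) =
      ∑ p ∈ Fintype.piFinset fun i => Finset.range (e i + 1),
        coeff (p 0) (f * v ^ p 0) * coeff (p 1 + n) (v ^ p 1) *
          ∏ i, coeff (e i) ((X * u) ^ p i) := by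
  have sum_eq := Finset.prod_univ_sum (fun i : Fin 2 => Finset.range (e i + 1)) fun i j =>
    coeff (e i) ((X * u) ^ j) * ![coeff j (f * v ^ j), coeff (j + n) (v ^ j)] i
  simp only [Fin.prod_univ_two, Matrix.cons_val_zero, Matrix.cons_val_one] at sum_eq ⊢
  rw [tailSer, coeff_subst_eq_sum _ (by simp) (e 1).lt_succ_self,
    ← lagrange_inversion_mul_inv huv _ (e 0).lt_succ_self]
  simp only [coeff_mk, mul_comm (coeff (_ + n) _)]
  rw [sum_eq]
  exact Finset.sum_congr rfl fun p _ => by ring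

lemma coeff_WofZ_two (hpsi : ∀ d n, Odd n → coeff n (psi d) = 0)
    (hy : ∀ n, Even n → coeff n (y 0) = 0) (e : Fin 2 →₀ ℕ) :
    MvPowerSeries.coeff e (WofZ psi y 0 2) =
      1 / 2 * ∑ n ∈ Finset.range (e 0 + 1), coeff n (oddSeries ℂ) *
        coeff (e 0) (X ^ n * (qSer psi y)⁻¹) *
          coeff (e 1) (tailSer (unitPart psi y) (unitPartInv psi y) n) := by
  rw [WofZ, coeff_subst_subst_X (constantCoeff_Xser psi y), qSer]
  simp only [mul_assoc (coeff _ (oddSeries ℂ)), Finset.mul_sum,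
    coeff_mul_coeff_tailSer (unitPart_mul_unitPartInv hy), ← Xser_eq]
  rw [Finset.sum_comm]
  refine Finset.sum_congr rfl fun p hp => ?_
  rw [coeff_W_two_eq_sum_oddSeries hpsi hy _
    (Finset.mem_range.1 (Fintype.mem_piFinset.1 hp 0)), Finset.mul_sum, Finset.sum_mul]
  simp only [Finsupp.equivFunOnFinite_symm_apply_apply, mul_assoc]

end TwoPoint

section Fractions

open PowerSeries

instance instCharZeroFrac (n : ℕ) : CharZero (Frac n) :=
  charZero_of_injective_ringHom
    ((algebraMap (MvPowerSeries (Fin n) ℂ) (Frac n)).comp MvPowerSeries.C).injective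

/-- The substitution `f ↦ f(z_i)` as a ring homomorphism. -/
def substVar {n : ℕ} (i : Fin n) : PowerSeries ℂ →+* MvPowerSeries (Fin n) ℂ :=
  (substAlgHom (R := ℂ) (HasSubst.X (S := ℂ) i)).toRingHom

lemma substVar_apply {n : ℕ} (i : Fin n) (f : PowerSeries ℂ) :
    substVar i f = f.subst (MvPowerSeries.X i : MvPowerSeries (Fin n) ℂ) := by
  simp [substVar, coe_substAlgHom]

/-- The substitution `f ↦ f(z_i)` as a ring homomorphism into the field of fractions: a bundled
`atZ`. -/
def atZHom {n : ℕ} (i : Fin n) : PowerSeries ℂ →+* Frac n :=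
  (algebraMap (MvPowerSeries (Fin n) ℂ) (Frac n)).comp (substVar i)

lemma algebraMap_substVar {n : ℕ} (i : Fin n) (f : PowerSeries ℂ) :
    algebraMap (MvPowerSeries (Fin n) ℂ) (Frac n) (substVar i f) = atZHom i f := rfl

lemma atZ_eq_atZHom {n : ℕ} (f : PowerSeries ℂ) (i : Fin n) : atZ f i = atZHom i f := by
  rw [atZ, ← substVar_apply, algebraMap_substVar]

lemma atZHom_C {n : ℕ} (i : Fin n) (c : ℂ) :
    atZHom i (C c) = algebraMap (MvPowerSeries (Fin n) ℂ) (Frac n) (MvPowerSeries.C c) := by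
  rw [← algebraMap_substVar, substVar_apply, PowerSeries.subst_C]

lemma atZHom_ne_zero {n : ℕ} (i : Fin n) {f : PowerSeries ℂ} (hf : f ≠ 0) : atZHom i f ≠ 0 := by
  have injective : Function.Injective (substVar i) := fun f g h =>
    subst_X_injective i (by simpa only [substVar_apply] using h)
  rw [← algebraMap_substVar, Ne, IsFractionRing.to_map_eq_zero_iff]
  exact (map_ne_zero_iff _ injective).2 hf

lemma atZHom_zero_ne_atZHom_one {f : PowerSeries ℂ} {m : ℕ} (hm : m ≠ 0) (hf : coeff m f ≠ 0) :
    (atZHom 0 f : Frac 2) ≠ atZHom 1 f := by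
  rw [← algebraMap_substVar, ← algebraMap_substVar, substVar_apply, substVar_apply]
  intro h
  have coeff_eq := congrArg (MvPowerSeries.coeff (Finsupp.single (0 : Fin 2) m))
    (IsFractionRing.injective _ (Frac 2) h)
  rw [coeff_subst_X, coeff_subst_X, if_pos (by simp), if_neg] at coeff_eq
  · exact hf (by simpa using coeff_eq)
  · intro single_eq
    exact hm (by simpa using congrArg (fun e => e 0) single_eq)

end Fractions

section ExpandFirst

open PowerSeries

/-- The embedding of `ℂ⟦z_1, z_2⟧` into the power series in `z_1` over the fractions in `z_2`. -/
def expandFirst : MvPowerSeries (Fin 2) ℂ →+* PowerSeries (Frac 1) :=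
  (PowerSeries.map (algebraMap (MvPowerSeries (Fin 1) ℂ) (Frac 1))).comp
    (MvPowerSeries.finSuccEquiv ℂ 1).toRingEquiv.toRingHom

lemma expandFirst_apply (f : MvPowerSeries (Fin 2) ℂ) : expandFirst f =
    PowerSeries.map (algebraMap (MvPowerSeries (Fin 1) ℂ) (Frac 1))
      (MvPowerSeries.finSuccEquiv ℂ 1 f) := rfl

lemma expandFirst_injective : Function.Injective expandFirst := by
  intro f g h
  rw [expandFirst_apply, expandFirst_apply] at h
  exact (MvPowerSeries.finSuccEquiv ℂ 1).injective
    (PowerSeries.map_injective _ (IsFractionRing.injective _ _) h)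

lemma expandFirst_substVar_zero (f : PowerSeries ℂ) :
    expandFirst (substVar 0 f) = PowerSeries.map ((atZHom 0).comp C) f := by
  rw [expandFirst_apply, substVar_apply, finSuccEquiv_subst_X_zero]
  ext m
  simp only [coeff_map, RingHom.comp_apply, atZHom_C]

lemma expandFirst_substVar_one (f : PowerSeries ℂ) :
    expandFirst (substVar 1 f) = C (atZHom 0 f) := by
  rw [expandFirst_apply, substVar_apply, ← Fin.succ_zero_eq_one, finSuccEquiv_subst_X_succ,
    PowerSeries.map_C, ← substVar_apply, algebraMap_substVar]

variable {psi y : ℕ → PowerSeries ℂ}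

lemma coeff_finSuccEquiv_WofZ (hpsi : ∀ d n, Odd n → coeff n (psi d) = 0)
    (hy : ∀ n, Even n → coeff n (y 0) = 0) (m : ℕ) :
    2 * coeff m (MvPowerSeries.finSuccEquiv ℂ 1 (WofZ psi y 0 2)) =
      ∑ n ∈ Finset.range (m + 1),
        MvPowerSeries.C (coeff n (oddSeries ℂ) * coeff m (X ^ n * (qSer psi y)⁻¹)) *
          substVar 0 (tailSer (unitPart psi y) (unitPartInv psi y) n) := by
  ext x
  rw [show (2 : MvPowerSeries (Fin 1) ℂ) = MvPowerSeries.C 2 from (map_ofNat _ 2).symm,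
    MvPowerSeries.coeff_C_mul, MvPowerSeries.coeff_coeff_finSuccEquiv, coeff_WofZ_two hpsi hy,
    map_sum, ← mul_assoc, mul_one_div_cancel two_ne_zero, one_mul]
  simp only [MvPowerSeries.coeff_C_mul, substVar_apply, coeff_fin_one, Finsupp.cons_zero]
  rfl

lemma Xser_ne_zero (hy : ∀ n, Even n → coeff n (y 0) = 0) : Xser psi y ≠ 0 :=
  mul_ne_zero X_ne_zero (left_ne_zero_of_mul_eq_one (unitPart_mul_unitPartInv hy))

lemma two_mul_expandFirst_WofZ (hpsi : ∀ d n, Odd n → coeff n (psi d) = 0)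
    (hy : ∀ n, Even n → coeff n (y 0) = 0) :
    2 * expandFirst (WofZ psi y 0 2) =
      (oddSeries (Frac 1)).subst (C (atZHom 0 X)⁻¹ * X : PowerSeries (Frac 1)) *
        (PowerSeries.map ((atZHom 0).comp C) (qSer psi y)⁻¹ * C (atZHom 0 (qSer psi y)⁻¹)) -
      (oddSeries (Frac 1)).subst (C (atZHom 0 (Xser psi y))⁻¹ *
          PowerSeries.map ((atZHom 0).comp C) (Xser psi y)) := by
  ext m
  rw [qSer, Xser_eq, ← sum_map_mul_map_tailSer (atZHom 0) (unitPart_mul_unitPartInv hy)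
    (coeff_unitPart_of_odd (hpsi 0) hy) (atZHom_ne_zero 0 (Xser_ne_zero hy)) m, ← qSer,
    show (2 : PowerSeries (Frac 1)) = C 2 from (map_ofNat C 2).symm, coeff_C_mul,
    expandFirst_apply, coeff_map, ← map_ofNat (algebraMap (MvPowerSeries (Fin 1) ℂ) (Frac 1)) 2,
    ← map_mul, coeff_finSuccEquiv_WofZ hpsi hy, map_sum]
  simp only [map_mul (algebraMap (MvPowerSeries (Fin 1) ℂ) (Frac 1)), atZHom_C,
    algebraMap_substVar]

lemma qSer_mul_inv (psi y : ℕ → PowerSeries ℂ) : qSer psi y * (qSer psi y)⁻¹ = 1 :=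
  lagrangeQ_mul_inv _ _

lemma two_mul_mul_of_eq_kernel_sub_kernel {R : Type*} [CommRing R] {z w x t q q' r r' G H W : R}
    (hW : 2 * W = G * (q' * r') - H) (hq : q * q' = 1) (hr : r * r' = 1)
    (hG : (w ^ 2 - z ^ 2) ^ 2 * G = z * w * (w ^ 2 + z ^ 2))
    (hH : (t ^ 2 - x ^ 2) ^ 2 * H = x * t * (t ^ 2 + x ^ 2)) :
    2 * W * (q * r) * ((w ^ 2 - z ^ 2) ^ 2 * (t ^ 2 - x ^ 2) ^ 2) =
      z * w * (w ^ 2 + z ^ 2) * (t ^ 2 - x ^ 2) ^ 2 -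
        q * r * (x * t * (t ^ 2 + x ^ 2)) * (w ^ 2 - z ^ 2) ^ 2 := by
  linear_combination q * r * ((w ^ 2 - z ^ 2) ^ 2 * (t ^ 2 - x ^ 2) ^ 2) * hW +
    (t ^ 2 - x ^ 2) ^ 2 * (q * q' * r * r') * hG +
    z * w * (w ^ 2 + z ^ 2) * (t ^ 2 - x ^ 2) ^ 2 * (r * r' * hq + hr) -
    q * r * (w ^ 2 - z ^ 2) ^ 2 * hH

lemma two_mul_WofZ_two_mul (hpsi : ∀ d n, Odd n → coeff n (psi d) = 0)
    (hy : ∀ n, Even n → coeff n (y 0) = 0) :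
    2 * WofZ psi y 0 2 * (substVar 0 (qSer psi y) * substVar 1 (qSer psi y)) *
        ((substVar 1 X ^ 2 - substVar 0 X ^ 2) ^ 2 *
          (substVar 1 (Xser psi y) ^ 2 - substVar 0 (Xser psi y) ^ 2) ^ 2) =
      substVar 0 X * substVar 1 X * (substVar 1 X ^ 2 + substVar 0 X ^ 2) *
          (substVar 1 (Xser psi y) ^ 2 - substVar 0 (Xser psi y) ^ 2) ^ 2 -
        substVar 0 (qSer psi y) * substVar 1 (qSer psi y) *
          (substVar 0 (Xser psi y) * substVar 1 (Xser psi y) *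
            (substVar 1 (Xser psi y) ^ 2 + substVar 0 (Xser psi y) ^ 2)) *
          (substVar 1 X ^ 2 - substVar 0 X ^ 2) ^ 2 := by
  apply expandFirst_injective
  have cancel_q₁ : PowerSeries.map ((atZHom (0 : Fin 1)).comp C) (qSer psi y) *
      PowerSeries.map ((atZHom (0 : Fin 1)).comp C) (qSer psi y)⁻¹ = 1 := by
    rw [← map_mul, qSer_mul_inv, map_one]
  have cancel_q₂ :
      C (atZHom (0 : Fin 1) (qSer psi y)) * C (atZHom (0 : Fin 1) (qSer psi y)⁻¹) = 1 := by
    rw [← map_mul, ← map_mul, qSer_mul_inv, map_one, map_one]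
  have kernel_z := sq_sub_sq_sq_mul_oddSeries_subst
    (atZHom_ne_zero (0 : Fin 1) X_ne_zero) (f := X) constantCoeff_X
  have kernel_X := sq_sub_sq_sq_mul_oddSeries_subst
    (atZHom_ne_zero (0 : Fin 1) (Xser_ne_zero (psi := psi) hy))
    (f := PowerSeries.map ((atZHom 0).comp C) (Xser psi y))
    (by rw [Xser_eq, map_mul, PowerSeries.map_X, map_mul, constantCoeff_X, zero_mul])
  simp only [map_mul expandFirst, map_sub expandFirst, map_add expandFirst, map_pow expandFirst,
    map_ofNat expandFirst, expandFirst_substVar_zero, expandFirst_substVar_one,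
    PowerSeries.map_X]
  exact two_mul_mul_of_eq_kernel_sub_kernel (two_mul_expandFirst_WofZ hpsi hy)
    cancel_q₁ cancel_q₂ kernel_z kernel_X

end ExpandFirst

section Differentials

open PowerSeries

variable {psi y : ℕ → PowerSeries ℂ}

lemma Q_eq_atZHom (hy : ∀ n, Even n → coeff n (y 0) = 0) {n : ℕ} (i : Fin n) :
    Q psi y i = atZHom i (qSer psi y) := by
  have derivative_eq := congrArg (atZHom i)
    (X_mul_derivative_X_mul (unitPart_mul_unitPartInv (psi := psi) hy))
  rw [← Xser_eq, map_mul (atZHom i), map_mul (atZHom i), ← qSer] at derivative_eq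
  rw [Q, zVar, dlogX, XVar, atZ_eq_atZHom, atZ_eq_atZHom, atZ_eq_atZHom, ← mul_div_assoc,
    derivative_eq, mul_div_cancel_right₀ _ (atZHom_ne_zero i (Xser_ne_zero hy))]

lemma Q_ne_zero (hy : ∀ n, Even n → coeff n (y 0) = 0) {n : ℕ} (i : Fin n) :
    Q psi y i ≠ 0 := by
  rw [Q_eq_atZHom hy]
  exact atZHom_ne_zero i (left_ne_zero_of_mul_eq_one (qSer_mul_inv psi y))

lemma zVar_ne_zero {n : ℕ} (i : Fin n) : zVar i ≠ 0 := by
  rw [zVar, atZ_eq_atZHom]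
  exact atZHom_ne_zero i X_ne_zero

lemma zVar_sq_ne_zVar_sq : (zVar 0 : Frac 2) ^ 2 ≠ zVar 1 ^ 2 := by
  rw [zVar, zVar, atZ_eq_atZHom, atZ_eq_atZHom, ← map_pow, ← map_pow]
  exact atZHom_zero_ne_atZHom_one two_ne_zero (by simp)

lemma XVar_sq_ne_XVar_sq (hy : ∀ n, Even n → coeff n (y 0) = 0) :
    (XVar psi y 0 : Frac 2) ^ 2 ≠ XVar psi y 1 ^ 2 := by
  rw [XVar, XVar, atZ_eq_atZHom, atZ_eq_atZHom, ← map_pow, ← map_pow]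
  refine atZHom_zero_ne_atZHom_one two_ne_zero ?_
  have constantCoeff_mul := congrArg constantCoeff (unitPart_mul_unitPartInv (psi := psi) hy)
  rw [map_mul, map_one] at constantCoeff_mul
  rw [Xser_eq, mul_pow, coeff_X_pow_mul', if_pos le_rfl, Nat.sub_self,
    coeff_zero_eq_constantCoeff_apply, map_pow]
  exact pow_ne_zero 2 (left_ne_zero_of_mul_eq_one constantCoeff_mul)

lemma B_eq_div {F : Type*} [Field F] {z w : F} (h : z ^ 2 ≠ w ^ 2) :
    B z w = 2 * (z * w * (w ^ 2 + z ^ 2)) / (w ^ 2 - z ^ 2) ^ 2 := by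
  have z_sub_w_ne : z - w ≠ 0 := fun h' => h (by rw [sub_eq_zero.1 h'])
  have z_add_w_ne : z + w ≠ 0 := fun h' => h (by rw [eq_neg_of_add_eq_zero_left h', neg_sq])
  rw [B, show (w ^ 2 - z ^ 2) ^ 2 = (z - w) ^ 2 * (z + w) ^ 2 by ring]
  field_simp
  ring

theorem algebraMap_WofZ_one (hpsi : ∀ d n, Odd n → coeff n (psi d) = 0)
    (hy : ∀ n, Even n → coeff n (y 0) = 0) :
    algebraMap (MvPowerSeries (Fin 1) ℂ) (Frac 1) (WofZ psi y 0 1) = atZ (y 0) 0 / 2 := by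
  have two_mul_y : (2 : PowerSeries ℂ) * (C (1 / 2 : ℂ) * y 0) = y 0 := by
    rw [← mul_assoc, ← map_ofNat (C (R := ℂ)) 2, ← map_mul, mul_one_div_cancel two_ne_zero,
      map_one, one_mul]
  rw [WofZ_one hpsi hy, ← substVar_apply, algebraMap_substVar, atZ_eq_atZHom,
    eq_div_iff two_ne_zero, mul_comm, ← map_ofNat (atZHom (0 : Fin 1)) 2, ← map_mul, two_mul_y]

theorem algebraMap_WofZ_two (hpsi : ∀ d n, Odd n → coeff n (psi d) = 0)
    (hy : ∀ n, Even n → coeff n (y 0) = 0) :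
    algebraMap (MvPowerSeries (Fin 2) ℂ) (Frac 2) (WofZ psi y 0 2) =
      1 / (4 * Q psi y 0 * Q psi y 1) * B (zVar 0) (zVar 1) -
        1 / 4 * B (XVar psi y 0) (XVar psi y 1) := by
  have cleared := congrArg (algebraMap (MvPowerSeries (Fin 2) ℂ) (Frac 2))
    (two_mul_WofZ_two_mul hpsi hy)
  simp only [map_mul (algebraMap (MvPowerSeries (Fin 2) ℂ) (Frac 2)),
    map_sub (algebraMap (MvPowerSeries (Fin 2) ℂ) (Frac 2)),
    map_add (algebraMap (MvPowerSeries (Fin 2) ℂ) (Frac 2)),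
    map_pow (algebraMap (MvPowerSeries (Fin 2) ℂ) (Frac 2)),
    map_ofNat (algebraMap (MvPowerSeries (Fin 2) ℂ) (Frac 2)), algebraMap_substVar,
    ← Q_eq_atZHom hy, ← atZ_eq_atZHom, ← zVar.eq_def, ← XVar.eq_def] at cleared
  have Q₁_ne_zero := Q_ne_zero (psi := psi) hy (0 : Fin 2)
  have Q₂_ne_zero := Q_ne_zero (psi := psi) hy (1 : Fin 2)
  have z_ne := sub_ne_zero.2 zVar_sq_ne_zVar_sq.symm
  have X_ne := sub_ne_zero.2 (XVar_sq_ne_XVar_sq (psi := psi) hy).symm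
  rw [B_eq_div zVar_sq_ne_zVar_sq, B_eq_div (XVar_sq_ne_XVar_sq hy)]
  field_simp
  linear_combination 2 * cleared

lemma dlogX_eq_Q_div_zVar {n : ℕ} (i : Fin n) : dlogX psi y i = Q psi y i / zVar i := by
  rw [Q, mul_div_cancel_left₀ _ (zVar_ne_zero i)]

theorem omega_one (hpsi : ∀ d n, Odd n → coeff n (psi d) = 0)
    (hy : ∀ n, Even n → coeff n (y 0) = 0) :
    omega psi y 0 1 = atZ (y 0) 0 * dlogX psi y 0 := by
  have two_zpow : (2 : Frac 1) ^ (1 - ((0 : ℕ) : ℤ)) = 2 := by simp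
  have omegaShift_eq_zero : omegaShift psi y 0 1 = 0 := rfl
  rw [omega, algebraMap_WofZ_one hpsi hy, two_zpow, omegaShift_eq_zero, Fin.prod_univ_one,
    add_zero, mul_div_cancel₀ _ two_ne_zero]

theorem omega_two (hpsi : ∀ d n, Odd n → coeff n (psi d) = 0)
    (hy : ∀ n, Even n → coeff n (y 0) = 0) :
    omega psi y 0 2 = 1 / 2 * (1 / (zVar 0 - zVar 1) ^ 2 + 1 / (zVar 0 + zVar 1) ^ 2) := by
  have two_zpow : (2 : Frac 2) ^ (1 - ((0 : ℕ) : ℤ)) = 2 := by simp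
  have Q₁_ne_zero := Q_ne_zero (psi := psi) hy (0 : Fin 2)
  have Q₂_ne_zero := Q_ne_zero (psi := psi) hy (1 : Fin 2)
  have B_eq : B (zVar 0) (zVar 1) = zVar 0 * zVar 1 *
      (1 / (zVar 0 - zVar 1) ^ 2 + 1 / (zVar 0 + zVar 1) ^ 2 : Frac 2) := by
    rw [B]
    ring
  calc omega psi y 0 2
      = B (zVar 0) (zVar 1) / (2 * Q psi y 0 * Q psi y 1) *
          (Q psi y 0 / zVar 0 * (Q psi y 1 / zVar 1)) := by
        rw [omega, algebraMap_WofZ_two hpsi hy, omegaShift, Fin.prod_univ_two, two_zpow,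
          dlogX_eq_Q_div_zVar, dlogX_eq_Q_div_zVar]
        ring
    _ = B (zVar 0) (zVar 1) / (zVar 0 * zVar 1) / 2 := by field_simp
    _ = _ := by
        rw [B_eq, mul_div_cancel_left₀ _ (mul_ne_zero (zVar_ne_zero 0) (zVar_ne_zero 1))]
        ring

end Differentials

end

end BKP

theorem mainTheorem7 (psi y : ℕ → PowerSeries ℂ)
    (hpsi : ∀ d n, Odd n → PowerSeries.coeff n (psi d) = 0)
    (hy : ∀ d n, Even n → PowerSeries.coeff n (y d) = 0) :
    algebraMap (MvPowerSeries (Fin 1) ℂ) (BKP.Frac 1) (BKP.WofZ psi y 0 1) =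
        BKP.atZ (y 0) 0 / 2 ∧
    algebraMap (MvPowerSeries (Fin 2) ℂ) (BKP.Frac 2) (BKP.WofZ psi y 0 2) =
        1 / (4 * BKP.Q psi y 0 * BKP.Q psi y 1) * BKP.B (BKP.zVar 0) (BKP.zVar 1) -
          1 / 4 * BKP.B (BKP.XVar psi y 0) (BKP.XVar psi y 1) ∧
    BKP.omega psi y 0 1 = BKP.atZ (y 0) 0 * BKP.dlogX psi y 0 ∧
    BKP.omega psi y 0 2 =
        1 / 2 * (1 / (BKP.zVar 0 - BKP.zVar 1) ^ 2 + 1 / (BKP.zVar 0 + BKP.zVar 1) ^ 2) :=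
  ⟨BKP.algebraMap_WofZ_one hpsi (hy 0), BKP.algebraMap_WofZ_two hpsi (hy 0),
    BKP.omega_one hpsi (hy 0), BKP.omega_two hpsi (hy 0)⟩
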